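/- **Setting.** Let $Z$ be a real Hilbert space and let $A$ be a sectorial operator in $Z$ with compact resolvent that generates an exponentially stable analytic semigroup $e^{At}$. For $s\ge 0$ let $Z^{s}=\operatorname{ran}\,(-A)^{-s}$ with norm $\|\varphi\|_s=\|(-A)^s\varphi\|$, and for $0\le s\le 1$ let $Z^{-s}$ be the completion of $Z$ in the norm $\|(-A)^{-s}\varphi\|$; $A$ and $e^{At}$ are extended to these spaces in the usual way. Let $s_b,s_c,s_d\in[0,1)$ with $s_c+s_b<1$ and $s_c+s_d<1$, let $B_{\rm in}\in\mathcal L(\mathbb R,Z^{-s_b})$, $B_{\rm d}\in\mathcal L(\mathbb R,Z^{-s_d})$, $C\in\mathcal L(Z^{s_c},\mathbb R)$, and consider the linear system $$ z'=Az+B_{\rm in}u+B_{\rm d}d,\qquad z(0)\in Z,\qquad y=Cz .$$ Assume $G=C(-A)^{-1}B_{\rm in}\neq 0$ and put $B=B_{\rm in}G^{-1}$, $I_0=I+BCA^{-1}$. Let $0<\beta<1$ be such that $A_\beta=A-\frac{1-\beta}{\beta}BC$ (considered in $Z$) generates an exponentially stable strongly continuous semigroup $e^{A_\beta t}$. For $t\ge0$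 put $$K(t)=-\tfrac1\beta CA_\beta^{-1}e^{A_\beta t}B,\qquad K_d(t)=-CA_\beta^{-1}e^{A_\beta t}I_0B_{\rm d},\qquad D=\int_0^\infty|K(t)|\,dt,\qquad D_d=\int_0^\infty|K_d(t)|\,dt .$$ Let $C_b^N$ be the space of $N$ times continuously differentiable functions $[0,\infty)\to\mathbb R$ all of whose derivatives of order $0,\dots,N$ are bounded. Let $r,d\in C_b^0$ be a reference signal and a disturbance, and let $\bar z_0\in Z^{s_c}$. The $\beta$-iteration is the sequence of states $\bar z^{j}$, errors $e_j$ and controls $\bar u^{j}$ given by $$\tfrac{d}{dt}\bar z^{0}=A_\beta\bar z^{0}+I_0B_{\rm d}d+\tfrac1\beta Br,\quad \bar z^{0}(0)=\bar z_0,\quad e_0=r-C\bar z^{0},\quad \bar u^0=G^{-1}\Big[\tfrac1\beta r-\tfrac{1-\beta}{\beta}C\bar z^0+CA^{-1}B_{\rm d}d\Big],$$ $$\tfrac{d}{dt}\bar z^{j}=A_\beta\bar z^{j}+\tfrac1\beta Be_{j-1},\quad \bar z^{j}(0)=0,\quad e_j=e_{j-1}-C\bar z^{j},\quad \bar u^j=G^{-1}\Big[\tfrac1\beta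 e_{j-1}-\tfrac{1-\beta}{\beta}C\bar z^j\Big]\qquad(j\ge1),$$ and $\bar z_n=\sum_{j=0}^n\bar z^j$, $\bar u_n=\sum_{j=0}^n\bar u^j$. For $r,d\in C_b^n$ put $$C_n=\max_{0\le j\le n}\limsup_{t\to\infty}|r^{(j)}(t)|+\frac{D_d}{D}\max_{0\le j\le n}\limsup_{t\to\infty}|d^{(j)}(t)| .$$ **Theorem.** $D$ and $D_d$ are finite, $D>0$, the $\beta$-iteration has a solution, and every solution of it satisfies the following. 1. For every $n\ge0$, $e_n=r-C\bar z_n$ on $[0,\infty)$, and if $r,d\in C_b^{n+1}$, then $$\limsup_{t\to\infty}|e_n(t)|=\limsup_{t\to\infty}|r(t)-C\bar z_n(t)|\le D^{\,n+1}C_{n+1}.$$ 2. Suppose that $r,d\in C_b^N$ for every $N$ and that there are constants $\overline A,\overline\alpha\in\mathbb R$ with $C_n\le\overline A\,\overline\alpha^{\,n}$ for all $n\ge 0$ and $D\overline\alpha<1$. Then for all $n\ge 0$ $$\limsup_{t\to\infty}|e_n(t)|\le\overline A(D\overline\alpha)^{n+1}\le\overline A(D\overline\alpha)^{n},\qquad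 \overline A(D\overline\alpha)^{n}\xrightarrow[n\to\infty]{}0 .$$ Moreover, for every $\varepsilon>0$ there is $N$ such that for all $n\ge N$ the control $\bar u_n$ solves the practical regulation problem with error level $\varepsilon$: $\bar u_n$ is continuous and bounded on $[0,\infty)$, and for every initial state in $Z$ the system $z'=Az+B_{\rm in}\bar u_n+B_{\rm d}d$ has a solution on $[0,\infty)$, and along each such solution the output $Cz(t)$ is defined for $t>0$ and $\limsup_{t\to\infty}|r(t)-Cz(t)|\le\varepsilon$. -/

import Mathlib

open Set Filter Topology MeasureTheory

namespace Regulation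

noncomputable section

/-! ### Semigroups and the scale of spaces generated by `A` -/

/-- A strongly continuous semigroup on `Z`; only the values at times `t ≥ 0` are meaningful. -/
structure C0Semigroup (Z : Type*) [NormedAddCommGroup Z] [NormedSpace ℝ Z] where
  op : ℝ → Z →L[ℝ] Z
  op_zero : op 0 = ContinuousLinearMap.id ℝ Z
  op_add : ∀ s t : ℝ, 0 ≤ s → 0 ≤ t → op (s + t) = (op s).comp (op t)
  continuousOn : ∀ x : Z, ContinuousOn (fun t => op t x) (Ici 0)

namespace C0Semigroup

variable {Z : Type*} [NormedAddCommGroup Z] [NormedSpace ℝ Z]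

/-- `x` is in the domain of the infinitesimal generator and the generator maps `x` to `y`. -/
def Gen (T : C0Semigroup Z) (x y : Z) : Prop :=
  Tendsto (fun h : ℝ => h⁻¹ • (T.op h x - x)) (𝓝[>] 0) (𝓝 y)

/-- `‖T(t)‖ ≤ M e^{-ω t}` for some `M` and some `ω > 0`. -/
def ExpStable (T : C0Semigroup Z) : Prop :=
  ∃ M ω : ℝ, 0 < ω ∧ ∀ t : ℝ, 0 ≤ t → ‖T.op t‖ ≤ M * Real.exp (-ω * t)

/-- Analyticity in the form that makes sense on a real space: `T(t)` maps into the domain of the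
generator `A` for `t > 0`, and `t ‖A T(t)‖` stays bounded as `t → 0`.  (For an exponentially stable
semigroup this says that the generator is sectorial.) -/
def IsAnalytic (T : C0Semigroup Z) : Prop :=
  ∃ M : ℝ, ∀ t : ℝ, 0 < t → t ≤ 1 → ∀ x : Z, ∃ y : Z, T.Gen (T.op t x) y ∧ t * ‖y‖ ≤ M * ‖x‖

/-- The fractional power `(-A)^{-s} = Γ(s)⁻¹ ∫₀^∞ t^{s-1} e^{At} dt` for `s > 0`, and `(-A)^0 = I`,
where `A` is the generator of the (exponentially stable, analytic) semigroup `T`. -/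
def negPow (T : C0Semigroup Z) (s : ℝ) : Z →L[ℝ] Z :=
  if s = 0 then ContinuousLinearMap.id ℝ Z
  else (Real.Gamma s)⁻¹ • ∫ t in Ioi (0 : ℝ), (t ^ (s - 1)) • T.op t

/-- `A⁻¹`. -/
def inv (T : C0Semigroup Z) : Z →L[ℝ] Z := -T.negPow 1

/-- `Z^s = ran (-A)^{-s}` for `s ≥ 0`. -/
def ZPos (T : C0Semigroup Z) (s : ℝ) : Submodule ℝ Z :=
  LinearMap.range (T.negPow s : Z →ₗ[ℝ] Z)

/-- The space `Z`, to be equipped with the norm `‖φ‖_{-s} = ‖(-A)^{-s} φ‖`. -/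
def PreNeg (_T : C0Semigroup Z) (_s : ℝ) : Type _ := Z

instance (T : C0Semigroup Z) (s : ℝ) : AddCommGroup (T.PreNeg s) :=
  inferInstanceAs (AddCommGroup Z)

instance (T : C0Semigroup Z) (s : ℝ) : Module ℝ (T.PreNeg s) :=
  inferInstanceAs (Module ℝ Z)

/-- `(-A)^{-s}` as a linear map on `PreNeg`. -/
def preNegMap (T : C0Semigroup Z) (s : ℝ) : T.PreNeg s →ₗ[ℝ] Z :=
  (T.negPow s : Z →ₗ[ℝ] Z)

instance (T : C0Semigroup Z) (s : ℝ) : SeminormedAddCommGroup (T.PreNeg s) :=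
  SeminormedAddCommGroup.induced (T.PreNeg s) Z (T.preNegMap s)

instance (T : C0Semigroup Z) (s : ℝ) : NormedSpace ℝ (T.PreNeg s) :=
  NormedSpace.induced ℝ (T.PreNeg s) Z (T.preNegMap s)

/-- `Z^{-s}`, the completion of `Z` in the norm `‖φ‖_{-s} = ‖(-A)^{-s} φ‖`. -/
abbrev ZNeg (T : C0Semigroup Z) (s : ℝ) : Type _ := UniformSpace.Completion (T.PreNeg s)

/-- `A⁻¹` on `Z`, with its domain read as `PreNeg`. -/
def preInv (T : C0Semigroup Z) (s : ℝ) : T.PreNeg s → Z := fun x => T.inv (x : Z)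

/-- The continuous extension `A⁻¹ : Z^{-s} → Z`, for `0 ≤ s ≤ 1`. -/
def invExt (T : C0Semigroup Z) (s : ℝ) : T.ZNeg s → Z :=
  UniformSpace.Completion.extension (T.preInv s)

end C0Semigroup

/-! ### The control system `z' = A z + b u + b_d d`, `y = C z` -/

/-- The data of a linear single input single output system. `T` is the semigroup `e^{At}`; the input
and disturbance operators are `B_in v = v b` and `B_d v = v b_d`. -/
structure Plant (Z : Type*) [NormedAddCommGroup Z] [NormedSpace ℝ Z] where
  T : C0Semigroup Z
  sb : ℝ
  sc : ℝ
  sd : ℝ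
  b : T.ZNeg sb
  bd : T.ZNeg sd
  C : T.ZPos sc →ₗ[ℝ] ℝ

namespace Plant

variable {Z : Type*} [NormedAddCommGroup Z] [NormedSpace ℝ Z] (P : Plant Z)

open Classical in
/-- `C z` for `z ∈ Z^{s_c}` (and the irrelevant value `0` for other `z`). -/
def out (z : Z) : ℝ := if hz : z ∈ P.T.ZPos P.sc then P.C ⟨z, hz⟩ else 0

/-- `A⁻¹ B_in`, as a vector of `Z`. -/
def invBin : Z := P.T.invExt P.sb P.b

/-- `A⁻¹ B_d`, as a vector of `Z`. -/
def invBd : Z := P.T.invExt P.sd P.bd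

/-- `G = C (-A⁻¹) B_in`, the transfer function at `0`. -/
def G : ℝ := P.out (-P.invBin)

/-- `B = B_in G⁻¹`, an element of `Z^{-s_b}`. -/
def B : P.T.ZNeg P.sb := P.G⁻¹ • P.b

/-- `A⁻¹ B`. -/
def invB : Z := P.T.invExt P.sb P.B

/-- `A⁻¹ I₀ B_d`, where `I₀ = I + B C A⁻¹`. -/
def invI0Bd : Z := P.invBd + P.out P.invBd • P.invB

/-- The assumptions on the system: `A` is sectorial with compact resolvent and generates an
exponentially stable analytic semigroup; `B_in ∈ L(ℝ, Z^{-s_b})`, `B_d ∈ L(ℝ, Z^{-s_d})`,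
`C ∈ L(Z^{s_c}, ℝ)` with exponents in `[0, 1)` and `s_c + s_b < 1`, `s_c + s_d < 1`;
and `G` is invertible. -/
structure Standing : Prop where
  expStable : P.T.ExpStable
  analytic : P.T.IsAnalytic
  compact_resolvent : IsCompactOperator P.T.inv
  sb_nonneg : 0 ≤ P.sb
  sc_nonneg : 0 ≤ P.sc
  sd_nonneg : 0 ≤ P.sd
  sb_lt : P.sb < 1
  sc_lt : P.sc < 1
  sd_lt : P.sd < 1
  sc_add_sb : P.sc + P.sb < 1
  sc_add_sd : P.sc + P.sd < 1
  /-- Boundedness of `C` for the norm `‖φ‖_{s_c} = ‖(-A)^{s_c} φ‖` of `φ = (-A)^{-s_c} h`. -/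
  C_bounded : ∃ M : ℝ, ∀ h : Z, |P.out (P.T.negPow P.sc h)| ≤ M * ‖h‖
  G_ne_zero : P.G ≠ 0

/-- A solution in `Z` of the control system `z' = A z + B_in u + B_d d`, `z(0) = z₀`, on `[0, ∞)`.
The equation holds in the extrapolation space `Z^{-1}`, onto which `A` extends to an isomorphism from
`Z`; it is stated after applying `A⁻¹`. -/
structure IsSolution (u d : ℝ → ℝ) (z₀ : Z) (z : ℝ → Z) : Prop where
  continuousOn : ContinuousOn z (Ici 0)
  initial : z 0 = z₀
  equation : ∀ t : ℝ, 0 ≤ t → HasDerivWithinAt (fun τ => P.T.inv (z τ))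
    (z t + u t • P.invBin + d t • P.invBd) (Ici 0) t

/-- The control `u` solves the practical regulation problem with error level `ε`: it is continuous and
bounded on `[0, ∞)`, and from every initial state `z₀ ∈ Z` the control system driven by `u` and `d` has
a solution, and along any solution the output `y = C z` is defined for `t > 0` and satisfies
`limsup_{t → ∞} |r(t) - y(t)| ≤ ε`. -/
def SolvesPracticalRegulation (r d : ℝ → ℝ) (ε : ℝ) (u : ℝ → ℝ) : Prop :=
  ContinuousOn u (Ici 0) ∧ (∃ M : ℝ, ∀ t : ℝ, 0 ≤ t → |u t| ≤ M) ∧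
  ∀ z₀ : Z, (∃ z : ℝ → Z, P.IsSolution u d z₀ z) ∧
    ∀ z : ℝ → Z, P.IsSolution u d z₀ z →
      (∀ t : ℝ, 0 < t → z t ∈ P.T.ZPos P.sc) ∧
      IsBoundedUnder (· ≤ ·) atTop (fun t => |r t - P.out (z t)|) ∧
      limsup (fun t => |r t - P.out (z t)|) atTop ≤ ε

/-! ### The regularized operator `A_β = A - ζ B C`, `ζ = (1 - β) / β` -/

/-- The graph of `A_β` as an operator in `Z`: `x ∈ Z^{s_c}` and `A x - ζ B C x = y`.
The equation between elements of `Z^{-1}` is stated after applying `A⁻¹`. -/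
def BetaGraph (β : ℝ) (x y : Z) : Prop :=
  x ∈ P.T.ZPos P.sc ∧ x - ((1 - β) / β * P.out x) • P.invB = P.T.inv y

/-- `S` is the semigroup `e^{A_β t}` generated by `A_β`. -/
def IsBetaSemigroup (β : ℝ) (S : C0Semigroup Z) : Prop :=
  ∀ x y : Z, S.Gen x y ↔ P.BetaGraph β x y

/-- `A_β⁻¹ v = A⁻¹ (I + (1 - β) B C A⁻¹) v` for `v ∈ Z^{-1}` given through `g = A⁻¹ v`. -/
def betaInv (β : ℝ) (g : Z) : Z := g + ((1 - β) * P.out g) • P.invB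

/-- `K(t) = -(1/β) C A_β⁻¹ e^{A_β t} B`. -/
def K (β : ℝ) (S : C0Semigroup Z) (t : ℝ) : ℝ :=
  -(1 / β) * P.out (S.op t (P.betaInv β P.invB))

/-- `K_d(t) = -C A_β⁻¹ e^{A_β t} I₀ B_d`. -/
def Kd (β : ℝ) (S : C0Semigroup Z) (t : ℝ) : ℝ :=
  -P.out (S.op t (P.betaInv β P.invI0Bd))

/-- `D = ∫₀^∞ |K(t)| dt`. -/
def D (β : ℝ) (S : C0Semigroup Z) : ℝ := ∫ t in Ioi (0 : ℝ), |P.K β S t|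

/-- `D_d = ∫₀^∞ |K_d(t)| dt`. -/
def Dd (β : ℝ) (S : C0Semigroup Z) : ℝ := ∫ t in Ioi (0 : ℝ), |P.Kd β S t|

/-! ### The β-iteration -/

/-- A solution on `[0, ∞)` of the regularized system
`z' = A_β z + (1/β) B v + I₀ B_d w`, `z(0) = z₀`, with values in `Z^{s_c}` and with continuous output.
As above, the equation is stated after applying `A⁻¹`. -/
structure IsBetaSolution (β : ℝ) (v w : ℝ → ℝ) (z₀ : Z) (z : ℝ → Z) : Prop where
  continuousOn : ContinuousOn z (Ici 0)
  mem : ∀ t : ℝ, 0 ≤ t → z t ∈ P.T.ZPos P.sc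
  out_continuousOn : ContinuousOn (fun t => P.out (z t)) (Ici 0)
  initial : z 0 = z₀
  equation : ∀ t : ℝ, 0 ≤ t → HasDerivWithinAt (fun τ => P.T.inv (z τ))
    ((z t - ((1 - β) / β * P.out (z t)) • P.invB) + (1 / β * v t) • P.invB + w t • P.invI0Bd)
    (Ici 0) t

/-- The errors `e₀ = r - C z⁰` and `e_j = e_{j-1} - C z^j`. -/
def err (r : ℝ → ℝ) (z : ℕ → ℝ → Z) : ℕ → ℝ → ℝ
  | 0 => fun t => r t - P.out (z 0 t)
  | j + 1 => fun t => err r z j t - P.out (z (j + 1) t)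

/-- `z⁰, z¹, z², …` are the states of the β-iteration in the linear case: `z⁰` solves
`z' = A_β z + (1/β) B r + I₀ B_d d`, `z(0) = z₀`, and `z^j` for `j ≥ 1` solves
`z' = A_β z + (1/β) B e_{j-1}`, `z(0) = 0`. -/
structure IsBetaIteration (β : ℝ) (r d : ℝ → ℝ) (z₀ : Z) (z : ℕ → ℝ → Z) : Prop where
  zero : P.IsBetaSolution β r d z₀ (z 0)
  succ : ∀ j : ℕ, P.IsBetaSolution β (P.err r z j) (fun _ => 0) 0 (z (j + 1))

/-- The controls `u⁰ = G⁻¹ [r/β - ((1-β)/β) C z⁰ + C A⁻¹ B_d d]` and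
`u^j = G⁻¹ [e_{j-1}/β - ((1-β)/β) C z^j]` for `j ≥ 1`. -/
def ctrl (β : ℝ) (r d : ℝ → ℝ) (z : ℕ → ℝ → Z) : ℕ → ℝ → ℝ
  | 0 => fun t =>
      P.G⁻¹ * (1 / β * r t - (1 - β) / β * P.out (z 0 t) + P.out P.invBd * d t)
  | j + 1 => fun t =>
      P.G⁻¹ * (1 / β * P.err r z j t - (1 - β) / β * P.out (z (j + 1) t))

/-- The control `u_n = u⁰ + ⋯ + u^n` produced by the β-iteration. -/
def totalCtrl (β : ℝ) (r d : ℝ → ℝ) (z : ℕ → ℝ → Z) (n : ℕ) (t : ℝ) : ℝ :=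
  ∑ j ∈ Finset.range (n + 1), P.ctrl β r d z j t

end Plant

/-! ### Signals -/

/-- `φ ∈ C_b^N([0, ∞))`: `N` times continuously differentiable, with bounded derivatives. -/
def IsCb (N : ℕ) (φ : ℝ → ℝ) : Prop :=
  ContDiffOn ℝ N φ (Ici 0) ∧
    ∀ j ≤ N, ∃ M : ℝ, ∀ t : ℝ, 0 ≤ t → |iteratedDerivWithin j φ (Ici 0) t| ≤ M

/-- `max_{0 ≤ j ≤ n} limsup_{t → ∞} |φ^{(j)}(t)|`. -/
def maxLimsup (n : ℕ) (φ : ℝ → ℝ) : ℝ :=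
  (Finset.range (n + 1)).sup' Finset.nonempty_range_add_one
    (fun j => limsup (fun t => |iteratedDerivWithin j φ (Ici 0) t|) atTop)

/-- `C_n = max_{j ≤ n} limsup |r^{(j)}| + (D_d / D) max_{j ≤ n} limsup |d^{(j)}|`. -/
def Plant.Cn {Z : Type*} [NormedAddCommGroup Z] [NormedSpace ℝ Z] (P : Plant Z)
    (β : ℝ) (S : C0Semigroup Z) (r d : ℝ → ℝ) (n : ℕ) : ℝ :=
  maxLimsup n r + P.Dd β S / P.D β S * maxLimsup n d

end

end Regulation

/-!
The output `y = C z` of `z' = A_β z + B f` solves a scalar Volterra equation whose kernel is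
`C A e^{At} A⁻¹ B`; smoothing of the analytic semigroup makes this kernel integrable because
`s_c + s_b < 1`, which gives well-posedness. Exponential stability of `e^{A_β t}` makes the outputs
of bounded inputs bounded and those of free motions decay.

Let `E` send an input `v` to the error `v - C z`, where `z` is driven from rest by `v / β`. Since
the constant input `v` has the steady state with output `v`, Duhamel's formula yields
`E v = v(0) K + K * v'`. Moreover `E` commutes with convolution operators, so each
application of `E` trades one derivative of `v` for a factor `D = ‖K‖₁`, up to terms `E ⋯ E K` that
decay, and `limsup |E^{n+1} r| ≤ D^{n+1} limsup |r^{(n+1)}|`. The disturbance enters the first error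
through `d(0) K_d + K_d * d'`, so its contribution to `e_n` is at most
`D_d D^n limsup |d^{(n+1)}|`.
-/

namespace Regulation

noncomputable section

/-! ### Causal convolutions on `[0, ∞)` -/

section CausalConvolution

variable {E : Type*} [NormedAddCommGroup E]

theorem continuous_comp_max_zero {X : Type*} [TopologicalSpace X] {f : ℝ → X}
    (hf : ContinuousOn f (Ici 0)) : Continuous fun t => f (max t 0) :=
  hf.comp_continuous (by fun_prop) fun _ => mem_Ici.2 (le_max_right _ _)

theorem exists_bound_Icc_zero {X : Type*} [SeminormedAddCommGroup X] {f : ℝ → X}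
    (hf : ContinuousOn f (Ici 0)) (t : ℝ) : ∃ M, ∀ s, 0 ≤ s → s ≤ t → ‖f s‖ ≤ M := by
  obtain ⟨M, hM⟩ := isCompact_Icc.exists_bound_of_continuousOn
    (hf.mono (Icc_subset_Ici_self : Icc 0 t ⊆ Ici 0))
  exact ⟨M, fun s h₀ ht => hM s ⟨h₀, ht⟩⟩

theorem locallyIntegrableOn_Ici_of_integrableOn_Ioi {p : ℝ → E} (hp : IntegrableOn p (Ioi 0)) :
    LocallyIntegrableOn p (Ici 0) :=
  ((integrableOn_Ici_iff_integrableOn_Ioi).2 hp).locallyIntegrableOn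

theorem locallyIntegrableOn_Ici_of_continuousOn {p : ℝ → E} (hp : ContinuousOn p (Ici 0)) :
    LocallyIntegrableOn p (Ici 0) :=
  hp.locallyIntegrableOn measurableSet_Ici

theorem integrableOn_Icc_of_locallyIntegrableOn {p : ℝ → E} (hp : LocallyIntegrableOn p (Ici 0))
    (t : ℝ) : IntegrableOn p (Icc 0 t) :=
  hp.integrableOn_compact_subset Icc_subset_Ici_self isCompact_Icc

theorem intervalIntegrable_of_locallyIntegrableOn {p : ℝ → E}
    (hp : LocallyIntegrableOn p (Ici 0)) {t : ℝ} (ht : 0 ≤ t) :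
    IntervalIntegrable p volume 0 t :=
  (intervalIntegrable_iff_integrableOn_Icc_of_le ht).2
    (integrableOn_Icc_of_locallyIntegrableOn hp t)

theorem intervalIntegrable_of_continuousOn_Ici {p : ℝ → E} (hp : ContinuousOn p (Ici 0)) {t : ℝ}
    (ht : 0 ≤ t) : IntervalIntegrable p volume 0 t :=
  intervalIntegrable_of_locallyIntegrableOn (locallyIntegrableOn_Ici_of_continuousOn hp) ht

variable [NormedSpace ℝ E]

/-- The causal convolution `∫₀ᵗ f(t - τ) p(τ) dτ` of a scalar signal `f` with a vector-valued
kernel `p`. -/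
def causalConv (p : ℝ → E) (f : ℝ → ℝ) (t : ℝ) : E := ∫ τ in (0 : ℝ)..t, f (t - τ) • p τ

theorem intervalIntegrable_causalConv {p : ℝ → E} (hp : LocallyIntegrableOn p (Ici 0))
    {f : ℝ → ℝ} (hf : ContinuousOn f (Ici 0)) {t : ℝ} (ht : 0 ≤ t) :
    IntervalIntegrable (fun τ => f (t - τ) • p τ) volume 0 t := by
  refine (intervalIntegrable_of_locallyIntegrableOn hp ht).continuousOn_smul ?_
  rw [uIcc_of_le ht]
  exact hf.comp (by fun_prop) fun τ hτ => sub_nonneg.2 hτ.2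

theorem causalConv_apply_zero (p : ℝ → E) (f : ℝ → ℝ) : causalConv p f 0 = 0 := by
  simp [causalConv]

theorem causalConv_congr {p : ℝ → E} {f f' : ℝ → ℝ} (h : ∀ t, 0 ≤ t → f t = f' t) {t : ℝ}
    (ht : 0 ≤ t) : causalConv p f t = causalConv p f' t := by
  refine intervalIntegral.integral_congr fun τ hτ => ?_
  rw [uIcc_of_le ht] at hτ
  simp only [h (t - τ) (sub_nonneg.2 hτ.2)]

theorem causalConv_congr_left {p p' : ℝ → E} {f : ℝ → ℝ} (h : ∀ t, 0 < t → p t = p' t) {t : ℝ}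
    (ht : 0 ≤ t) : causalConv p f t = causalConv p' f t := by
  refine intervalIntegral.integral_congr_ae (Eventually.of_forall fun τ hτ => ?_)
  rw [uIoc_of_le ht] at hτ
  simp only [h τ hτ.1]

theorem causalConv_add {p : ℝ → E} (hp : LocallyIntegrableOn p (Ici 0)) {f f' : ℝ → ℝ}
    (hf : ContinuousOn f (Ici 0)) (hf' : ContinuousOn f' (Ici 0)) {t : ℝ} (ht : 0 ≤ t) :
    causalConv p (fun s => f s + f' s) t = causalConv p f t + causalConv p f' t := by
  simp only [causalConv, add_smul]
  exact intervalIntegral.integral_add (intervalIntegrable_causalConv hp hf ht)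
    (intervalIntegrable_causalConv hp hf' ht)

theorem causalConv_const_mul (p : ℝ → E) (a : ℝ) (f : ℝ → ℝ) (t : ℝ) :
    causalConv p (fun s => a * f s) t = a • causalConv p f t := by
  simp only [causalConv, mul_smul]
  exact intervalIntegral.integral_smul _ _

theorem map_causalConv [CompleteSpace E] {F : Type*} [NormedAddCommGroup F]
    [NormedSpace ℝ F] [CompleteSpace F] (L : E →L[ℝ] F) {p : ℝ → E}
    (hp : LocallyIntegrableOn p (Ici 0)) {f : ℝ → ℝ} (hf : ContinuousOn f (Ici 0)) {t : ℝ}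
    (ht : 0 ≤ t) : L (causalConv p f t) = causalConv (fun τ => L (p τ)) f t := by
  rw [causalConv, ← L.intervalIntegral_comp_comm (intervalIntegrable_causalConv hp hf ht)]
  simp only [map_smul, causalConv]

theorem intervalIntegral_comp_const_sub (f : ℝ → E) (t : ℝ) :
    ∫ τ in (0 : ℝ)..t, f (t - τ) = ∫ τ in (0 : ℝ)..t, f τ := by
  simp

theorem causalConv_one (f : ℝ → ℝ) (t : ℝ) :
    causalConv (fun _ => (1 : ℝ)) f t = ∫ τ in (0 : ℝ)..t, f τ := by
  simp [causalConv]

theorem causalConv_comm (k f : ℝ → ℝ) (t : ℝ) : causalConv k f t = causalConv f k t := by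
  simp only [causalConv, smul_eq_mul]
  rw [← intervalIntegral_comp_const_sub]
  exact intervalIntegral.integral_congr fun τ _ => by simp only [sub_sub_cancel, mul_comm]

theorem norm_causalConv_le {p : ℝ → E} (hp : LocallyIntegrableOn p (Ici 0)) {f : ℝ → ℝ} {t M : ℝ}
    (ht : 0 ≤ t) (hM : ∀ s, 0 ≤ s → s ≤ t → |f s| ≤ M) :
    ‖causalConv p f t‖ ≤ (∫ τ in (0 : ℝ)..t, ‖p τ‖) * M := by
  rw [← intervalIntegral.integral_mul_const]
  refine intervalIntegral.norm_integral_le_of_norm_le ht (Eventually.of_forall fun τ hτ => ?_)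
    ((intervalIntegrable_of_locallyIntegrableOn hp ht).norm.mul_const _)
  rw [norm_smul, mul_comm]
  exact mul_le_mul_of_nonneg_left (hM _ (by linarith [hτ.2]) (by linarith [hτ.1])) (norm_nonneg _)

theorem norm_causalConv_le_causalConv_norm {p : ℝ → E} (hp : LocallyIntegrableOn p (Ici 0))
    {f : ℝ → ℝ} (hf : ContinuousOn f (Ici 0)) {t : ℝ} (ht : 0 ≤ t) :
    ‖causalConv p f t‖ ≤ causalConv (fun s => ‖p s‖) (fun s => |f s|) t := by
  refine intervalIntegral.norm_integral_le_of_norm_le ht (Eventually.of_forall fun τ _ => ?_)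
    (intervalIntegrable_causalConv hp.norm hf.abs ht)
  rw [norm_smul, smul_eq_mul, Real.norm_eq_abs]

/-- Subtracting the initial value makes the extension by zero to negative times continuous, so that
dominated convergence applies; the constant `f 0` contributes a primitive of `p`. -/
theorem causalConv_eq_add_integral_Icc {p : ℝ → E} (hp : LocallyIntegrableOn p (Ici 0))
    {f : ℝ → ℝ} (hf : ContinuousOn f (Ici 0)) {t R : ℝ} (ht : t ∈ Icc 0 R) :
    causalConv p f t =
      f 0 • (∫ τ in (0 : ℝ)..t, p τ) + ∫ τ in Icc 0 R, (f (max (t - τ) 0) - f 0) • p τ := by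
  have vanish : ∀ τ ∈ Icc 0 R \ Ioc 0 t, τ ≠ 0 → (f (max (t - τ) 0) - f 0) • p τ = 0 := by
    rintro τ ⟨hτR, hτ⟩ hτ0
    have : t ≤ τ := le_of_not_ge fun h => hτ ⟨hτR.1.lt_of_ne' hτ0, h⟩
    rw [max_eq_right (sub_nonpos.2 this), sub_self, zero_smul]
  rw [setIntegral_eq_of_subset_of_ae_sdiff_eq_zero (s := Ioc 0 t)
    measurableSet_Icc.nullMeasurableSet (fun τ hτ => ⟨hτ.1.le, hτ.2.trans ht.2⟩),
    ← intervalIntegral.integral_of_le ht.1, ← intervalIntegral.integral_smul,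
    ← intervalIntegral.integral_add]
  · refine intervalIntegral.integral_congr fun τ hτ => ?_
    rw [uIcc_of_le ht.1] at hτ
    simp only [max_eq_left (sub_nonneg.2 hτ.2), ← add_smul, add_sub_cancel]
  · exact (intervalIntegrable_of_locallyIntegrableOn hp ht.1).smul (f 0)
  · exact (intervalIntegrable_of_locallyIntegrableOn hp ht.1).continuousOn_smul
      (((continuous_comp_max_zero hf).comp (continuous_sub_left t)).sub
        continuous_const).continuousOn
  · filter_upwards [ae_iff.2 (by simp : volume {τ : ℝ | ¬τ ≠ 0} = 0)] with τ hτ0 hτ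
      using vanish τ hτ hτ0

theorem continuousOn_causalConv {p : ℝ → E} (hp : LocallyIntegrableOn p (Ici 0)) {f : ℝ → ℝ}
    (hf : ContinuousOn f (Ici 0)) : ContinuousOn (causalConv p f) (Ici 0) := by
  suffices ∀ R, 0 ≤ R → ContinuousOn (causalConv p f) (Icc 0 R) by
    intro t ht
    refine (this (t + 1) (by linarith [mem_Ici.1 ht]) t ⟨ht, by linarith⟩).mono_of_mem_nhdsWithin ?_
    filter_upwards [self_mem_nhdsWithin, mem_nhdsWithin_of_mem_nhds (Iio_mem_nhds (lt_add_one t))]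
      with s hs hst using ⟨hs, hst.le⟩
  intro R hR
  obtain ⟨M, hM⟩ := exists_bound_Icc_zero hf R
  have hpR := integrableOn_Icc_of_locallyIntegrableOn hp R
  have hfc := continuous_comp_max_zero hf
  refine ContinuousOn.congr ?_ fun t ht => causalConv_eq_add_integral_Icc hp hf ht
  refine ContinuousOn.add ?_ ?_
  · rw [← uIcc_of_le hR] at hpR ⊢
    exact (intervalIntegral.continuousOn_primitive_interval hpR).const_smul (f 0)
  · refine continuousOn_of_dominated (bound := fun τ => (M + |f 0|) * ‖p τ‖) (fun t _ => ?_)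
      (fun t ht => ?_) (hpR.norm.const_mul _) (Eventually.of_forall fun τ => ?_)
    · exact ((hfc.comp (continuous_sub_left t)).sub
        continuous_const).aestronglyMeasurable.smul hpR.aestronglyMeasurable
    · filter_upwards [ae_restrict_mem measurableSet_Icc] with τ hτ
      rw [norm_smul]
      gcongr
      exact (norm_sub_le _ _).trans (add_le_add_left
        (hM _ (le_max_right _ _) (max_le (by linarith [hτ.1, ht.2]) hR)) _)
    · exact (((hfc.comp (continuous_sub_right τ)).sub continuous_const).smul
        continuous_const).continuousOn

theorem intervalIntegral_eq_integral_indicator_triangle (H : ℝ → ℝ → E) (t : ℝ) :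
    ∫ τ in Icc 0 t, ∫ σ in (0 : ℝ)..(t - τ), H τ σ =
      ∫ τ, ∫ σ, {x : ℝ × ℝ | 0 ≤ x.1 ∧ 0 ≤ x.2 ∧ x.1 + x.2 ≤ t}.indicator
        (Function.uncurry H) (τ, σ) := by
  rw [← integral_indicator measurableSet_Icc]
  congr 1 with τ
  by_cases hτ : τ ∈ Icc 0 t
  · rw [indicator_of_mem hτ, intervalIntegral.integral_of_le (sub_nonneg.2 hτ.2),
      ← integral_Icc_eq_integral_Ioc, ← integral_indicator measurableSet_Icc]
    congr 1 with σ
    simp only [indicator, mem_Icc, mem_ofPred_eq, hτ.1, true_and, le_sub_iff_add_le',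
      Function.uncurry_apply_pair]
  · rw [indicator_of_notMem hτ, integral_eq_zero_of_ae (Eventually.of_forall fun σ => ?_)]
    refine indicator_of_notMem (fun h => hτ ⟨h.1, ?_⟩) _
    linarith [h.2.1, h.2.2]

/-- Fubini on the triangle `{τ, σ ≥ 0, τ + σ ≤ t}`. -/
theorem integral_integral_swap_triangle {H : ℝ → ℝ → E} {t : ℝ} (ht : 0 ≤ t)
    (hH : IntegrableOn (Function.uncurry H) {x | 0 ≤ x.1 ∧ 0 ≤ x.2 ∧ x.1 + x.2 ≤ t}) :
    ∫ τ in (0 : ℝ)..t, ∫ σ in (0 : ℝ)..(t - τ), H τ σ =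
      ∫ σ in (0 : ℝ)..t, ∫ τ in (0 : ℝ)..(t - σ), H τ σ := by
  have hmeas : MeasurableSet {x : ℝ × ℝ | 0 ≤ x.1 ∧ 0 ≤ x.2 ∧ x.1 + x.2 ≤ t} := by measurability
  rw [intervalIntegral.integral_of_le ht, ← integral_Icc_eq_integral_Ioc,
    intervalIntegral_eq_integral_indicator_triangle H,
    integral_integral_swap (f := fun τ σ => Set.indicator _ _ (τ, σ))
      (hH.integrable_indicator hmeas), intervalIntegral.integral_of_le ht,
    ← integral_Icc_eq_integral_Ioc,
    intervalIntegral_eq_integral_indicator_triangle (Function.swap H)]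
  congr 1 with σ
  congr 1 with τ
  simp only [indicator, mem_ofPred_eq, Function.uncurry, Function.swap, add_comm τ σ,
    and_left_comm (a := 0 ≤ τ)]
  congr

theorem causalConv_causalConv [CompleteSpace E] {p : ℝ → E} (hp : LocallyIntegrableOn p (Ici 0))
    {F f : ℝ → ℝ} (hF : ContinuousOn F (Ici 0)) (hf : ContinuousOn f (Ici 0)) {t : ℝ}
    (ht : 0 ≤ t) :
    causalConv p (causalConv F f) t = ∫ σ in (0 : ℝ)..t, F σ • causalConv p f (t - σ) := by
  have hH : IntegrableOn (Function.uncurry fun τ σ => (F σ * f (t - τ - σ)) • p τ)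
      {x | 0 ≤ x.1 ∧ 0 ≤ x.2 ∧ x.1 + x.2 ≤ t} := by
    set Δ : Set (ℝ × ℝ) := {x | 0 ≤ x.1 ∧ 0 ≤ x.2 ∧ x.1 + x.2 ≤ t}
    have hΔ : Δ ⊆ Icc 0 t ×ˢ Icc 0 t := fun x hx =>
      ⟨⟨hx.1, by linarith [hx.2.1, hx.2.2]⟩, hx.2.1, by linarith [hx.1, hx.2.2]⟩
    have hp_fst : IntegrableOn (fun x : ℝ × ℝ => p x.1) (Icc 0 t ×ˢ Icc 0 t) := by
      rw [IntegrableOn, Measure.volume_eq_prod, ← Measure.prod_restrict]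
      exact (integrableOn_Icc_of_locallyIntegrableOn hp t).comp_fst _
    have hΔ_closed : IsClosed Δ := by
      simp only [Δ, ofPred_and]
      exact (isClosed_le (by fun_prop) (by fun_prop)).inter
        ((isClosed_le (by fun_prop) (by fun_prop)).inter (isClosed_le (by fun_prop) (by fun_prop)))
    refine IntegrableOn.continuousOn_smul (hp_fst.mono_set hΔ) ?_
      ((isCompact_Icc.prod isCompact_Icc).of_isClosed_subset hΔ_closed hΔ)
    exact (hF.comp continuous_snd.continuousOn fun x hx => hx.2.1).mul
      (hf.comp (by fun_prop) fun x hx => mem_Ici.2 (by linarith [hx.2.2]))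
  calc causalConv p (causalConv F f) t
      = ∫ τ in (0 : ℝ)..t, ∫ σ in (0 : ℝ)..(t - τ), (F σ * f (t - τ - σ)) • p τ := by
        simp only [causalConv, intervalIntegral.integral_smul_const, smul_eq_mul, mul_comm (F _)]
    _ = ∫ σ in (0 : ℝ)..t, ∫ τ in (0 : ℝ)..(t - σ), (F σ * f (t - τ - σ)) • p τ :=
        integral_integral_swap_triangle ht hH
    _ = ∫ σ in (0 : ℝ)..t, F σ • causalConv p f (t - σ) := by
        simp only [causalConv, mul_smul, intervalIntegral.integral_smul, sub_right_comm t]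

theorem causalConv_left_comm {k F f : ℝ → ℝ} (hk : LocallyIntegrableOn k (Ici 0))
    (hF : ContinuousOn F (Ici 0)) (hf : ContinuousOn f (Ici 0)) {t : ℝ} (ht : 0 ≤ t) :
    causalConv k (causalConv F f) t = causalConv F (causalConv k f) t := by
  rw [causalConv_causalConv hk hF hf ht, causalConv]
  simp only [smul_eq_mul, mul_comm]

theorem integral_causalConv [CompleteSpace E] {p : ℝ → E} (hp : LocallyIntegrableOn p (Ici 0))
    {f : ℝ → ℝ} (hf : ContinuousOn f (Ici 0)) {t : ℝ} (ht : 0 ≤ t) :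
    ∫ s in (0 : ℝ)..t, causalConv p f s = causalConv p (fun s => ∫ σ in (0 : ℝ)..s, f σ) t := by
  rw [← causalConv_congr (fun s _ => causalConv_one f s) ht,
    causalConv_causalConv hp continuousOn_const hf ht]
  simp only [one_smul, intervalIntegral_comp_const_sub]

theorem integral_norm_causalConv_le {p : ℝ → E} (hp : LocallyIntegrableOn p (Ici 0)) {f : ℝ → ℝ}
    (hf : ContinuousOn f (Ici 0)) {t : ℝ} (ht : 0 ≤ t) :
    ∫ s in (0 : ℝ)..t, ‖causalConv p f s‖ ≤
      (∫ s in (0 : ℝ)..t, ‖p s‖) * ∫ s in (0 : ℝ)..t, |f s| := by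
  have integral_abs_le : ∀ s, 0 ≤ s → s ≤ t →
      |∫ σ in (0 : ℝ)..s, (|f σ|)| ≤ ∫ s in (0 : ℝ)..t, |f s| := fun s hs hst => by
    rw [abs_of_nonneg (intervalIntegral.integral_nonneg hs fun _ _ => abs_nonneg _)]
    exact intervalIntegral.integral_mono_interval le_rfl hs hst
      (Eventually.of_forall fun _ => abs_nonneg _)
      (intervalIntegrable_of_continuousOn_Ici hf.abs ht)
  calc ∫ s in (0 : ℝ)..t, ‖causalConv p f s‖
      ≤ ∫ s in (0 : ℝ)..t, causalConv (fun s => ‖p s‖) (fun s => |f s|) s :=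
        intervalIntegral.integral_mono_on ht
          (intervalIntegrable_of_continuousOn_Ici (continuousOn_causalConv hp hf).norm ht)
          (intervalIntegrable_of_continuousOn_Ici (continuousOn_causalConv hp.norm hf.abs) ht)
          fun s hs => norm_causalConv_le_causalConv_norm hp hf hs.1
    _ = causalConv (fun s => ‖p s‖) (fun s => ∫ σ in (0 : ℝ)..s, |f σ|) t :=
        integral_causalConv hp.norm hf.abs ht
    _ ≤ ‖causalConv (fun s => ‖p s‖) (fun s => ∫ σ in (0 : ℝ)..s, |f σ|) t‖ := le_abs_self _
    _ ≤ (∫ s in (0 : ℝ)..t, ‖p s‖) * ∫ s in (0 : ℝ)..t, |f s| := by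
        simpa only [norm_norm] using norm_causalConv_le hp.norm ht integral_abs_le

theorem hasDerivWithinAt_integral_Ici [CompleteSpace E] {f : ℝ → E} (hf : ContinuousOn f (Ici 0))
    {t : ℝ} (ht : 0 ≤ t) :
    HasDerivWithinAt (fun t => ∫ s in (0 : ℝ)..t, f s) (f t) (Ici 0) t := by
  have hc := continuous_comp_max_zero hf
  have integral_eq : ∀ s ∈ Ici (0 : ℝ),
      ∫ τ in (0 : ℝ)..s, f τ = ∫ τ in (0 : ℝ)..s, f (max τ 0) := fun s hs => by
    refine intervalIntegral.integral_congr fun τ hτ => ?_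
    rw [uIcc_of_le hs] at hτ
    simp only [max_eq_left hτ.1]
  have := (hc.integral_hasStrictDerivAt 0 t).hasDerivAt.hasDerivWithinAt (s := Ici 0)
  simp only [max_eq_left ht] at this
  exact this.congr integral_eq (integral_eq t ht)

theorem integral_eq_sub_of_hasDerivWithinAt_Ici [CompleteSpace E] {f f' : ℝ → E}
    (hf : ∀ t, 0 ≤ t → HasDerivWithinAt f (f' t) (Ici 0) t) (hf' : ContinuousOn f' (Ici 0))
    {t : ℝ} (ht : 0 ≤ t) : ∫ s in (0 : ℝ)..t, f' s = f t - f 0 := by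
  refine intervalIntegral.integral_eq_sub_of_hasDeriv_right_of_le ht
    (fun s hs => (hf s hs.1).continuousWithinAt.mono Icc_subset_Ici_self)
    (fun s hs => (hf s hs.1.le).mono fun u hu => hs.1.le.trans (le_of_lt hu))
    (intervalIntegrable_of_continuousOn_Ici hf' ht)

end CausalConvolution

/-! ### Bounded signals -/

section Signals

open scoped NNReal BoundedContinuousFunction

theorem IsCb.continuousOn {N : ℕ} {f : ℝ → ℝ} (hf : IsCb N f) : ContinuousOn f (Ici 0) :=
  hf.1.continuousOn

theorem IsCb.exists_bound {N : ℕ} {f : ℝ → ℝ} (hf : IsCb N f) :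
    ∃ M, 0 ≤ M ∧ ∀ t, 0 ≤ t → |f t| ≤ M := by
  obtain ⟨M, hM⟩ := hf.2 0 (Nat.zero_le N)
  simp only [iteratedDerivWithin_zero] at hM
  exact ⟨M, (abs_nonneg _).trans (hM 0 le_rfl), hM⟩

theorem isCb_zero_of_bound {f : ℝ → ℝ} (hf : ContinuousOn f (Ici 0)) {M : ℝ}
    (hM : ∀ t, 0 ≤ t → |f t| ≤ M) : IsCb 0 f := by
  refine ⟨contDiffOn_zero.2 hf, fun j hj => ⟨M, ?_⟩⟩
  simpa only [Nat.le_zero.1 hj, iteratedDerivWithin_zero] using hM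

theorem IsCb.mono {M N : ℕ} {f : ℝ → ℝ} (hf : IsCb N f) (h : M ≤ N) : IsCb M f :=
  ⟨hf.1.of_le (by exact_mod_cast h), fun j hj => hf.2 j (hj.trans h)⟩

theorem IsCb.add {N : ℕ} {f g : ℝ → ℝ} (hf : IsCb N f) (hg : IsCb N g) :
    IsCb N fun t => f t + g t := by
  refine ⟨hf.1.add hg.1, fun j hj => ?_⟩
  obtain ⟨M, hM⟩ := hf.2 j hj
  obtain ⟨M', hM'⟩ := hg.2 j hj
  refine ⟨M + M', fun t ht => ?_⟩
  have hjN : (j : WithTop ℕ∞) ≤ N := by exact_mod_cast hj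
  rw [iteratedDerivWithin_fun_add (mem_Ici.2 ht) (uniqueDiffOn_Ici 0)
    ((hf.1.of_le hjN) t ht) ((hg.1.of_le hjN) t ht)]
  exact (abs_add_le _ _).trans (add_le_add (hM t ht) (hM' t ht))

theorem IsCb.const_mul {N : ℕ} {f : ℝ → ℝ} (hf : IsCb N f) (a : ℝ) :
    IsCb N fun t => a * f t := by
  refine ⟨contDiffOn_const.mul hf.1, fun j hj => ?_⟩
  obtain ⟨M, hM⟩ := hf.2 j hj
  refine ⟨|a| * M, fun t ht => ?_⟩
  have := iteratedDerivWithin_const_smul_field (s := Ici (0 : ℝ)) (x := t) (n := j) a f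
  simp only [Pi.smul_def, smul_eq_mul] at this
  rw [this, abs_mul]
  exact mul_le_mul_of_nonneg_left (hM t ht) (abs_nonneg a)

theorem IsCb.sub {N : ℕ} {f g : ℝ → ℝ} (hf : IsCb N f) (hg : IsCb N g) :
    IsCb N fun t => f t - g t := by
  simpa [sub_eq_add_neg] using hf.add (hg.const_mul (-1))

theorem IsCb.congr {N : ℕ} {f g : ℝ → ℝ} (hf : IsCb N f) (h : EqOn g f (Ici 0)) : IsCb N g := by
  refine ⟨hf.1.congr h, fun j hj => ?_⟩
  obtain ⟨M, hM⟩ := hf.2 j hj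
  exact ⟨M, fun t ht => by rw [iteratedDerivWithin_congr h ht]; exact hM t ht⟩

theorem isCb_const (N : ℕ) (a : ℝ) : IsCb N fun _ => a := by
  refine ⟨contDiffOn_const, fun j _ => ⟨|a|, fun t _ => ?_⟩⟩
  rw [iteratedDerivWithin_const]
  split_ifs <;> simp

theorem IsCb.sum {N : ℕ} {ι : Type*} {s : Finset ι} {f : ι → ℝ → ℝ}
    (h : ∀ i ∈ s, IsCb N (f i)) : IsCb N fun t => ∑ i ∈ s, f i t := by
  classical
  induction s using Finset.induction_on with
  | empty => simpa using isCb_const N 0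
  | insert i s hi ih =>
    simp only [Finset.sum_insert hi]
    exact (h i (Finset.mem_insert_self i s)).add
      (ih fun j hj => h j (Finset.mem_insert_of_mem hj))

theorem IsCb.derivWithin {N : ℕ} {φ : ℝ → ℝ} (h : IsCb (N + 1) φ) :
    IsCb N (derivWithin φ (Ici 0)) := by
  refine ⟨((contDiffOn_succ_iff_derivWithin (uniqueDiffOn_Ici 0)).1 h.1).2.2, fun j hj => ?_⟩
  simpa only [iteratedDerivWithin_succ'] using h.2 (j + 1) (Nat.succ_le_succ hj)

theorem IsCb.hasDerivWithinAt {N : ℕ} {φ : ℝ → ℝ} (h : IsCb (N + 1) φ) {t : ℝ} (ht : 0 ≤ t) :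
    HasDerivWithinAt φ (_root_.derivWithin φ (Ici 0) t) (Ici 0) t :=
  ((h.1.differentiableOn (by simp)) t ht).hasDerivWithinAt

theorem intervalIntegral_norm_le_integral_Ioi {E : Type*} [NormedAddCommGroup E] {p : ℝ → E}
    (hp : IntegrableOn p (Ioi 0)) {t : ℝ} (ht : 0 ≤ t) :
    ∫ τ in (0 : ℝ)..t, ‖p τ‖ ≤ ∫ τ in Ioi (0 : ℝ), ‖p τ‖ := by
  rw [intervalIntegral.integral_of_le ht]
  exact setIntegral_mono_set hp.norm (Eventually.of_forall fun _ => norm_nonneg _)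
    Ioc_subset_Ioi_self.eventuallyLE

theorem norm_causalConv_le_integral_Ioi {E : Type*} [NormedAddCommGroup E] [NormedSpace ℝ E]
    {p : ℝ → E} (hp : IntegrableOn p (Ioi 0)) {f : ℝ → ℝ} {t M : ℝ} (ht : 0 ≤ t) (hM₀ : 0 ≤ M)
    (hM : ∀ s, 0 ≤ s → s ≤ t → |f s| ≤ M) :
    ‖causalConv p f t‖ ≤ (∫ τ in Ioi (0 : ℝ), ‖p τ‖) * M :=
  (norm_causalConv_le (locallyIntegrableOn_Ici_of_integrableOn_Ioi hp) ht hM).trans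
    (mul_le_mul_of_nonneg_right (intervalIntegral_norm_le_integral_Ioi hp ht) hM₀)

theorem isCb_causalConv {k f : ℝ → ℝ} (hk : IntegrableOn k (Ioi 0)) (hf : IsCb 0 f) :
    IsCb 0 (causalConv k f) := by
  obtain ⟨M, hM₀, hM⟩ := hf.exists_bound
  exact isCb_zero_of_bound
    (continuousOn_causalConv (locallyIntegrableOn_Ici_of_integrableOn_Ioi hk) hf.continuousOn)
    fun t ht => norm_causalConv_le_integral_Ioi hk ht hM₀ fun s hs _ => hM s hs

/-- A bounded continuous function on `[0, ∞)` as a function on `ℝ`, constant on `(-∞, 0]`. -/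
def extend (φ : ℝ≥0 →ᵇ ℝ) (t : ℝ) : ℝ := φ t.toNNReal

theorem extend_add (v w : ℝ≥0 →ᵇ ℝ) (t : ℝ) : extend (v + w) t = extend v t + extend w t := rfl

theorem extend_smul (a : ℝ) (v : ℝ≥0 →ᵇ ℝ) (t : ℝ) : extend (a • v) t = a * extend v t := rfl

theorem eq_of_extend_eq {v w : ℝ≥0 →ᵇ ℝ} (h : ∀ t, 0 ≤ t → extend v t = extend w t) : v = w := by
  ext t
  simpa [extend] using h t t.coe_nonneg

theorem isCb_extend (φ : ℝ≥0 →ᵇ ℝ) : IsCb 0 (extend φ) :=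
  isCb_zero_of_bound (φ.continuous.comp continuous_real_toNNReal).continuousOn
    fun _ _ => φ.norm_coe_le_norm _

/-- The restriction to `[0, ∞)` of a signal, as an element of the Banach space `C_b`. -/
def IsCb.toBCF {N : ℕ} {f : ℝ → ℝ} (hf : IsCb N f) : ℝ≥0 →ᵇ ℝ :=
  BoundedContinuousFunction.ofNormedAddCommGroup (fun t : ℝ≥0 => f t)
    (hf.continuousOn.comp_continuous NNReal.continuous_coe fun t => t.2) hf.exists_bound.choose
    fun t => hf.exists_bound.choose_spec.2 t t.2

theorem IsCb.extend_toBCF {N : ℕ} {f : ℝ → ℝ} (hf : IsCb N f) {t : ℝ} (ht : 0 ≤ t) :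
    extend hf.toBCF t = f t :=
  congrArg f (Real.coe_toNNReal t ht)

/-- Convolution with an integrable kernel, as an operator on `C_b([0, ∞))`. -/
def causalConvBCF {k : ℝ → ℝ} (hk : IntegrableOn k (Ioi 0)) : (ℝ≥0 →ᵇ ℝ) →ₗ[ℝ] (ℝ≥0 →ᵇ ℝ) where
  toFun v := (isCb_causalConv hk (isCb_extend v)).toBCF
  map_add' v w := by
    ext t
    exact causalConv_add (locallyIntegrableOn_Ici_of_integrableOn_Ioi hk)
      (isCb_extend v).continuousOn (isCb_extend w).continuousOn t.coe_nonneg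
  map_smul' a v := by
    ext t
    exact causalConv_const_mul k a (extend v) t

theorem extend_causalConvBCF {k : ℝ → ℝ} (hk : IntegrableOn k (Ioi 0)) (v : ℝ≥0 →ᵇ ℝ) {t : ℝ}
    (ht : 0 ≤ t) : extend (causalConvBCF hk v) t = causalConv k (extend v) t :=
  (isCb_causalConv hk (isCb_extend v)).extend_toBCF ht

theorem norm_causalConvBCF_le {k : ℝ → ℝ} (hk : IntegrableOn k (Ioi 0)) (v : ℝ≥0 →ᵇ ℝ) :
    ‖causalConvBCF hk v‖ ≤ (∫ τ in Ioi (0 : ℝ), ‖k τ‖) * ‖v‖ :=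
  (BoundedContinuousFunction.norm_le (by positivity)).2 fun t =>
    norm_causalConv_le_integral_Ioi hk t.2 (norm_nonneg v) fun s _ _ => v.norm_coe_le_norm _

end Signals

/-! ### Asymptotic bounds -/

section LimsupAbsLE

/-- `limsup_{t → ∞} |f(t)| ≤ c`, in a form that also makes `f` eventually bounded. -/
def LimsupAbsLE (f : ℝ → ℝ) (c : ℝ) : Prop := ∀ ε, 0 < ε → ∀ᶠ t in atTop, |f t| ≤ c + ε

theorem LimsupAbsLE.add {f g : ℝ → ℝ} {a b : ℝ} (hf : LimsupAbsLE f a) (hg : LimsupAbsLE g b) :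
    LimsupAbsLE (fun t => f t + g t) (a + b) := fun ε hε => by
  filter_upwards [hf (ε / 2) (by positivity), hg (ε / 2) (by positivity)] with t h₁ h₂
  linarith [abs_add_le (f t) (g t)]

theorem LimsupAbsLE.const_mul_zero {f : ℝ → ℝ} (h : LimsupAbsLE f 0) (a : ℝ) :
    LimsupAbsLE (fun t => a * f t) 0 := fun ε hε => by
  filter_upwards [h (ε / (|a| + 1)) (by positivity)] with t ht
  rw [zero_add, le_div_iff₀ (by positivity)] at ht
  rw [abs_mul, zero_add]
  nlinarith [abs_nonneg (f t)]

theorem LimsupAbsLE.congr {f g : ℝ → ℝ} {c : ℝ} (h : LimsupAbsLE f c)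
    (hfg : ∀ t, 0 ≤ t → g t = f t) : LimsupAbsLE g c := fun ε hε => by
  filter_upwards [h ε hε, eventually_ge_atTop 0] with t h₁ h₂
  rwa [hfg t h₂]

theorem limsupAbsLE_zero_of_tendsto {f : ℝ → ℝ} (h : Tendsto f atTop (𝓝 0)) :
    LimsupAbsLE f 0 := fun ε hε => by
  filter_upwards [Metric.tendsto_nhds.1 h ε hε] with t ht
  rw [Real.dist_0_eq_abs] at ht
  linarith

theorem isBoundedUnder_abs_of_bound {f : ℝ → ℝ} {M : ℝ} (h : ∀ t, 0 ≤ t → |f t| ≤ M) :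
    IsBoundedUnder (· ≤ ·) atTop fun t => |f t| :=
  ⟨M, (eventually_ge_atTop 0).mono fun t ht => h t ht⟩

theorem limsupAbsLE_limsup_of_bound {f : ℝ → ℝ} {M : ℝ} (h : ∀ t, 0 ≤ t → |f t| ≤ M) :
    LimsupAbsLE f (limsup (fun t => |f t|) atTop) := fun _ hε =>
  (eventually_lt_of_limsup_lt (lt_add_of_pos_right _ hε)
    (isBoundedUnder_abs_of_bound h)).mono fun _ ht => ht.le

theorem LimsupAbsLE.isBoundedUnder {f : ℝ → ℝ} {c : ℝ} (h : LimsupAbsLE f c) :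
    IsBoundedUnder (· ≤ ·) atTop fun t => |f t| := ⟨c + 1, h 1 one_pos⟩

theorem LimsupAbsLE.limsup_le {f : ℝ → ℝ} {c : ℝ} (h : LimsupAbsLE f c) :
    limsup (fun t => |f t|) atTop ≤ c :=
  le_of_forall_pos_le_add fun ε hε => limsup_le_of_le
    (isCoboundedUnder_le_of_le atTop (x := 0) fun t => abs_nonneg (f t)) (h ε hε)

theorem limsup_abs_nonneg {f : ℝ → ℝ} {M : ℝ} (h : ∀ t, 0 ≤ t → |f t| ≤ M) :
    0 ≤ limsup (fun t => |f t|) atTop :=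
  le_limsup_of_frequently_le (Eventually.of_forall fun t => abs_nonneg (f t)).frequently
    (isBoundedUnder_abs_of_bound h)

variable {E : Type*} [NormedAddCommGroup E]

/-- Splitting the convolution at `τ = t - t₀` separates the recent values of `f` from the values
before `t₀`, which only meet the tail of the kernel. -/
theorem norm_causalConv_le_add [NormedSpace ℝ E] {p : ℝ → E}
    (hp : LocallyIntegrableOn p (Ici 0)) {f : ℝ → ℝ} (hf : ContinuousOn f (Ici 0))
    {t₀ t a M : ℝ} (ht₀ : 0 ≤ t₀) (ht : t₀ ≤ t)
    (ha : ∀ s, t₀ ≤ s → |f s| ≤ a) (hM : ∀ s, 0 ≤ s → |f s| ≤ M) :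
    ‖causalConv p f t‖ ≤
      (∫ τ in (0 : ℝ)..(t - t₀), ‖p τ‖) * a + (∫ τ in (t - t₀)..t, ‖p τ‖) * M := by
  have hs : t - t₀ ∈ uIcc 0 t := by
    rw [uIcc_of_le (ht₀.trans ht)]
    exact ⟨sub_nonneg.2 ht, sub_le_self t ht₀⟩
  have hconv := intervalIntegrable_causalConv hp hf (ht₀.trans ht)
  have hnorm := (intervalIntegrable_of_locallyIntegrableOn hp (ht₀.trans ht)).norm
  rw [causalConv, ← intervalIntegral.integral_add_adjacent_intervals
    (hconv.mono_set (uIcc_subset_uIcc_left hs)) (hconv.mono_set (uIcc_subset_uIcc_right hs)),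
    ← intervalIntegral.integral_mul_const, ← intervalIntegral.integral_mul_const]
  refine (norm_add_le _ _).trans (add_le_add ?_ ?_)
  · refine intervalIntegral.norm_integral_le_of_norm_le (sub_nonneg.2 ht)
      (Eventually.of_forall fun τ hτ => ?_)
      ((hnorm.mono_set (uIcc_subset_uIcc_left hs)).mul_const _)
    rw [norm_smul, mul_comm]
    exact mul_le_mul_of_nonneg_left (ha _ (by linarith [hτ.2])) (norm_nonneg _)
  · refine intervalIntegral.norm_integral_le_of_norm_le (sub_le_self t ht₀)
      (Eventually.of_forall fun τ hτ => ?_)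
      ((hnorm.mono_set (uIcc_subset_uIcc_right hs)).mul_const _)
    rw [norm_smul, mul_comm]
    exact mul_le_mul_of_nonneg_left (hM _ (by linarith [hτ.2])) (norm_nonneg _)

theorem tendsto_intervalIntegral_norm_tail {p : ℝ → E} (hp : IntegrableOn p (Ioi 0)) (t₀ : ℝ) :
    Tendsto (fun t => ∫ τ in (t - t₀)..t, ‖p τ‖) atTop (𝓝 0) := by
  have hlim : Tendsto (fun t => ∫ τ in (0 : ℝ)..t, ‖p τ‖) atTop (𝓝 (∫ τ in Ioi 0, ‖p τ‖)) :=
    intervalIntegral_tendsto_integral_Ioi 0 hp.norm tendsto_id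
  have hshift := hlim.comp (tendsto_atTop_add_const_right atTop (-t₀) tendsto_id)
  have hdiff := hlim.sub hshift
  rw [sub_self] at hdiff
  have intervalIntegrable_norm {t : ℝ} (ht : 0 ≤ t) :=
    intervalIntegrable_of_locallyIntegrableOn
      (locallyIntegrableOn_Ici_of_integrableOn_Ioi hp).norm ht
  refine hdiff.congr' ?_
  filter_upwards [eventually_ge_atTop 0, eventually_ge_atTop t₀] with t ht ht'
  exact intervalIntegral.integral_interval_sub_left (intervalIntegrable_norm ht)
    (intervalIntegrable_norm (by simpa using ht'))

theorem limsupAbsLE_causalConv {k f : ℝ → ℝ} (hk : IntegrableOn k (Ioi 0)) (hf : IsCb 0 f) {c : ℝ}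
    (hc : 0 ≤ c) (h : LimsupAbsLE f c) :
    LimsupAbsLE (causalConv k f) ((∫ τ in Ioi (0 : ℝ), |k τ|) * c) := by
  intro ε hε
  have hkL := locallyIntegrableOn_Ici_of_integrableOn_Ioi hk
  set I := ∫ τ in Ioi (0 : ℝ), |k τ|
  have hI₀ : 0 ≤ I := integral_nonneg fun _ => abs_nonneg _
  obtain ⟨M, -, hM⟩ := hf.exists_bound
  set δ := ε / (I + 1)
  have hδ₀ : 0 < δ := by positivity
  have hIδ : I * (c + δ) < I * c + ε := by
    have : (I + 1) * δ = ε := mul_div_cancel₀ ε (by positivity)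
    linarith
  obtain ⟨t₀, ht₀⟩ := eventually_atTop.1 (h δ hδ₀)
  have hlim : Tendsto (fun t => I * (c + δ) + (∫ τ in (t - max t₀ 0)..t, ‖k τ‖) * M) atTop
      (𝓝 (I * (c + δ) + 0 * M)) :=
    ((tendsto_intervalIntegral_norm_tail hk _).mul_const M).const_add _
  rw [zero_mul, add_zero] at hlim
  filter_upwards [hlim.eventually_lt_const hIδ, eventually_ge_atTop (max t₀ 0)] with t hlt ht
  refine (norm_causalConv_le_add hkL hf.continuousOn (le_max_right _ _) ht
    (fun s hs => ht₀ s ((le_max_left _ _).trans hs)) hM).trans (le_trans ?_ hlt.le)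
  gcongr
  exact intervalIntegral_norm_le_integral_Ioi hk (sub_nonneg.2 ht)

theorem limsup_le_maxLimsup {j n : ℕ} (h : j ≤ n) (φ : ℝ → ℝ) :
    limsup (fun t => |iteratedDerivWithin j φ (Ici 0) t|) atTop ≤ maxLimsup n φ :=
  Finset.le_sup' (fun j => limsup (fun t => |iteratedDerivWithin j φ (Ici 0) t|) atTop)
    (Finset.mem_range.2 (Nat.lt_succ_of_le h))

theorem IsCb.maxLimsup_nonneg {n : ℕ} {φ : ℝ → ℝ} (h : IsCb n φ) : 0 ≤ maxLimsup n φ := by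
  obtain ⟨M, hM⟩ := h.2 0 (Nat.zero_le n)
  exact (limsup_abs_nonneg hM).trans (limsup_le_maxLimsup (Nat.zero_le n) φ)

end LimsupAbsLE

/-! ### Volterra equations -/

section Volterra

open scoped NNReal BoundedContinuousFunction

/-- The exponential weight `p ↦ (t ↦ e^{-λt} p(t))`; a large `λ` makes a Volterra operator a
contraction. -/
def expWeight {E : Type*} [NormedAddCommGroup E] [NormedSpace ℝ E] (l : ℝ) (p : ℝ → E) (t : ℝ) :
    E := Real.exp (-l * t) • p t

section ExpWeight

variable {E : Type*} [NormedAddCommGroup E] [NormedSpace ℝ E]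

theorem exp_neg_mul_le_one {l t : ℝ} (hl : 0 ≤ l) (ht : 0 ≤ t) : Real.exp (-l * t) ≤ 1 :=
  Real.exp_le_one_iff.2 (by nlinarith [mul_nonneg hl ht])

theorem expWeight_neg_expWeight (l : ℝ) (p : ℝ → E) : expWeight l (expWeight (-l) p) = p := by
  funext t
  simp [expWeight, smul_smul, ← Real.exp_add]

theorem expWeight_causalConv (l : ℝ) (p : ℝ → E) (f : ℝ → ℝ) :
    expWeight l (causalConv p f) = causalConv (expWeight l p) (expWeight l f) := by
  funext t
  simp only [expWeight, causalConv, ← intervalIntegral.integral_smul, smul_smul, smul_eq_mul]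
  refine intervalIntegral.integral_congr fun τ _ => ?_
  rw [show -l * t = -l * (t - τ) + -l * τ by ring, Real.exp_add]
  ring_nf

theorem norm_expWeight (l : ℝ) (p : ℝ → E) (t : ℝ) :
    ‖expWeight l p t‖ = Real.exp (-l * t) * ‖p t‖ := by
  rw [expWeight, norm_smul, Real.norm_of_nonneg (Real.exp_pos _).le]

theorem norm_expWeight_le {l t : ℝ} (hl : 0 ≤ l) (ht : 0 ≤ t) (p : ℝ → E) :
    ‖expWeight l p t‖ ≤ ‖p t‖ := by
  rw [norm_expWeight]
  exact mul_le_of_le_one_left (norm_nonneg _) (exp_neg_mul_le_one hl ht)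

theorem norm_le_exp_mul_norm_expWeight {l t T : ℝ} (hl : 0 ≤ l) (ht : t ≤ T) (p : ℝ → E) :
    ‖p t‖ ≤ Real.exp (l * T) * ‖expWeight l p t‖ := by
  rw [norm_expWeight, ← mul_assoc, ← Real.exp_add]
  exact le_mul_of_one_le_left (norm_nonneg _)
    (Real.one_le_exp (by linarith [mul_le_mul_of_nonneg_left ht hl]))

theorem continuousOn_expWeight {p : ℝ → E} {s : Set ℝ} (hp : ContinuousOn p s) (l : ℝ) :
    ContinuousOn (expWeight l p) s :=
  ContinuousOn.smul (Continuous.continuousOn (by fun_prop)) hp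

theorem isCb_expWeight {l : ℝ} (hl : 0 ≤ l) {f : ℝ → ℝ} (hf : IsCb 0 f) :
    IsCb 0 (expWeight l f) := by
  obtain ⟨M, -, hM⟩ := hf.exists_bound
  exact isCb_zero_of_bound (continuousOn_expWeight hf.continuousOn l)
    fun t ht => (norm_expWeight_le hl ht f).trans (hM t ht)

theorem integrableOn_expWeight {p : ℝ → E} (hp : IntegrableOn p (Ioi 0)) {l : ℝ} (hl : 0 ≤ l) :
    IntegrableOn (expWeight l p) (Ioi 0) :=
  hp.norm.mono' ((Continuous.aestronglyMeasurable (by fun_prop)).smul hp.aestronglyMeasurable)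
    ((ae_restrict_iff' measurableSet_Ioi).2
      (Eventually.of_forall fun _ ht => norm_expWeight_le hl (le_of_lt ht) p))

theorem tendsto_integral_norm_expWeight {p : ℝ → E} (hp : IntegrableOn p (Ioi 0)) :
    Tendsto (fun l => ∫ t in Ioi (0 : ℝ), ‖expWeight l p t‖) atTop (𝓝 0) := by
  suffices Tendsto (fun l => ∫ t in Ioi (0 : ℝ), ‖expWeight l p t‖) atTop
      (𝓝 (∫ _ in Ioi (0 : ℝ), (0 : ℝ))) by simpa using this
  refine tendsto_integral_filter_of_dominated_convergence (fun t => ‖p t‖) ?_ ?_ hp.norm ?_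
  · filter_upwards [eventually_ge_atTop 0] with l hl
    exact (integrableOn_expWeight hp hl).aestronglyMeasurable.norm
  · filter_upwards [eventually_ge_atTop 0] with l hl
    refine (ae_restrict_iff' measurableSet_Ioi).2 (Eventually.of_forall fun t ht => ?_)
    rw [norm_norm]
    exact norm_expWeight_le hl (le_of_lt ht) p
  · refine (ae_restrict_iff' measurableSet_Ioi).2 (Eventually.of_forall fun t ht => ?_)
    have hexp : Tendsto (fun l : ℝ => Real.exp (-(l * t))) atTop (𝓝 0) :=
      Real.tendsto_exp_neg_atTop_nhds_zero.comp (tendsto_id.atTop_mul_const ht)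
    simpa only [norm_expWeight, neg_mul, zero_mul] using hexp.mul_const ‖p t‖

theorem exists_contracting_expWeight {k : ℝ → E} (hk : IntegrableOn k (Ioi 0)) (z : ℝ) :
    ∃ l, 0 ≤ l ∧ |z| * ∫ t in Ioi (0 : ℝ), ‖expWeight l k t‖ ≤ 1 / 2 := by
  have hlim := (tendsto_integral_norm_expWeight hk).const_mul |z|
  rw [mul_zero] at hlim
  obtain ⟨l, hl, hl₀⟩ :=
    ((hlim.eventually_le_const (by norm_num : (0 : ℝ) < 1 / 2)).and (eventually_ge_atTop 0)).exists
  exact ⟨l, hl₀, hl⟩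

end ExpWeight

/-- `y` is a continuous solution on `[0, ∞)` of the Volterra equation `y = a + z k * y`. -/
structure IsVolterraSolution (k : ℝ → ℝ) (z : ℝ) (a y : ℝ → ℝ) : Prop where
  continuousOn : ContinuousOn y (Ici 0)
  equation : ∀ t, 0 ≤ t → y t = a t + z * causalConv k y t

namespace IsVolterraSolution

variable {k : ℝ → ℝ} {z : ℝ} {a y : ℝ → ℝ}

theorem expWeight (h : IsVolterraSolution k z a y) (l : ℝ) :
    IsVolterraSolution (expWeight l k) z (expWeight l a) (expWeight l y) := by
  refine ⟨continuousOn_expWeight h.continuousOn l, fun t ht => ?_⟩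
  rw [← expWeight_causalConv, Regulation.expWeight, h.equation t ht]
  simp only [Regulation.expWeight, smul_eq_mul]
  ring

theorem continuousOn_data (h : IsVolterraSolution k z a y) (hk : LocallyIntegrableOn k (Ici 0)) :
    ContinuousOn a (Ici 0) :=
  (h.continuousOn.sub ((continuousOn_causalConv hk h.continuousOn).const_mul z)).congr
    fun t ht => by simp only [Pi.sub_apply, h.equation t ht, add_sub_cancel_right]

theorem abs_le_of_contracting (h : IsVolterraSolution k z a y) (hk : IntegrableOn k (Ioi 0))
    (hz : |z| * ∫ t in Ioi (0 : ℝ), ‖k t‖ ≤ 1 / 2) {T A : ℝ}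
    (hA : ∀ t, 0 ≤ t → t ≤ T → |a t| ≤ A) {t : ℝ} (ht : 0 ≤ t) (htT : t ≤ T) :
    |y t| ≤ 2 * A := by
  obtain ⟨s, hs, hmax⟩ := isCompact_Icc.exists_isMaxOn (nonempty_Icc.2 (ht.trans htT))
    (h.continuousOn.abs.mono (Icc_subset_Ici_self : Icc 0 T ⊆ Ici 0))
  have hconv := norm_causalConv_le_integral_Ioi hk hs.1 (abs_nonneg (y s))
    fun u h₀ hu => hmax ⟨h₀, hu.trans hs.2⟩
  have : |y s| ≤ A + 1 / 2 * |y s| := by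
    calc |y s| ≤ |a s| + |z| * |causalConv k y s| := by
          rw [← abs_mul, h.equation s hs.1]
          exact abs_add_le _ _
      _ ≤ A + |z| * ((∫ t in Ioi (0 : ℝ), ‖k t‖) * |y s|) := by
          gcongr
          exacts [hA s hs.1 hs.2, hconv]
      _ ≤ A + 1 / 2 * |y s| := by
          rw [← mul_assoc]
          gcongr
  have := isMaxOn_iff.1 hmax t ⟨ht, htT⟩
  linarith

theorem integral_abs_le_of_contracting (h : IsVolterraSolution k z a y)
    (hk : IntegrableOn k (Ioi 0)) (hz : |z| * ∫ t in Ioi (0 : ℝ), ‖k t‖ ≤ 1 / 2) {T : ℝ}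
    (hT : 0 ≤ T) : ∫ t in (0 : ℝ)..T, |y t| ≤ 2 * ∫ t in (0 : ℝ)..T, |a t| := by
  have hkL := locallyIntegrableOn_Ici_of_integrableOn_Ioi hk
  have hy := h.continuousOn
  have intervalIntegrable_abs {f : ℝ → ℝ} (hf : ContinuousOn f (Ici 0)) :=
    intervalIntegrable_of_continuousOn_Ici hf.abs hT
  have ha := intervalIntegrable_abs (h.continuousOn_data hkL)
  have hc := (intervalIntegrable_abs (continuousOn_causalConv hkL hy)).const_mul |z|
  have : ∫ t in (0 : ℝ)..T, |y t| ≤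
      (∫ t in (0 : ℝ)..T, |a t|) + 1 / 2 * ∫ t in (0 : ℝ)..T, |y t| := by
    calc ∫ t in (0 : ℝ)..T, |y t|
        ≤ ∫ t in (0 : ℝ)..T, (|a t| + |z| * |causalConv k y t|) := by
          refine intervalIntegral.integral_mono_on hT (intervalIntegrable_abs hy) (ha.add hc)
            fun t ht => ?_
          rw [← abs_mul, h.equation t ht.1]
          exact abs_add_le _ _
      _ = (∫ t in (0 : ℝ)..T, |a t|) + |z| * ∫ t in (0 : ℝ)..T, |causalConv k y t| := by
          rw [intervalIntegral.integral_add ha hc, intervalIntegral.integral_const_mul]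
      _ ≤ (∫ t in (0 : ℝ)..T, |a t|) +
            |z| * ((∫ t in Ioi (0 : ℝ), ‖k t‖) * ∫ t in (0 : ℝ)..T, |y t|) := by
          have := intervalIntegral.integral_nonneg (μ := volume) hT fun t _ => abs_nonneg (y t)
          gcongr
          exact (integral_norm_causalConv_le hkL hy hT).trans (mul_le_mul_of_nonneg_right
            (intervalIntegral_norm_le_integral_Ioi hk hT) this)
      _ ≤ _ := by
          rw [← mul_assoc]
          have := intervalIntegral.integral_nonneg (μ := volume) hT fun t _ => abs_nonneg (y t)
          gcongr
  linarith

end IsVolterraSolution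

theorem exists_isVolterraSolution_of_contracting {k : ℝ → ℝ} (hk : IntegrableOn k (Ioi 0)) {z : ℝ}
    (hz : |z| * ∫ t in Ioi (0 : ℝ), ‖k t‖ ≤ 1 / 2) {a : ℝ → ℝ} (ha : IsCb 0 a) :
    ∃ y, IsVolterraSolution k z a y := by
  let Ψ : (ℝ≥0 →ᵇ ℝ) → (ℝ≥0 →ᵇ ℝ) := fun φ => ha.toBCF + z • causalConvBCF hk φ
  have hΨ : ContractingWith (1 / 2) Ψ := by
    refine ⟨by rw [← NNReal.coe_lt_coe]; norm_num, LipschitzWith.of_dist_le_mul fun φ χ => ?_⟩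
    have hdist : dist (Ψ φ) (Ψ χ) = |z| * ‖causalConvBCF hk (φ - χ)‖ := by
      rw [dist_add_left, dist_eq_norm, map_sub, ← Real.norm_eq_abs, ← norm_smul, smul_sub]
    rw [hdist, dist_eq_norm]
    calc |z| * ‖causalConvBCF hk (φ - χ)‖
        ≤ |z| * ((∫ t in Ioi (0 : ℝ), ‖k t‖) * ‖φ - χ‖) := by
          gcongr
          exact norm_causalConvBCF_le hk _
      _ ≤ ((1 / 2 : ℝ≥0) : ℝ) * ‖φ - χ‖ := by
          rw [← mul_assoc]
          gcongr
          simpa using hz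
  have hfix : Ψ (ContractingWith.fixedPoint Ψ hΨ) = _ := hΨ.fixedPoint_isFixedPt
  refine ⟨extend (ContractingWith.fixedPoint Ψ hΨ), (isCb_extend _).continuousOn, fun t ht => ?_⟩
  conv_lhs => rw [← hfix]
  rw [extend_add, extend_smul, ha.extend_toBCF ht, extend_causalConvBCF hk _ ht]

theorem exists_isVolterraSolution {k : ℝ → ℝ} (hk : IntegrableOn k (Ioi 0)) (z : ℝ) {a : ℝ → ℝ}
    (ha : IsCb 0 a) : ∃ y, IsVolterraSolution k z a y := by
  obtain ⟨l, hl, hz⟩ := exists_contracting_expWeight hk z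
  obtain ⟨y, hy⟩ := exists_isVolterraSolution_of_contracting (integrableOn_expWeight hk hl) hz
    (isCb_expWeight hl ha)
  have := hy.expWeight (-l)
  have cancel (p : ℝ → ℝ) : expWeight (-l) (expWeight l p) = p := by
    simpa using expWeight_neg_expWeight (-l) p
  rw [cancel, cancel] at this
  exact ⟨_, this⟩

theorem exists_isVolterraSolution_bounds {k : ℝ → ℝ} (hk : IntegrableOn k (Ioi 0)) (z : ℝ) :
    ∃ c : ℝ → ℝ, (∀ T, 0 ≤ c T) ∧ ∀ a y : ℝ → ℝ, IsVolterraSolution k z a y → ∀ T, 0 ≤ T →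
      (∀ A, (∀ t, 0 ≤ t → t ≤ T → |a t| ≤ A) → ∀ t, 0 ≤ t → t ≤ T → |y t| ≤ c T * A) ∧
      ∫ t in (0 : ℝ)..T, |y t| ≤ c T * ∫ t in (0 : ℝ)..T, |a t| := by
  obtain ⟨l, hl, hz⟩ := exists_contracting_expWeight hk z
  have hkl := integrableOn_expWeight hk hl
  refine ⟨fun T => Real.exp (l * T) * 2, fun T => by positivity, fun a y h T hT => ⟨?_, ?_⟩⟩
  · intro A hA t ht htT
    rw [mul_assoc]
    refine (norm_le_exp_mul_norm_expWeight hl htT y).trans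
      (mul_le_mul_of_nonneg_left ?_ (Real.exp_pos _).le)
    exact (h.expWeight l).abs_le_of_contracting hkl hz
      (fun s hs hsT => (norm_expWeight_le hl hs a).trans (hA s hs hsT)) ht htT
  · have intervalIntegrable_abs {f : ℝ → ℝ} (hf : ContinuousOn f (Ici 0)) :=
      intervalIntegrable_of_continuousOn_Ici hf.abs hT
    have ha := h.continuousOn_data (locallyIntegrableOn_Ici_of_integrableOn_Ioi hk)
    calc ∫ t in (0 : ℝ)..T, |y t|
        ≤ ∫ t in (0 : ℝ)..T, Real.exp (l * T) * |expWeight l y t| :=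
          intervalIntegral.integral_mono_on hT (intervalIntegrable_abs h.continuousOn)
            ((intervalIntegrable_abs (continuousOn_expWeight h.continuousOn l)).const_mul _)
            fun t ht => norm_le_exp_mul_norm_expWeight hl ht.2 y
      _ = Real.exp (l * T) * ∫ t in (0 : ℝ)..T, |expWeight l y t| :=
          intervalIntegral.integral_const_mul _ _
      _ ≤ Real.exp (l * T) * (2 * ∫ t in (0 : ℝ)..T, |expWeight l a t|) := by
          gcongr
          exact (h.expWeight l).integral_abs_le_of_contracting hkl hz hT
      _ ≤ Real.exp (l * T) * (2 * ∫ t in (0 : ℝ)..T, |a t|) := by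
          gcongr
          exact intervalIntegral.integral_mono_on hT
            (intervalIntegrable_abs (continuousOn_expWeight ha l)) (intervalIntegrable_abs ha)
            fun t ht => norm_expWeight_le hl ht.1 a
      _ = _ := (mul_assoc _ _ _).symm

theorem IsVolterraSolution.sub {k : ℝ → ℝ} {z : ℝ} {a a' y y' : ℝ → ℝ}
    (h : IsVolterraSolution k z a y) (h' : IsVolterraSolution k z a' y')
    (hk : LocallyIntegrableOn k (Ici 0)) :
    IsVolterraSolution k z (fun t => a t - a' t) (fun t => y t - y' t) where
  continuousOn := h.continuousOn.sub h'.continuousOn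
  equation t ht := by
    have hsub := causalConv_add hk h.continuousOn (h'.continuousOn.const_mul (-1)) ht
    rw [causalConv_const_mul, neg_one_smul, ← sub_eq_add_neg] at hsub
    simp only [neg_one_mul, ← sub_eq_add_neg] at hsub
    rw [hsub, h.equation t ht, h'.equation t ht]
    ring

theorem IsVolterraSolution.unique {k : ℝ → ℝ} {z : ℝ} {a a' y y' : ℝ → ℝ}
    (h : IsVolterraSolution k z a y) (h' : IsVolterraSolution k z a' y')
    (hk : IntegrableOn k (Ioi 0)) (haa' : ∀ t, 0 ≤ t → a t = a' t) {t : ℝ} (ht : 0 ≤ t) :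
    y t = y' t := by
  obtain ⟨c, -, hc⟩ := exists_isVolterraSolution_bounds hk z
  have hsub := h.sub h' (locallyIntegrableOn_Ici_of_integrableOn_Ioi hk)
  have hle := (hc _ _ hsub t ht).1 0 (fun s hs _ => by simp [haa' s hs]) t ht le_rfl
  rw [mul_zero] at hle
  exact sub_eq_zero.1 (abs_nonpos_iff.1 hle)

theorem IsVolterraSolution.causalConv {k : ℝ → ℝ} {z : ℝ} {a y F : ℝ → ℝ}
    (h : IsVolterraSolution k z a y) (hk : LocallyIntegrableOn k (Ici 0))
    (hF : ContinuousOn F (Ici 0)) :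
    IsVolterraSolution k z (Regulation.causalConv F a) (Regulation.causalConv F y) where
  continuousOn := continuousOn_causalConv (locallyIntegrableOn_Ici_of_continuousOn hF)
    h.continuousOn
  equation t ht := by
    rw [causalConv_congr h.equation ht,
      causalConv_add (locallyIntegrableOn_Ici_of_continuousOn hF) (h.continuousOn_data hk)
        ((continuousOn_causalConv hk h.continuousOn).const_mul z) ht,
      causalConv_const_mul, causalConv_left_comm hk hF h.continuousOn ht, smul_eq_mul]

end Volterra

/-! ### Exponentially stable semigroups -/

section RightDerivative

variable {E : Type*} [NormedAddCommGroup E] [NormedSpace ℝ E]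

theorem hasDerivWithinAt_Ici_iff_tendsto {f : ℝ → E} {y : E} {t : ℝ} :
    HasDerivWithinAt f y (Ici t) t ↔
      Tendsto (fun h : ℝ => h⁻¹ • (f (t + h) - f t)) (𝓝[>] 0) (𝓝 y) := by
  rw [← hasDerivWithinAt_Ioi_iff_Ici, hasDerivWithinAt_iff_tendsto_slope' (by simp)]
  have hmap : map (fun h : ℝ => t + h) (𝓝[>] 0) = 𝓝[>] t := by
    simp
  rw [← hmap, tendsto_map'_iff]
  refine tendsto_congr fun h => ?_
  simp [slope, Function.comp]

end RightDerivative

theorem tendsto_const_mul_exp_neg (c : ℝ) {ω : ℝ} (hω : 0 < ω) :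
    Tendsto (fun t : ℝ => c * Real.exp (-ω * t)) atTop (𝓝 0) := by
  simpa using (Real.tendsto_exp_atBot.comp
    (tendsto_id.const_mul_atTop_of_neg (neg_lt_zero.2 hω))).const_mul c

namespace C0Semigroup

variable {Z : Type*} [NormedAddCommGroup Z] [NormedSpace ℝ Z] {T : C0Semigroup Z}

theorem op_add_apply (T : C0Semigroup Z) {s t : ℝ} (hs : 0 ≤ s) (ht : 0 ≤ t) (x : Z) :
    T.op (s + t) x = T.op s (T.op t x) := by
  rw [T.op_add s t hs ht]
  rfl

theorem op_zero_apply (T : C0Semigroup Z) (x : Z) : T.op 0 x = x := by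
  rw [T.op_zero]
  rfl

theorem op_comm_apply (T : C0Semigroup Z) {s t : ℝ} (hs : 0 ≤ s) (ht : 0 ≤ t) (x : Z) :
    T.op s (T.op t x) = T.op t (T.op s x) := by
  rw [← T.op_add_apply hs ht, ← T.op_add_apply ht hs, add_comm]

theorem ExpStable.exists_bound (h : T.ExpStable) : ∃ M ω : ℝ, 0 ≤ M ∧ 0 < ω ∧
    ∀ t : ℝ, 0 ≤ t → ‖T.op t‖ ≤ M * Real.exp (-ω * t) := by
  obtain ⟨M, ω, hω, hM⟩ := h
  refine ⟨M, ω, ?_, hω, hM⟩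
  have := (norm_nonneg _).trans (hM 0 le_rfl)
  simpa using this

theorem ExpStable.exists_uniform_bound (h : T.ExpStable) : ∃ M : ℝ, 0 ≤ M ∧
    ∀ t : ℝ, 0 ≤ t → ‖T.op t‖ ≤ M := by
  obtain ⟨M, ω, hM0, hω, hM⟩ := h.exists_bound
  exact ⟨M, hM0, fun t ht => (hM t ht).trans
    (mul_le_of_le_one_right hM0 (exp_neg_mul_le_one hω.le ht))⟩

theorem ExpStable.tendsto_op_apply (h : T.ExpStable) {ι : Type*} {l : Filter ι} {s : ι → ℝ}
    {x : ι → Z} {t₀ : ℝ} {x₀ : Z} (ht₀ : 0 ≤ t₀) (hs : Tendsto s l (𝓝[Ici 0] t₀))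
    (hx : Tendsto x l (𝓝 x₀)) : Tendsto (fun i => T.op (s i) (x i)) l (𝓝 (T.op t₀ x₀)) := by
  obtain ⟨M, -, hM⟩ := h.exists_uniform_bound
  have hfixed : Tendsto (fun i => T.op (s i) x₀) l (𝓝 (T.op t₀ x₀)) :=
    (T.continuousOn x₀ t₀ ht₀).tendsto.comp hs
  have hvarying : Tendsto (fun i => T.op (s i) (x i - x₀)) l (𝓝 0) := by
    have hbound : Tendsto (fun i => M * ‖x i - x₀‖) l (𝓝 0) := by
      have := (hx.sub_const x₀).norm.const_mul M
      simpa using this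
    refine squeeze_zero_norm' ?_ hbound
    filter_upwards [hs.eventually self_mem_nhdsWithin] with i hi
    exact ((T.op (s i)).le_opNorm _).trans (mul_le_mul_of_nonneg_right (hM _ hi) (norm_nonneg _))
  have := hvarying.add hfixed
  simpa [map_sub] using this

theorem ExpStable.tendsto_op_atTop (h : T.ExpStable) (x : Z) :
    Tendsto (fun t => T.op t x) atTop (𝓝 0) := by
  obtain ⟨M, ω, -, hω, hM⟩ := h.exists_bound
  have hbound : Tendsto (fun t : ℝ => M * Real.exp (-ω * t) * ‖x‖) atTop (𝓝 0) := by
    simpa only [zero_mul] using (tendsto_const_mul_exp_neg M hω).mul_const ‖x‖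
  refine squeeze_zero_norm' ?_ hbound
  filter_upwards [eventually_ge_atTop 0] with t ht
  exact ((T.op t).le_opNorm _).trans (mul_le_mul_of_nonneg_right (hM t ht) (norm_nonneg _))

theorem Gen.unique {x y y' : Z} (h : T.Gen x y) (h' : T.Gen x y') : y = y' :=
  tendsto_nhds_unique h h'

theorem Gen.add {x y x' y' : Z} (h : T.Gen x y) (h' : T.Gen x' y') : T.Gen (x + x') (y + y') := by
  refine (Tendsto.add h h').congr fun s => ?_
  rw [← smul_add, map_add]
  abel_nf

theorem Gen.smul {x y : Z} (h : T.Gen x y) (c : ℝ) : T.Gen (c • x) (c • y) := by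
  refine (Tendsto.const_smul h c).congr fun s => ?_
  rw [map_smul, ← smul_sub, smul_comm]

theorem Gen.sub {x y x' y' : Z} (h : T.Gen x y) (h' : T.Gen x' y') : T.Gen (x - x') (y - y') := by
  simpa [sub_eq_add_neg] using h.add (h'.smul (-1))

theorem Gen.map_op {x y : Z} (h : T.Gen x y) {t : ℝ} (ht : 0 ≤ t) :
    T.Gen (T.op t x) (T.op t y) := by
  refine (((T.op t).continuous.tendsto y).comp h).congr' ?_
  filter_upwards [self_mem_nhdsWithin] with s hs
  simp only [Function.comp, map_smul, map_sub]
  rw [T.op_comm_apply ht (le_of_lt hs)]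

theorem Gen.hasDerivWithinAt_right {x y : Z} (h : T.Gen x y) {t : ℝ} (ht : 0 ≤ t) :
    HasDerivWithinAt (fun s => T.op s x) (T.op t y) (Ici t) t := by
  rw [hasDerivWithinAt_Ici_iff_tendsto]
  refine (((T.op t).continuous.tendsto y).comp h).congr' ?_
  filter_upwards [self_mem_nhdsWithin] with s hs
  simp only [Function.comp, map_smul, map_sub]
  rw [T.op_add_apply ht (le_of_lt hs)]

theorem ExpStable.integrableOn_op_apply (hT : T.ExpStable) (x : Z) :
    IntegrableOn (fun t => T.op t x) (Ioi 0) := by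
  obtain ⟨M, ω, -, hω, hM⟩ := hT.exists_bound
  refine Integrable.mono' (((exp_neg_integrableOn_Ioi 0 hω).const_mul M).mul_const ‖x‖)
    (((T.continuousOn x).mono Ioi_subset_Ici_self).aestronglyMeasurable measurableSet_Ioi) ?_
  refine (ae_restrict_iff' measurableSet_Ioi).2 (Eventually.of_forall fun t ht => ?_)
  exact ((T.op t).le_opNorm _).trans (mul_le_mul_of_nonneg_right (hM t (le_of_lt ht))
    (norm_nonneg _))

theorem ExpStable.tendsto_intervalIntegral_op (hT : T.ExpStable) (x : Z) :
    Tendsto (fun t => ∫ s in (0 : ℝ)..t, T.op s x) atTop (𝓝 (∫ t in Ioi (0 : ℝ), T.op t x)) :=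
  intervalIntegral_tendsto_integral_Ioi 0 (hT.integrableOn_op_apply x) tendsto_id

theorem intervalIntegrable_op_apply (T : C0Semigroup Z) (x : Z) {t : ℝ} (ht : 0 ≤ t) :
    IntervalIntegrable (fun s => T.op s x) volume 0 t :=
  intervalIntegrable_of_continuousOn_Ici (T.continuousOn x) ht

theorem ExpStable.continuousOn_op_sub_apply (hT : T.ExpStable) {w : ℝ → Z}
    (hw : ContinuousOn w (Ici 0)) (t : ℝ) :
    ContinuousOn (fun s => T.op (t - s) (w s)) (Icc 0 t) := by
  intro s hs
  refine hT.tendsto_op_apply (sub_nonneg.2 hs.2) ?_ ((hw s hs.1).mono Icc_subset_Ici_self)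
  refine tendsto_nhdsWithin_of_tendsto_nhds_of_eventually_within _ ?_ ?_
  · exact (Continuous.tendsto (by fun_prop) s).mono_left nhdsWithin_le_nhds
  · filter_upwards [self_mem_nhdsWithin] with u hu using sub_nonneg.2 hu.2

variable [CompleteSpace Z]

theorem Gen.op_sub_eq_integral {x y : Z} (h : T.Gen x y) {t : ℝ} (ht : 0 ≤ t) :
    T.op t x - x = ∫ s in (0 : ℝ)..t, T.op s y := by
  have hc := T.continuousOn y
  have hconst : ∀ s ∈ Icc 0 t, T.op s x - ∫ σ in (0 : ℝ)..s, T.op σ y =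
      T.op 0 x - ∫ σ in (0 : ℝ)..0, T.op σ y := by
    refine constant_of_has_deriv_right_zero (ContinuousOn.sub
      ((T.continuousOn x).mono Icc_subset_Ici_self) fun s hs =>
      ((hasDerivWithinAt_integral_Ici hc hs.1).continuousWithinAt).mono Icc_subset_Ici_self)
      fun s hs => ?_
    have hderiv := (h.hasDerivWithinAt_right hs.1).sub
      ((hasDerivWithinAt_integral_Ici hc hs.1).mono (Ici_subset_Ici.2 hs.1))
    rw [sub_self] at hderiv
    exact hderiv
  have hval := hconst t ⟨ht, le_rfl⟩
  rw [intervalIntegral.integral_same, sub_zero, T.op_zero_apply] at hval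
  rw [sub_eq_iff_eq_add, add_comm, ← sub_eq_iff_eq_add, hval]

theorem Gen.hasDerivWithinAt {x y : Z} (h : T.Gen x y) {t : ℝ} (ht : 0 ≤ t) :
    HasDerivWithinAt (fun s => T.op s x) (T.op t y) (Ici 0) t := by
  have hderiv := (hasDerivWithinAt_integral_Ici (T.continuousOn y) ht).add_const x
  have heq : ∀ s ∈ Ici (0 : ℝ), T.op s x = (∫ σ in (0 : ℝ)..s, T.op σ y) + x := fun s hs => by
    rw [← h.op_sub_eq_integral hs]
    abel
  exact hderiv.congr heq (heq t ht)

theorem ExpStable.hasDerivWithinAt_op_sub_apply (hT : T.ExpStable) {w : ℝ → Z} {w' y : Z}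
    {s t : ℝ} (hst : s < t) (hw : HasDerivWithinAt w w' (Ici s) s) (hy : T.Gen (w s) y) :
    HasDerivWithinAt (fun s => T.op (t - s) (w s)) (T.op (t - s) (w' - y)) (Ici s) s := by
  have hpos : 0 < t - s := sub_pos.2 hst
  have deriv_fst : HasDerivAt (fun u => T.op (t - u) (w s)) (-T.op (t - s) y) s := by
    have := (hy.hasDerivWithinAt hpos.le).hasDerivAt (Ici_mem_nhds hpos)
    simpa [Function.comp_def] using HasDerivAt.scomp s this ((hasDerivAt_id s).const_sub t)
  have deriv_snd : Tendsto (fun h : ℝ => T.op (t - (s + h)) (h⁻¹ • (w (s + h) - w s))) (𝓝[>] 0)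
      (𝓝 (T.op (t - s) w')) := by
    refine hT.tendsto_op_apply hpos.le ?_ (hasDerivWithinAt_Ici_iff_tendsto.1 hw)
    have hc : Tendsto (fun h : ℝ => t - (s + h)) (𝓝[>] 0) (𝓝 (t - s)) := by
      have : Tendsto (fun h : ℝ => t - (s + h)) (𝓝 0) (𝓝 (t - (s + 0))) :=
        Continuous.tendsto (by fun_prop) 0
      rw [add_zero] at this
      exact this.mono_left nhdsWithin_le_nhds
    exact tendsto_nhdsWithin_of_tendsto_nhds_of_eventually_within _ hc
      ((hc.eventually (lt_mem_nhds hpos)).mono fun u hu => le_of_lt hu)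
  rw [hasDerivWithinAt_Ici_iff_tendsto, map_sub,
    sub_eq_add_neg (T.op (t - s) w')]
  refine (deriv_snd.add (hasDerivWithinAt_Ici_iff_tendsto.1
    (deriv_fst.hasDerivWithinAt (s := Ici s)))).congr fun h => ?_
  rw [map_smul, ← smul_add, map_sub]
  abel_nf

theorem ExpStable.eq_zero_of_hasDerivWithinAt (hT : T.ExpStable) {w w' : ℝ → Z}
    (hw : ∀ s, 0 ≤ s → HasDerivWithinAt w (w' s) (Ici 0) s)
    (hgen : ∀ s, 0 ≤ s → T.Gen (w s) (w' s)) (h0 : w 0 = 0) {t : ℝ} (ht : 0 ≤ t) : w t = 0 := by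
  have hconst : ∀ s ∈ Icc 0 t, T.op (t - s) (w s) = T.op (t - 0) (w 0) := by
    refine constant_of_has_deriv_right_zero (hT.continuousOn_op_sub_apply
      (fun s hs => (hw s hs).continuousWithinAt) t) fun s hs => ?_
    simpa using hT.hasDerivWithinAt_op_sub_apply hs.2 ((hw s hs.1).mono (Ici_subset_Ici.2 hs.1))
      (hgen s hs.1)
  simpa [T.op_zero_apply, h0] using hconst t ⟨ht, le_rfl⟩

theorem op_integral (T : C0Semigroup Z) (x : Z) {t h : ℝ} (ht : 0 ≤ t) (hh : 0 ≤ h) :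
    T.op h (∫ s in (0 : ℝ)..t, T.op s x) - ∫ s in (0 : ℝ)..t, T.op s x =
      (∫ s in (0 : ℝ)..(t + h), T.op s x) - (∫ s in (0 : ℝ)..t, T.op s x) -
        ∫ s in (0 : ℝ)..h, T.op s x := by
  have hshift : T.op h (∫ s in (0 : ℝ)..t, T.op s x) = ∫ s in h..(t + h), T.op s x := by
    rw [← ContinuousLinearMap.intervalIntegral_comp_comm _ (T.intervalIntegrable_op_apply x ht)]
    have := intervalIntegral.integral_comp_add_right (a := 0) (b := t) (fun s => T.op s x) h
    rw [zero_add] at this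
    rw [← this]
    refine intervalIntegral.integral_congr fun s hs => ?_
    rw [uIcc_of_le ht] at hs
    rw [add_comm, T.op_add_apply hh hs.1]
  have hsplit : (∫ s in (0 : ℝ)..(t + h), T.op s x) - ∫ s in (0 : ℝ)..h, T.op s x =
      ∫ s in h..(t + h), T.op s x :=
    intervalIntegral.integral_interval_sub_left
      (T.intervalIntegrable_op_apply x (add_nonneg ht hh)) (T.intervalIntegrable_op_apply x hh)
  rw [hshift, ← hsplit]
  abel

theorem gen_integral (T : C0Semigroup Z) (x : Z) {t : ℝ} (ht : 0 ≤ t) :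
    T.Gen (∫ s in (0 : ℝ)..t, T.op s x) (T.op t x - x) := by
  have hd : ∀ t, 0 ≤ t → HasDerivWithinAt (fun t => ∫ s in (0 : ℝ)..t, T.op s x) (T.op t x)
      (Ici t) t := fun t ht =>
    (hasDerivWithinAt_integral_Ici (T.continuousOn x) ht).mono (Ici_subset_Ici.2 ht)
  have hderiv_t := hasDerivWithinAt_Ici_iff_tendsto.1 (hd t ht)
  have hderiv_zero := hasDerivWithinAt_Ici_iff_tendsto.1 (hd 0 le_rfl)
  rw [T.op_zero_apply] at hderiv_zero
  refine (hderiv_t.sub hderiv_zero).congr' ?_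
  filter_upwards [self_mem_nhdsWithin] with h hh
  rw [T.op_integral x ht (le_of_lt hh), zero_add, intervalIntegral.integral_same, sub_zero,
    ← smul_sub]

theorem ExpStable.eq_op_of_gen_integral (hT : T.ExpStable) {f : ℝ → Z} (hf : ContinuousOn f (Ici 0))
    {x : Z} (hgen : ∀ s, 0 ≤ s → T.Gen (∫ σ in (0 : ℝ)..s, f σ) (f s - x)) {t : ℝ} (ht : 0 ≤ t) :
    f t = T.op t x := by
  have hderiv : ∀ s, 0 ≤ s →
      HasDerivWithinAt (fun s => (∫ σ in (0 : ℝ)..s, f σ) - ∫ σ in (0 : ℝ)..s, T.op σ x)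
        (f s - T.op s x) (Ici 0) s := fun s hs =>
    (hasDerivWithinAt_integral_Ici hf hs).fun_sub
      (hasDerivWithinAt_integral_Ici (T.continuousOn x) hs)
  have hzero : ∀ s, 0 ≤ s → (∫ σ in (0 : ℝ)..s, f σ) - ∫ σ in (0 : ℝ)..s, T.op σ x = 0 :=
    fun s hs => hT.eq_zero_of_hasDerivWithinAt hderiv (fun s hs => by
      simpa using (hgen s hs).sub (T.gen_integral x hs)) (by simp) hs
  exact sub_eq_zero.1 ((uniqueDiffOn_Ici 0 t ht).eq_deriv _ (hderiv t ht)
    ((hasDerivWithinAt_const t (Ici 0) (0 : Z)).congr hzero (hzero t ht)))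

theorem ExpStable.op_integral_Ioi_sub (hT : T.ExpStable) (x : Z) {h : ℝ} (hh : 0 ≤ h) :
    T.op h (∫ t in Ioi (0 : ℝ), T.op t x) - (∫ t in Ioi (0 : ℝ), T.op t x) =
      -∫ s in (0 : ℝ)..h, T.op s x := by
  have hlim := hT.tendsto_intervalIntegral_op x
  have hlim_diff := (((T.op h).continuous.tendsto _).comp hlim).sub hlim
  have hlim_shift := ((hlim.comp (tendsto_atTop_add_const_right _ h tendsto_id)).sub hlim).sub_const
    (∫ s in (0 : ℝ)..h, T.op s x)
  rw [sub_self, zero_sub] at hlim_shift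
  refine tendsto_nhds_unique hlim_diff (hlim_shift.congr' ?_)
  filter_upwards [eventually_ge_atTop 0] with t ht
  exact (T.op_integral x ht hh).symm

theorem ExpStable.gen_neg_integral_Ioi (hT : T.ExpStable) (y : Z) :
    T.Gen (-∫ t in Ioi (0 : ℝ), T.op t y) y := by
  have hderiv := hasDerivWithinAt_Ici_iff_tendsto.1
    (hasDerivWithinAt_integral_Ici (T.continuousOn y) le_rfl)
  rw [T.op_zero_apply] at hderiv
  refine hderiv.congr' ?_
  filter_upwards [self_mem_nhdsWithin] with h hh
  rw [zero_add, intervalIntegral.integral_same, sub_zero, map_neg, ← neg_sub',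
    hT.op_integral_Ioi_sub y (le_of_lt hh), neg_neg]

theorem ExpStable.gen_iff_eq_integral (hT : T.ExpStable) {x y : Z} :
    T.Gen x y ↔ x = -∫ t in Ioi (0 : ℝ), T.op t y := by
  refine ⟨fun h => ?_, fun h => h ▸ hT.gen_neg_integral_Ioi y⟩
  have hlim : Tendsto (fun t => T.op t x - x) atTop (𝓝 (∫ t in Ioi (0 : ℝ), T.op t y)) := by
    refine (hT.tendsto_intervalIntegral_op y).congr' ?_
    filter_upwards [eventually_ge_atTop 0] with t ht
    exact (h.op_sub_eq_integral ht).symm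
  rw [tendsto_nhds_unique hlim ((hT.tendsto_op_atTop x).sub_const x), zero_sub, neg_neg]

end C0Semigroup

/-! ### Analytic semigroups and fractional powers -/

theorem integral_rpow_mul_sub_rpow {s r x : ℝ} (hs : 0 < s) (hr : 0 < r) (hx : 0 < x) :
    ∫ t in (0 : ℝ)..x, t ^ (s - 1) * (x - t) ^ (r - 1) =
      x ^ (s + r - 1) * (Real.Gamma s * Real.Gamma r / Real.Gamma (s + r)) := by
  have beta_eq : Complex.betaIntegral s r =
      ((Real.Gamma s * Real.Gamma r / Real.Gamma (s + r) : ℝ) : ℂ) := by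
    have hΓ : Complex.Gamma ((s : ℂ) + r) ≠ 0 :=
      Complex.Gamma_ne_zero_of_re_pos (by simpa using add_pos hs hr)
    push_cast
    rw [← Complex.Gamma_ofReal, ← Complex.Gamma_ofReal, ← Complex.Gamma_ofReal,
      Complex.Gamma_mul_Gamma_eq_betaIntegral (by simpa using hs) (by simpa using hr)]
    push_cast
    rw [mul_comm, mul_div_assoc, div_self hΓ, mul_one]
  have integral_ofReal :
      ∫ t in (0 : ℝ)..x, (t : ℂ) ^ ((s : ℂ) - 1) * ((x : ℂ) - t) ^ ((r : ℂ) - 1) =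
      ((∫ t in (0 : ℝ)..x, t ^ (s - 1) * (x - t) ^ (r - 1) : ℝ) : ℂ) := by
    rw [← intervalIntegral.integral_ofReal]
    refine intervalIntegral.integral_congr fun t ht => ?_
    rw [uIcc_of_le hx.le] at ht
    rw [Complex.ofReal_mul, Complex.ofReal_cpow ht.1, Complex.ofReal_cpow (sub_nonneg.2 ht.2)]
    push_cast
    rfl
  have scaled := Complex.betaIntegral_scaled (s : ℂ) (r : ℂ) hx
  rw [integral_ofReal, beta_eq, show ((s : ℂ) + r - 1) = ((s + r - 1 : ℝ) : ℂ) by push_cast; rfl,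
    ← Complex.ofReal_cpow hx.le, ← Complex.ofReal_mul] at scaled
  exact_mod_cast scaled

theorem integrableOn_rpow_mul_exp {s ω : ℝ} (hs : 0 < s) (hω : 0 < ω) :
    IntegrableOn (fun t : ℝ => t ^ (s - 1) * Real.exp (-ω * t)) (Ioi 0) := by
  simpa using integrableOn_rpow_mul_exp_neg_mul_rpow (s := s - 1) (p := 1) (b := ω)
    (by linarith) one_pos hω

theorem inv_min_half_one_le {t : ℝ} (ht : 0 < t) : (min (t / 2) 1)⁻¹ ≤ (2 + t) * t⁻¹ := by
  have hmin : 0 < min (t / 2) 1 := lt_min (by linarith) one_pos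
  rw [← div_eq_mul_inv, inv_le_comm₀ hmin (by positivity), inv_div]
  refine le_min ?_ ?_
  · rw [div_le_div_iff₀ (by positivity) (by positivity)]
    nlinarith
  · rw [div_le_one (by positivity)]
    linarith

theorem two_add_mul_exp_le {ω t : ℝ} (hω : 0 < ω) (ht : 0 ≤ t) :
    (2 + t) * Real.exp (-ω * (t / 2)) ≤ (2 + 4 / ω) * Real.exp (-(ω / 4) * t) := by
  rw [show -ω * (t / 2) = -(ω / 4) * t + -(ω / 4) * t by ring, Real.exp_add, ← mul_assoc]
  refine mul_le_mul_of_nonneg_right ?_ (Real.exp_pos _).le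
  have exp_le_one : Real.exp (-(ω / 4) * t) ≤ 1 := exp_neg_mul_le_one (by positivity) ht
  have mul_exp_le : t * Real.exp (-(ω / 4) * t) ≤ 4 / ω := by
    have := Real.mul_exp_neg_le_exp_neg_one (ω / 4 * t)
    have := Real.exp_le_one_iff.2 (neg_nonpos.2 zero_le_one)
    rw [le_div_iff₀ hω, neg_mul]
    linarith
  linarith

theorem inv_add_le_rpow {t τ θ : ℝ} (ht : 0 < t) (hτ : 0 < τ) (h0 : 0 ≤ θ) (h1 : θ ≤ 1) :
    (t + τ)⁻¹ ≤ t ^ (-θ) * τ ^ (θ - 1) := by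
  have weighted_prod_le : t ^ θ * τ ^ (1 - θ) ≤ t + τ := by
    calc t ^ θ * τ ^ (1 - θ) ≤ (t + τ) ^ θ * (t + τ) ^ (1 - θ) :=
          mul_le_mul (Real.rpow_le_rpow ht.le (by linarith) h0)
            (Real.rpow_le_rpow hτ.le (by linarith) (by linarith)) (by positivity) (by positivity)
      _ = t + τ := by
          rw [← Real.rpow_add (by positivity)]
          simp
  rw [Real.rpow_neg ht.le, show θ - 1 = -(1 - θ) by ring, Real.rpow_neg hτ.le, ← mul_inv]
  exact inv_anti₀ (by positivity) weighted_prod_le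

namespace C0Semigroup

variable {Z : Type*} [NormedAddCommGroup Z] [NormedSpace ℝ Z] {T : C0Semigroup Z}

theorem Gen.map_of_commute {x y : Z} (h : T.Gen x y) (L : Z →L[ℝ] Z)
    (hL : ∀ t, 0 ≤ t → ∀ x, L (T.op t x) = T.op t (L x)) : T.Gen (L x) (L y) := by
  refine ((L.continuous.tendsto y).comp h).congr' ?_
  filter_upwards [self_mem_nhdsWithin] with s hs
  simp only [Function.comp, map_smul, map_sub]
  rw [hL s (le_of_lt hs)]

theorem exists_gen_op (hT : T.ExpStable) (hA : T.IsAnalytic) : ∃ c ω : ℝ, 0 ≤ c ∧ 0 < ω ∧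
    ∀ t, 0 < t → ∀ x, ∃ y, T.Gen (T.op t x) y ∧ ‖y‖ ≤ c * t⁻¹ * Real.exp (-ω * t) * ‖x‖ := by
  obtain ⟨M, ω, hM0, hω, hM⟩ := hT.exists_bound
  obtain ⟨Ma, hMa⟩ := hA
  refine ⟨|Ma| * M * (2 + 4 / ω), ω / 4, by positivity, by positivity, fun t ht x => ?_⟩
  -- Write `T(t) = T(ε) T(t - ε)`: analyticity acts on the first factor, stability on the second.
  set ε := min (t / 2) 1
  have hε0 : 0 < ε := lt_min (by linarith) one_pos
  have hεt : ε ≤ t / 2 := min_le_left _ _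
  obtain ⟨y, hy, hyn⟩ := hMa ε hε0 (min_le_right _ _) (T.op (t - ε) x)
  refine ⟨y, by rwa [← T.op_add_apply hε0.le (by linarith), add_sub_cancel] at hy, ?_⟩
  have norm_op_le : ‖T.op (t - ε) x‖ ≤ M * Real.exp (-ω * (t / 2)) * ‖x‖ := by
    refine ((T.op _).le_opNorm x).trans (mul_le_mul_of_nonneg_right ?_ (norm_nonneg _))
    refine (hM _ (by linarith)).trans (mul_le_mul_of_nonneg_left (Real.exp_le_exp.2 ?_) hM0)
    nlinarith
  calc ‖y‖ ≤ ε⁻¹ * (|Ma| * ‖T.op (t - ε) x‖) := by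
        rw [inv_mul_eq_div, le_div_iff₀ hε0, mul_comm]
        exact hyn.trans (mul_le_mul_of_nonneg_right (le_abs_self _) (norm_nonneg _))
    _ ≤ ((2 + t) * t⁻¹) * (|Ma| * (M * Real.exp (-ω * (t / 2)) * ‖x‖)) := by
        gcongr
        exact inv_min_half_one_le ht
    _ = |Ma| * M * t⁻¹ * ‖x‖ * ((2 + t) * Real.exp (-ω * (t / 2))) := by ring
    _ ≤ |Ma| * M * t⁻¹ * ‖x‖ * ((2 + 4 / ω) * Real.exp (-(ω / 4) * t)) := by
        gcongr _ * ?_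
        exact two_add_mul_exp_le hω ht.le
    _ = _ := by ring

/-- The bounded operator `A e^{At}`, for `t > 0`, where `A` is the generator of an exponentially
stable analytic semigroup. It is picked by choice among the operators that send each `x` to the
value of the generator at `e^{At} x`. -/
def genOp (T : C0Semigroup Z) (t : ℝ) : Z →L[ℝ] Z :=
  Classical.epsilon fun L : Z →L[ℝ] Z => ∀ x, T.Gen (T.op t x) (L x)

theorem gen_genOp (hT : T.ExpStable) (hA : T.IsAnalytic) {t : ℝ} (ht : 0 < t) (x : Z) :
    T.Gen (T.op t x) (T.genOp t x) := by
  obtain ⟨c, ω, -, -, h⟩ := exists_gen_op hT hA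
  choose f hf hfn using h t ht
  let L : Z →ₗ[ℝ] Z :=
    { toFun := f
      map_add' := fun x y => (hf (x + y)).unique (by rw [map_add]; exact (hf x).add (hf y))
      map_smul' := fun a x => (hf (a • x)).unique (by rw [map_smul]; exact (hf x).smul a) }
  have : ∃ L : Z →L[ℝ] Z, ∀ x, T.Gen (T.op t x) (L x) := ⟨L.mkContinuous _ hfn, hf⟩
  exact Classical.epsilon_spec this x

theorem exists_norm_genOp_le (hT : T.ExpStable) (hA : T.IsAnalytic) : ∃ c ω : ℝ, 0 ≤ c ∧ 0 < ω ∧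
    ∀ t, 0 < t → ‖T.genOp t‖ ≤ c * t⁻¹ * Real.exp (-ω * t) := by
  obtain ⟨c, ω, hc, hω, h⟩ := exists_gen_op hT hA
  refine ⟨c, ω, hc, hω, fun t ht => ContinuousLinearMap.opNorm_le_bound _ (by positivity)
    fun x => ?_⟩
  obtain ⟨y, hy, hyn⟩ := h t ht x
  rwa [(gen_genOp hT hA ht x).unique hy]

theorem genOp_add (hT : T.ExpStable) (hA : T.IsAnalytic) {s t : ℝ} (hs : 0 ≤ s) (ht : 0 < t) :
    T.genOp (s + t) = (T.op s).comp (T.genOp t) := by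
  ext x
  refine (gen_genOp hT hA (by linarith) x).unique ?_
  rw [T.op_add_apply hs ht.le]
  exact (gen_genOp hT hA ht x).map_op hs

theorem genOp_op (hT : T.ExpStable) (hA : T.IsAnalytic) {s t : ℝ} (hs : 0 ≤ s) (ht : 0 < t)
    (x : Z) : T.genOp t (T.op s x) = T.genOp (t + s) x := by
  refine (gen_genOp hT hA ht _).unique ?_
  rw [← T.op_add_apply ht.le hs]
  exact gen_genOp hT hA (by linarith) x

theorem map_genOp (hT : T.ExpStable) (hA : T.IsAnalytic) {t : ℝ} (ht : 0 < t) (L : Z →L[ℝ] Z)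
    (hL : ∀ t, 0 ≤ t → ∀ x, L (T.op t x) = T.op t (L x)) (x : Z) :
    L (T.genOp t x) = T.genOp t (L x) := by
  refine (Gen.unique ?_ ((gen_genOp hT hA ht x).map_of_commute L hL)).symm
  rw [hL t ht.le]
  exact gen_genOp hT hA ht _

theorem norm_rpow_smul_genOp_op_le (hT : T.ExpStable) (hA : T.IsAnalytic) {c ω s θ t τ : ℝ}
    (h : ∀ t, 0 < t → ‖T.genOp t‖ ≤ c * t⁻¹ * Real.exp (-ω * t)) (hc : 0 ≤ c) (h0 : 0 ≤ θ)
    (h1 : θ ≤ 1) (ht : 0 < t) (hτ : 0 < τ) (x : Z) :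
    ‖τ ^ (1 - s - 1) • T.genOp t (T.op τ x)‖ ≤
      c * t ^ (-θ) * Real.exp (-ω * t) * ‖x‖ * (τ ^ (θ - s - 1) * Real.exp (-ω * τ)) := by
  rw [genOp_op hT hA hτ.le ht, norm_smul, Real.norm_of_nonneg (by positivity)]
  calc τ ^ (1 - s - 1) * ‖T.genOp (t + τ) x‖
      ≤ τ ^ (1 - s - 1) * (c * (t + τ)⁻¹ * Real.exp (-ω * (t + τ)) * ‖x‖) := by
        refine mul_le_mul_of_nonneg_left ?_ (by positivity)
        exact ((T.genOp _).le_opNorm x).trans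
          (mul_le_mul_of_nonneg_right (h _ (by positivity)) (norm_nonneg _))
    _ ≤ τ ^ (1 - s - 1) * (c * (t ^ (-θ) * τ ^ (θ - 1)) * Real.exp (-ω * (t + τ)) * ‖x‖) := by
        gcongr
        exact inv_add_le_rpow ht hτ h0 h1
    _ = _ := by
        rw [show θ - s - 1 = (1 - s - 1) + (θ - 1) by ring, Real.rpow_add hτ,
          show -ω * (t + τ) = -ω * t + -ω * τ by ring, Real.exp_add]
        ring

theorem norm_op_sub_op_le [CompleteSpace Z] (hT : T.ExpStable) (hA : T.IsAnalytic) {M : ℝ}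
    (hM : ∀ t, 0 ≤ t → ‖T.op t‖ ≤ M) {a s t : ℝ} (ha : 0 < a) (hs : a ≤ s) (hst : s ≤ t) :
    ‖T.op t - T.op s‖ ≤ M * (M * ‖T.genOp a‖) * (t - s) := by
  have hM0 : 0 ≤ M := (norm_nonneg _).trans (hM 0 le_rfl)
  refine ContinuousLinearMap.opNorm_le_bound _
    (mul_nonneg (by positivity) (sub_nonneg.2 hst)) fun x => ?_
  have op_s : T.op s x = T.op (s - a) (T.op a x) := by
    rw [← T.op_add_apply (sub_nonneg.2 hs) ha.le, sub_add_cancel]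
  have op_t : T.op t x = T.op (s - a) (T.op (t - s) (T.op a x)) := by
    rw [← T.op_add_apply (sub_nonneg.2 hst) ha.le,
      ← T.op_add_apply (sub_nonneg.2 hs) (by linarith)]
    congr 2
    ring
  have norm_integral_le : ‖∫ σ in (0 : ℝ)..(t - s), T.op σ (T.genOp a x)‖ ≤
      M * (‖T.genOp a‖ * ‖x‖) * |t - s - 0| := by
    refine intervalIntegral.norm_integral_le_of_norm_le_const fun σ hσ => ?_
    rw [uIoc_of_le (sub_nonneg.2 hst)] at hσ
    exact ((T.op σ).le_opNorm _).trans (mul_le_mul (hM σ hσ.1.le) ((T.genOp a).le_opNorm x)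
      (norm_nonneg _) hM0)
  rw [sub_zero, abs_of_nonneg (sub_nonneg.2 hst)] at norm_integral_le
  rw [sub_apply, op_s, op_t, ← map_sub,
    (gen_genOp hT hA ha x).op_sub_eq_integral (sub_nonneg.2 hst)]
  refine ((T.op _).le_opNorm _).trans ((mul_le_mul (hM _ (sub_nonneg.2 hs)) norm_integral_le
    (norm_nonneg _) hM0).trans_eq ?_)
  ring

theorem continuousOn_op [CompleteSpace Z] (hT : T.ExpStable) (hA : T.IsAnalytic) :
    ContinuousOn T.op (Ioi 0) := by
  obtain ⟨M, -, hM⟩ := hT.exists_uniform_bound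
  intro t₀ (ht₀ : 0 < t₀)
  have ha : 0 < t₀ / 2 := half_pos ht₀
  set L := M * (M * ‖T.genOp (t₀ / 2)‖)
  refine ContinuousAt.continuousWithinAt (tendsto_iff_norm_sub_tendsto_zero.2 ?_)
  have hlim : Tendsto (fun t => L * |t - t₀|) (𝓝 t₀) (𝓝 0) := by
    have : Tendsto (fun t => L * |t - t₀|) (𝓝 t₀) (𝓝 (L * |t₀ - t₀|)) :=
      Continuous.tendsto (by fun_prop) t₀
    simpa using this
  refine squeeze_zero' (Eventually.of_forall fun _ => norm_nonneg _) ?_ hlim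
  filter_upwards [Ioi_mem_nhds (half_lt_self ht₀)] with t ht
  rcases le_total t₀ t with h | h
  · rw [abs_of_nonneg (sub_nonneg.2 h)]
    exact norm_op_sub_op_le hT hA hM ha (half_le_self ht₀.le) h
  · rw [abs_of_nonpos (sub_nonpos.2 h), norm_sub_rev, neg_sub]
    exact norm_op_sub_op_le hT hA hM ha (le_of_lt ht) h

theorem continuousOn_genOp [CompleteSpace Z] (hT : T.ExpStable) (hA : T.IsAnalytic) :
    ContinuousOn T.genOp (Ioi 0) := by
  intro t₀ (ht₀ : 0 < t₀)
  set a := t₀ / 2 with ha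
  have ha0 : 0 < a := by positivity
  have hop : ContinuousAt T.op (t₀ - a) :=
    (continuousOn_op hT hA).continuousAt (Ioi_mem_nhds (by linarith))
  have hcomp : ContinuousAt (fun t => (T.op (t - a)).comp (T.genOp a)) t₀ :=
    (ContinuousAt.comp (f := fun t => t - a) hop (by fun_prop)).clm_comp continuousAt_const
  refine (hcomp.congr ?_).continuousWithinAt
  filter_upwards [Ioi_mem_nhds (show a < t₀ by linarith)] with t ht
  rw [← genOp_add hT hA (sub_nonneg.2 (le_of_lt ht)) ha0, sub_add_cancel]

section NegPow

theorem uniformContinuous_preNegMap (T : C0Semigroup Z) (s : ℝ) :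
    UniformContinuous (T.preNegMap s) :=
  ((T.preNegMap s).mkContinuous 1 fun x => (one_mul ‖x‖).symm.le).uniformContinuous

theorem negPow_zero (T : C0Semigroup Z) (x : Z) : T.negPow 0 x = x := by simp [negPow]

variable [CompleteSpace Z]

theorem integrableOn_rpow_smul_op (hT : T.ExpStable) (hA : T.IsAnalytic) {s : ℝ} (hs : 0 < s) :
    IntegrableOn (fun t : ℝ => t ^ (s - 1) • T.op t) (Ioi 0) := by
  obtain ⟨M, ω, -, hω, hM⟩ := hT.exists_bound
  refine Integrable.mono' ((integrableOn_rpow_mul_exp hs hω).const_mul M) ?_ ?_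
  · have hpow : ContinuousOn (fun t : ℝ => t ^ (s - 1)) (Ioi 0) :=
      continuousOn_id.rpow_const fun t ht => Or.inl (ne_of_gt ht)
    exact (hpow.smul (continuousOn_op hT hA)).aestronglyMeasurable measurableSet_Ioi
  · refine (ae_restrict_iff' measurableSet_Ioi).2 (Eventually.of_forall fun t ht => ?_)
    have ht' : (0 : ℝ) < t := ht
    rw [norm_smul, Real.norm_of_nonneg (by positivity)]
    calc t ^ (s - 1) * ‖T.op t‖ ≤ t ^ (s - 1) * (M * Real.exp (-ω * t)) :=
          mul_le_mul_of_nonneg_left (hM t ht'.le) (by positivity)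
      _ = _ := by ring

theorem negPow_apply (hT : T.ExpStable) (hA : T.IsAnalytic) {s : ℝ} (hs : 0 < s) (x : Z) :
    T.negPow s x = (Real.Gamma s)⁻¹ • ∫ t in Ioi (0 : ℝ), t ^ (s - 1) • T.op t x := by
  rw [negPow, if_neg hs.ne', smul_apply,
    ContinuousLinearMap.integral_apply (integrableOn_rpow_smul_op hT hA hs)]
  rfl

theorem integrableOn_rpow_smul_op_apply (hT : T.ExpStable) (hA : T.IsAnalytic) {s : ℝ} (hs : 0 < s)
    (x : Z) : IntegrableOn (fun t : ℝ => t ^ (s - 1) • T.op t x) (Ioi 0) :=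
  (integrableOn_rpow_smul_op hT hA hs).apply_continuousLinearMap x

theorem map_negPow (hT : T.ExpStable) (hA : T.IsAnalytic) {s : ℝ} (hs : 0 < s) (L : Z →L[ℝ] Z)
    (x : Z) : L (T.negPow s x) =
      (Real.Gamma s)⁻¹ • ∫ t in Ioi (0 : ℝ), t ^ (s - 1) • L (T.op t x) := by
  rw [negPow_apply hT hA hs, map_smul,
    ← L.integral_comp_comm (integrableOn_rpow_smul_op_apply hT hA hs x)]
  simp only [map_smul]

theorem negPow_op (hT : T.ExpStable) (hA : T.IsAnalytic) {s : ℝ} (hs : 0 ≤ s) {t : ℝ} (ht : 0 ≤ t)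
    (x : Z) : T.negPow s (T.op t x) = T.op t (T.negPow s x) := by
  rcases hs.eq_or_lt with rfl | hs
  · simp [negPow_zero]
  rw [map_negPow hT hA hs, negPow_apply hT hA hs]
  congr 1
  refine setIntegral_congr_fun measurableSet_Ioi fun τ hτ => ?_
  rw [T.op_comm_apply ht (le_of_lt hτ)]

theorem integral_rpow_smul_op_comp (T : C0Semigroup Z) {s r u : ℝ} (hs : 0 < s) (hr : 0 < r)
    (hu : 0 < u) :
    ∫ t in (0 : ℝ)..u, (t ^ (s - 1) • T.op t).comp ((u - t) ^ (r - 1) • T.op (u - t)) =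
      (Real.Gamma s * Real.Gamma r / Real.Gamma (s + r)) • u ^ (s + r - 1) • T.op u := by
  have integrand_eq : ∀ t ∈ uIcc 0 u,
      (t ^ (s - 1) • T.op t).comp ((u - t) ^ (r - 1) • T.op (u - t)) =
        (t ^ (s - 1) * (u - t) ^ (r - 1)) • T.op u := by
    intro t ht
    rw [uIcc_of_le hu.le] at ht
    rw [ContinuousLinearMap.smul_comp, ContinuousLinearMap.comp_smul,
      ← T.op_add t (u - t) ht.1 (sub_nonneg.2 ht.2), add_sub_cancel, smul_smul]
  rw [intervalIntegral.integral_congr integrand_eq, intervalIntegral.integral_smul_const,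
    integral_rpow_mul_sub_rpow hs hr hu, smul_smul, mul_comm]

theorem negPow_negPow (hT : T.ExpStable) (hA : T.IsAnalytic) {s r : ℝ} (hs : 0 ≤ s) (hr : 0 ≤ r)
    (x : Z) : T.negPow s (T.negPow r x) = T.negPow (s + r) x := by
  rcases hs.eq_or_lt with rfl | hs
  · simp [negPow_zero]
  rcases hr.eq_or_lt with rfl | hr
  · simp [negPow_zero]
  have hconv := integral_posConvolution (integrableOn_rpow_smul_op hT hA hs)
    (integrableOn_rpow_smul_op hT hA hr) (ContinuousLinearMap.compL ℝ Z Z Z)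
  simp only [ContinuousLinearMap.compL_apply] at hconv
  rw [setIntegral_congr_fun measurableSet_Ioi fun u hu => T.integral_rpow_smul_op_comp hs hr hu,
    integral_smul] at hconv
  have hΓs := (Real.Gamma_pos_of_pos hs).ne'
  have hΓr := (Real.Gamma_pos_of_pos hr).ne'
  have comp_eq : (T.negPow s).comp (T.negPow r) = T.negPow (s + r) := by
    simp only [negPow, if_neg hs.ne', if_neg hr.ne', if_neg (add_pos hs hr).ne']
    rw [ContinuousLinearMap.smul_comp, ContinuousLinearMap.comp_smul, ← hconv, smul_smul,
      smul_smul]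
    congr 1
    field_simp
  exact DFunLike.congr_fun comp_eq x

theorem inv_apply (hT : T.ExpStable) (hA : T.IsAnalytic) (x : Z) :
    T.inv x = -∫ t in Ioi (0 : ℝ), T.op t x := by
  rw [inv, neg_apply, negPow_apply hT hA one_pos]
  simp

theorem gen_iff (hT : T.ExpStable) (hA : T.IsAnalytic) {x y : Z} : T.Gen x y ↔ x = T.inv y := by
  rw [inv_apply hT hA, hT.gen_iff_eq_integral]

theorem inv_injective (hT : T.ExpStable) (hA : T.IsAnalytic) : Function.Injective T.inv :=
  fun _ _ h => ((gen_iff hT hA).2 rfl).unique ((gen_iff hT hA).2 h)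

theorem inv_op (hT : T.ExpStable) (hA : T.IsAnalytic) {t : ℝ} (ht : 0 ≤ t) (x : Z) :
    T.inv (T.op t x) = T.op t (T.inv x) := by
  simp only [inv, neg_apply, map_neg, negPow_op hT hA zero_le_one ht]

theorem inv_genOp (hT : T.ExpStable) (hA : T.IsAnalytic) {t : ℝ} (ht : 0 < t) (x : Z) :
    T.inv (T.genOp t x) = T.op t x := ((gen_iff hT hA).1 (gen_genOp hT hA ht x)).symm

theorem negPow_injective (hT : T.ExpStable) (hA : T.IsAnalytic) {s : ℝ} (h0 : 0 ≤ s) (h1 : s ≤ 1) :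
    Function.Injective (T.negPow s) := by
  intro x y h
  refine inv_injective hT hA ?_
  have e : ∀ x, T.inv x = -T.negPow (1 - s) (T.negPow s x) := fun x => by
    rw [negPow_negPow hT hA (sub_nonneg.2 h1) h0, sub_add_cancel]
    rfl
  rw [e, e, h]

/-- The bounded operator `(-A)^s e^{At} = -A e^{At} (-A)^{-(1-s)}`, for `0 ≤ s ≤ 1` and `t > 0`. -/
def powOp (T : C0Semigroup Z) (s t : ℝ) : Z →L[ℝ] Z := -(T.genOp t).comp (T.negPow (1 - s))

theorem negPow_powOp (hT : T.ExpStable) (hA : T.IsAnalytic) {s t : ℝ} (h0 : 0 ≤ s) (h1 : s ≤ 1)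
    (ht : 0 < t) (x : Z) : T.negPow s (T.powOp s t x) = T.op t x := by
  rw [powOp, neg_apply, ContinuousLinearMap.comp_apply,
    ← map_genOp hT hA ht (T.negPow (1 - s)) fun t ht x => negPow_op hT hA (sub_nonneg.2 h1) ht x,
    map_neg, negPow_negPow hT hA h0 (sub_nonneg.2 h1), add_sub_cancel]
  exact inv_genOp hT hA ht x

theorem continuousOn_powOp (hT : T.ExpStable) (hA : T.IsAnalytic) (s : ℝ) :
    ContinuousOn (T.powOp s) (Ioi 0) :=
  ((continuousOn_genOp hT hA).clm_comp continuousOn_const).neg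

theorem exists_norm_powOp_le (hT : T.ExpStable) (hA : T.IsAnalytic) {s θ : ℝ} (h0 : 0 ≤ s)
    (hθ : s < θ) (h1 : θ < 1) : ∃ c ω : ℝ, 0 ≤ c ∧ 0 < ω ∧
      ∀ t, 0 < t → ‖T.powOp s t‖ ≤ c * t ^ (-θ) * Real.exp (-ω * t) := by
  obtain ⟨c, ω, hc, hω, h⟩ := exists_norm_genOp_le hT hA
  have hs1 : 0 < 1 - s := by linarith
  have hΓ := Real.Gamma_pos_of_pos hs1
  have hint := integrableOn_rpow_mul_exp (s := θ - s) (by linarith) hω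
  set I := ∫ τ in Ioi (0 : ℝ), τ ^ (θ - s - 1) * Real.exp (-ω * τ) with hI
  have hI0 : 0 ≤ I := setIntegral_nonneg measurableSet_Ioi fun τ (hτ : 0 < τ) => by positivity
  refine ⟨(Real.Gamma (1 - s))⁻¹ * c * I, ω, by positivity, hω, fun t ht => ?_⟩
  refine ContinuousLinearMap.opNorm_le_bound _ (by positivity) fun x => ?_
  have norm_integral_le : ‖∫ τ in Ioi (0 : ℝ), τ ^ (1 - s - 1) • T.genOp t (T.op τ x)‖ ≤
      c * t ^ (-θ) * Real.exp (-ω * t) * ‖x‖ * I := by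
    rw [hI, ← integral_const_mul]
    refine norm_integral_le_of_norm_le (hint.const_mul _) ?_
    exact (ae_restrict_iff' measurableSet_Ioi).2 (Eventually.of_forall fun τ hτ =>
      norm_rpow_smul_genOp_op_le hT hA h hc (by linarith) h1.le ht hτ x)
  rw [powOp, neg_apply, norm_neg, ContinuousLinearMap.comp_apply,
    map_negPow hT hA hs1, norm_smul, Real.norm_of_nonneg (by positivity)]
  calc (Real.Gamma (1 - s))⁻¹ * ‖∫ τ in Ioi (0 : ℝ), τ ^ (1 - s - 1) • T.genOp t (T.op τ x)‖
      ≤ (Real.Gamma (1 - s))⁻¹ * (c * t ^ (-θ) * Real.exp (-ω * t) * ‖x‖ * I) :=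
        mul_le_mul_of_nonneg_left norm_integral_le (by positivity)
    _ = _ := by ring

theorem integrableOn_powOp_apply (hT : T.ExpStable) (hA : T.IsAnalytic) {s : ℝ} (h0 : 0 ≤ s)
    (h1 : s < 1) (x : Z) : IntegrableOn (fun t => T.powOp s t x) (Ioi 0) := by
  obtain ⟨θ, hsθ, hθ⟩ := exists_between h1
  obtain ⟨c, ω, -, hω, h⟩ := exists_norm_powOp_le hT hA h0 hsθ hθ
  have hint := ((integrableOn_rpow_mul_exp (s := 1 - θ) (by linarith) hω).const_mul c).mul_const ‖x‖
  refine Integrable.mono' hint (((continuousOn_powOp hT hA s).clm_apply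
    continuousOn_const).aestronglyMeasurable measurableSet_Ioi) ?_
  refine (ae_restrict_iff' measurableSet_Ioi).2 (Eventually.of_forall fun t ht => ?_)
  rw [show 1 - θ - 1 = -θ by ring, ← mul_assoc]
  exact ((T.powOp s t).le_opNorm x).trans (mul_le_mul_of_nonneg_right (h t ht) (norm_nonneg x))

theorem exists_integral_norm_powOp_apply_le (hT : T.ExpStable) (hA : T.IsAnalytic) {s : ℝ}
    (h0 : 0 ≤ s) (h1 : s < 1) :
    ∃ c : ℝ, 0 ≤ c ∧ ∀ x, ∫ t in Ioi (0 : ℝ), ‖T.powOp s t x‖ ≤ c * ‖x‖ := by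
  obtain ⟨θ, hsθ, hθ⟩ := exists_between h1
  obtain ⟨c, ω, hc, hω, h⟩ := exists_norm_powOp_le hT hA h0 hsθ hθ
  have hint := (integrableOn_rpow_mul_exp (s := 1 - θ) (by linarith) hω).const_mul c
  refine ⟨∫ t in Ioi (0 : ℝ), c * (t ^ (1 - θ - 1) * Real.exp (-ω * t)),
    setIntegral_nonneg measurableSet_Ioi fun t ht => ?_, fun x => ?_⟩
  · have := mem_Ioi.1 ht
    positivity
  · rw [← integral_mul_const]
    refine setIntegral_mono_on (integrableOn_powOp_apply hT hA h0 h1 x).norm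
      (hint.mul_const _) measurableSet_Ioi fun t ht => ((T.powOp s t).le_opNorm x).trans ?_
    rw [show 1 - θ - 1 = -θ by ring, ← mul_assoc]
    exact mul_le_mul_of_nonneg_right (h t ht) (norm_nonneg x)

theorem inv_negPow_powOp_add (hT : T.ExpStable) (hA : T.IsAnalytic) {s r t : ℝ} (hs : 0 ≤ s)
    (hsr : s + r ≤ 1) (ht : 0 < t) (x : Z) :
    T.inv (T.negPow s (T.powOp (s + r) t x)) = -T.op t (T.negPow (1 - r) x) := by
  rw [powOp, neg_apply, ContinuousLinearMap.comp_apply, map_neg, map_neg,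
    map_genOp hT hA ht (T.negPow s) fun t ht x => negPow_op hT hA hs ht x,
    negPow_negPow hT hA hs (sub_nonneg.2 hsr), inv_genOp hT hA ht]
  congr 4
  ring

theorem preInv_eq_negPow_preNegMap (hT : T.ExpStable) (hA : T.IsAnalytic) {s : ℝ}
    (h0 : 0 ≤ s) (h1 : s ≤ 1) (x : T.PreNeg s) :
    T.preInv s x = (-T.negPow (1 - s)) (T.preNegMap s x) := by
  have := negPow_negPow hT hA (sub_nonneg.2 h1) h0 x
  rw [sub_add_cancel] at this
  exact congrArg Neg.neg this.symm

theorem uniformContinuous_preInv (hT : T.ExpStable) (hA : T.IsAnalytic) {s : ℝ} (h0 : 0 ≤ s)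
    (h1 : s ≤ 1) : UniformContinuous (T.preInv s) := by
  rw [funext (preInv_eq_negPow_preNegMap hT hA h0 h1)]
  exact (-T.negPow (1 - s)).uniformContinuous.comp (T.uniformContinuous_preNegMap s)

theorem exists_invExt_eq (hT : T.ExpStable) (hA : T.IsAnalytic) {s : ℝ} (h0 : 0 ≤ s) (h1 : s ≤ 1)
    (b : T.ZNeg s) : ∃ h : Z, T.invExt s b = T.negPow (1 - s) h := by
  have hu := T.uniformContinuous_preNegMap s
  refine ⟨-UniformSpace.Completion.extension (T.preNegMap s) b, ?_⟩
  rw [map_neg, invExt, UniformSpace.Completion.extension_unique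
    (uniformContinuous_preInv hT hA h0 h1)
    ((-T.negPow (1 - s)).uniformContinuous.comp UniformSpace.Completion.uniformContinuous_extension)
    fun a => by
      rw [Function.comp_apply, UniformSpace.Completion.extension_coe hu]
      exact preInv_eq_negPow_preNegMap hT hA h0 h1 a]
  rfl

theorem invExt_smul (hT : T.ExpStable) (hA : T.IsAnalytic) {s : ℝ} (h0 : 0 ≤ s) (h1 : s ≤ 1)
    (c : ℝ) (b : T.ZNeg s) : T.invExt s (c • b) = c • T.invExt s b := by
  have hu := uniformContinuous_preInv hT hA h0 h1
  have hc : Continuous (T.invExt s) := UniformSpace.Completion.continuous_extension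
  induction b using UniformSpace.Completion.induction_on with
  | hp => exact isClosed_eq (hc.comp (continuous_const_smul c)) (hc.const_smul c)
  | ih a =>
    rw [← UniformSpace.Completion.coe_smul, invExt, UniformSpace.Completion.extension_coe hu,
      UniformSpace.Completion.extension_coe hu]
    exact map_smul T.inv c a

end NegPow

end C0Semigroup

namespace Plant

variable {Z : Type*} [NormedAddCommGroup Z] [NormedSpace ℝ Z] {P : Plant Z} {β : ℝ}

/-! ### Admissible plants -/

/-- The standing assumptions without compactness of the resolvent; the exponents are below `1`
because `s_c + s_b < 1` and `s_c + s_d < 1`. -/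
structure Admissible (P : Plant Z) : Prop where
  expStable : P.T.ExpStable
  analytic : P.T.IsAnalytic
  sb_nonneg : 0 ≤ P.sb
  sc_nonneg : 0 ≤ P.sc
  sd_nonneg : 0 ≤ P.sd
  sc_add_sb : P.sc + P.sb < 1
  sc_add_sd : P.sc + P.sd < 1
  C_bounded : ∃ M : ℝ, ∀ h : Z, |P.out (P.T.negPow P.sc h)| ≤ M * ‖h‖
  G_ne_zero : P.G ≠ 0

theorem Standing.admissible (hP : P.Standing) : P.Admissible where
  expStable := hP.expStable
  analytic := hP.analytic
  sb_nonneg := hP.sb_nonneg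
  sc_nonneg := hP.sc_nonneg
  sd_nonneg := hP.sd_nonneg
  sc_add_sb := hP.sc_add_sb
  sc_add_sd := hP.sc_add_sd
  C_bounded := hP.C_bounded
  G_ne_zero := hP.G_ne_zero

theorem Admissible.sc_lt_one (hP : P.Admissible) : P.sc < 1 := by
  linarith [hP.sb_nonneg, hP.sc_add_sb]

/-- `(-A)^{-s_c}`. -/
def negPowC (P : Plant Z) : Z →L[ℝ] Z := P.T.negPow P.sc

/-- `(-A)^{s_c}` on `Z^{s_c}`, with junk values outside of `Z^{s_c}`. -/
def posPowC (P : Plant Z) : Z → Z := Function.invFun P.negPowC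

theorem negPowC_mem (P : Plant Z) (h : Z) : P.negPowC h ∈ P.T.ZPos P.sc :=
  LinearMap.mem_range_self _ h

theorem mem_ZPos_iff {z : Z} : z ∈ P.T.ZPos P.sc ↔ ∃ h, P.negPowC h = z := LinearMap.mem_range

theorem negPowC_posPowC {z : Z} (hz : z ∈ P.T.ZPos P.sc) : P.negPowC (P.posPowC z) = z :=
  Function.invFun_eq (mem_ZPos_iff.1 hz)

/-- The bounded functional `C (-A)^{-s_c}` on `Z`. -/
def Admissible.outNegPowC (hP : P.Admissible) : Z →L[ℝ] ℝ :=
  (P.C ∘ₗ (P.T.negPow P.sc : Z →ₗ[ℝ] Z).rangeRestrict).mkContinuous hP.C_bounded.choose fun h => by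
    have hM := hP.C_bounded.choose_spec h
    rwa [out, dif_pos (show P.T.negPow P.sc h ∈ P.T.ZPos P.sc from P.negPowC_mem h)] at hM

theorem Admissible.out_negPowC (hP : P.Admissible) (h : Z) :
    P.out (P.negPowC h) = hP.outNegPowC h := by
  rw [out, dif_pos (P.negPowC_mem h)]
  rfl

theorem Admissible.out_eq_outNegPowC (hP : P.Admissible) {z : Z} (hz : z ∈ P.T.ZPos P.sc) :
    P.out z = hP.outNegPowC (P.posPowC z) := by
  rw [← hP.out_negPowC, negPowC_posPowC hz]

theorem Admissible.abs_out_le (hP : P.Admissible) {z : Z} (hz : z ∈ P.T.ZPos P.sc) :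
    |P.out z| ≤ ‖hP.outNegPowC‖ * ‖P.posPowC z‖ :=
  hP.out_eq_outNegPowC hz ▸ hP.outNegPowC.le_opNorm _

theorem Admissible.out_add (hP : P.Admissible) {z z' : Z} (hz : z ∈ P.T.ZPos P.sc)
    (hz' : z' ∈ P.T.ZPos P.sc) : P.out (z + z') = P.out z + P.out z' := by
  obtain ⟨h, rfl⟩ := mem_ZPos_iff.1 hz
  obtain ⟨h', rfl⟩ := mem_ZPos_iff.1 hz'
  simp only [← map_add, hP.out_negPowC]

theorem Admissible.out_smul (hP : P.Admissible) {z : Z} (hz : z ∈ P.T.ZPos P.sc) (a : ℝ) :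
    P.out (a • z) = a * P.out z := by
  obtain ⟨h, rfl⟩ := mem_ZPos_iff.1 hz
  rw [← map_smul, hP.out_negPowC, hP.out_negPowC, map_smul, smul_eq_mul]

theorem Admissible.out_neg (hP : P.Admissible) {z : Z} (hz : z ∈ P.T.ZPos P.sc) :
    P.out (-z) = -P.out z := by
  rw [← neg_one_smul ℝ z, hP.out_smul hz, neg_one_mul]

theorem Admissible.out_sum (hP : P.Admissible) {z : ℕ → Z} (hz : ∀ j, z j ∈ P.T.ZPos P.sc)
    (n : ℕ) : P.out (∑ j ∈ Finset.range (n + 1), z j) =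
      ∑ j ∈ Finset.range (n + 1), P.out (z j) := by
  induction n with
  | zero => simp
  | succ n ih =>
    rw [Finset.sum_range_succ, hP.out_add (Submodule.sum_mem _ fun j _ => hz j) (hz _), ih,
      Finset.sum_range_succ _ (n + 1)]

/-! ### Input kernels and mild solutions -/

/-- The kernel `t ↦ (-A)^{s_c} e^{At} A g` on `(0, ∞)`. The vector `A g ∈ Z^{-1}` is an admissible
input direction for outputs defined on `Z^{s_c}` if this kernel is integrable. -/
def inputKernel (P : Plant Z) (g : Z) (t : ℝ) : Z := P.posPowC (P.T.genOp t g)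

/-- The mild solution `e^{At} z₀ + ∫₀ᵗ e^{A(t-τ)} (f₁(τ) A g₁ + f₂(τ) A g₂) dτ` of
`z' = A z + f₁ A g₁ + f₂ A g₂`, `z(0) = z₀`. -/
def mild (P : Plant Z) (g₁ g₂ : Z) (f₁ f₂ : ℝ → ℝ) (z₀ : Z) (t : ℝ) : Z :=
  P.T.op t z₀ +
    P.negPowC (causalConv (P.inputKernel g₁) f₁ t + causalConv (P.inputKernel g₂) f₂ t)

theorem mild_zero (P : Plant Z) (g₁ g₂ : Z) (f₁ f₂ : ℝ → ℝ) (z₀ : Z) :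
    P.mild g₁ g₂ f₁ f₂ z₀ 0 = z₀ := by
  simp [mild, causalConv_apply_zero, P.T.op_zero_apply]

theorem continuousOn_mild {g₁ g₂ : Z}
    (h₁ : IntegrableOn (P.inputKernel g₁) (Ioi 0)) (h₂ : IntegrableOn (P.inputKernel g₂) (Ioi 0))
    {f₁ f₂ : ℝ → ℝ} (hf₁ : ContinuousOn f₁ (Ici 0)) (hf₂ : ContinuousOn f₂ (Ici 0)) (z₀ : Z) :
    ContinuousOn (P.mild g₁ g₂ f₁ f₂ z₀) (Ici 0) :=
  (P.T.continuousOn z₀).add (P.negPowC.continuous.comp_continuousOn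
    ((continuousOn_causalConv (locallyIntegrableOn_Ici_of_integrableOn_Ioi h₁) hf₁).add
      (continuousOn_causalConv (locallyIntegrableOn_Ici_of_integrableOn_Ioi h₂) hf₂)))

variable [CompleteSpace Z]

theorem Admissible.negPowC_injective (hP : P.Admissible) : Function.Injective P.negPowC :=
  C0Semigroup.negPow_injective hP.expStable hP.analytic hP.sc_nonneg hP.sc_lt_one.le

theorem Admissible.posPowC_negPowC (hP : P.Admissible) (h : Z) : P.posPowC (P.negPowC h) = h :=
  Function.leftInverse_invFun hP.negPowC_injective h

theorem Admissible.posPowC_zero (hP : P.Admissible) : P.posPowC 0 = 0 := by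
  simpa using hP.posPowC_negPowC 0

theorem Admissible.negPowC_op (hP : P.Admissible) {t : ℝ} (ht : 0 ≤ t) (x : Z) :
    P.negPowC (P.T.op t x) = P.T.op t (P.negPowC x) :=
  C0Semigroup.negPow_op hP.expStable hP.analytic hP.sc_nonneg ht x

theorem Admissible.negPowC_inputKernel (hP : P.Admissible) (g : Z) {t : ℝ} (ht : 0 < t) :
    P.negPowC (P.inputKernel g t) = P.T.genOp t g := by
  refine negPowC_posPowC (mem_ZPos_iff.2 ⟨P.T.powOp P.sc (t / 2) (P.T.genOp (t / 2) g), ?_⟩)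
  calc P.negPowC (P.T.powOp P.sc (t / 2) (P.T.genOp (t / 2) g))
      = P.T.op (t / 2) (P.T.genOp (t / 2) g) :=
        C0Semigroup.negPow_powOp hP.expStable hP.analytic hP.sc_nonneg hP.sc_lt_one.le
          (half_pos ht) _
    _ = P.T.genOp (t / 2 + t / 2) g := by
        rw [C0Semigroup.genOp_add hP.expStable hP.analytic (half_pos ht).le (half_pos ht),
          ContinuousLinearMap.comp_apply]
    _ = P.T.genOp t g := by rw [add_halves]

theorem Admissible.inv_negPowC_inputKernel (hP : P.Admissible) (g : Z) {t : ℝ} (ht : 0 < t) :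
    P.T.inv (P.negPowC (P.inputKernel g t)) = P.T.op t g := by
  rw [hP.negPowC_inputKernel g ht, C0Semigroup.inv_genOp hP.expStable hP.analytic ht]

theorem Admissible.inputKernel_eq_of_inv_negPowC (hP : P.Admissible) {g h : Z} {t : ℝ} (ht : 0 < t)
    (hgh : P.T.inv (P.negPowC h) = P.T.op t g) : P.inputKernel g t = h := by
  refine hP.negPowC_injective (C0Semigroup.inv_injective hP.expStable hP.analytic ?_)
  rw [hP.inv_negPowC_inputKernel g ht, hgh]

theorem Admissible.inputKernel_add (hP : P.Admissible) (g g' : Z) {t : ℝ} (ht : 0 < t) :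
    P.inputKernel (g + g') t = P.inputKernel g t + P.inputKernel g' t :=
  hP.inputKernel_eq_of_inv_negPowC ht <| by
    simp only [map_add, hP.inv_negPowC_inputKernel _ ht]

theorem Admissible.inputKernel_smul (hP : P.Admissible) (a : ℝ) (g : Z) {t : ℝ} (ht : 0 < t) :
    P.inputKernel (a • g) t = a • P.inputKernel g t :=
  hP.inputKernel_eq_of_inv_negPowC ht <| by
    simp only [map_smul, hP.inv_negPowC_inputKernel _ ht]

theorem Admissible.inputKernel_negPow (hP : P.Admissible) {s : ℝ} (hs : P.sc + s ≤ 1) (h : Z)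
    {t : ℝ} (ht : 0 < t) :
    P.inputKernel (P.T.negPow (1 - s) h) t = -P.T.powOp (P.sc + s) t h := by
  refine hP.inputKernel_eq_of_inv_negPowC ht ?_
  have key := C0Semigroup.inv_negPow_powOp_add hP.expStable hP.analytic hP.sc_nonneg hs ht h
  rw [map_neg, map_neg, negPowC, key, neg_neg]

theorem Admissible.integrableOn_inputKernel_invExt (hP : P.Admissible) {s : ℝ} (h0 : 0 ≤ s)
    (hs : P.sc + s < 1) (b : P.T.ZNeg s) :
    IntegrableOn (P.inputKernel (P.T.invExt s b)) (Ioi 0) := by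
  obtain ⟨h, hh⟩ := C0Semigroup.exists_invExt_eq hP.expStable hP.analytic h0
    (by linarith [hP.sc_nonneg]) b
  have hint := C0Semigroup.integrableOn_powOp_apply hP.expStable hP.analytic
    (add_nonneg hP.sc_nonneg h0) hs h
  refine hint.neg.congr_fun (fun t ht => ?_) measurableSet_Ioi
  rw [hh, hP.inputKernel_negPow hs.le h ht]
  rfl

theorem Admissible.invExt_mem (hP : P.Admissible) {s : ℝ} (h0 : 0 ≤ s) (hs : P.sc + s < 1)
    (b : P.T.ZNeg s) : P.T.invExt s b ∈ P.T.ZPos P.sc := by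
  obtain ⟨h, hh⟩ := C0Semigroup.exists_invExt_eq hP.expStable hP.analytic h0
    (by linarith [hP.sc_nonneg]) b
  have key := C0Semigroup.negPow_negPow hP.expStable hP.analytic hP.sc_nonneg
    (show 0 ≤ 1 - s - P.sc by linarith) h
  rw [show P.sc + (1 - s - P.sc) = 1 - s by ring] at key
  exact mem_ZPos_iff.2 ⟨_, key.trans hh.symm⟩

theorem Admissible.integrableOn_inputKernel_invBin (hP : P.Admissible) :
    IntegrableOn (P.inputKernel P.invBin) (Ioi 0) :=
  hP.integrableOn_inputKernel_invExt hP.sb_nonneg hP.sc_add_sb P.b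

theorem Admissible.integrableOn_inputKernel_invBd (hP : P.Admissible) :
    IntegrableOn (P.inputKernel P.invBd) (Ioi 0) :=
  hP.integrableOn_inputKernel_invExt hP.sd_nonneg hP.sc_add_sd P.bd

theorem Admissible.integrableOn_inputKernel_invB (hP : P.Admissible) :
    IntegrableOn (P.inputKernel P.invB) (Ioi 0) :=
  hP.integrableOn_inputKernel_invExt hP.sb_nonneg hP.sc_add_sb P.B

theorem Admissible.integrableOn_inputKernel_invI0Bd (hP : P.Admissible) :
    IntegrableOn (P.inputKernel P.invI0Bd) (Ioi 0) := by
  refine (hP.integrableOn_inputKernel_invBd.add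
    (hP.integrableOn_inputKernel_invB.smul (P.out P.invBd))).congr_fun (fun t ht => ?_)
    measurableSet_Ioi
  rw [invI0Bd, hP.inputKernel_add _ _ ht, hP.inputKernel_smul _ _ ht]
  rfl

theorem Admissible.invBin_mem (hP : P.Admissible) : P.invBin ∈ P.T.ZPos P.sc :=
  hP.invExt_mem hP.sb_nonneg hP.sc_add_sb P.b

theorem Admissible.invBd_mem (hP : P.Admissible) : P.invBd ∈ P.T.ZPos P.sc :=
  hP.invExt_mem hP.sd_nonneg hP.sc_add_sd P.bd

theorem Admissible.invB_mem (hP : P.Admissible) : P.invB ∈ P.T.ZPos P.sc :=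
  hP.invExt_mem hP.sb_nonneg hP.sc_add_sb P.B

theorem Admissible.invI0Bd_mem (hP : P.Admissible) : P.invI0Bd ∈ P.T.ZPos P.sc :=
  Submodule.add_mem _ hP.invBd_mem (Submodule.smul_mem _ _ hP.invB_mem)

theorem Admissible.invB_eq (hP : P.Admissible) : P.invB = P.G⁻¹ • P.invBin :=
  C0Semigroup.invExt_smul hP.expStable hP.analytic hP.sb_nonneg
    (by linarith [hP.sc_nonneg, hP.sc_add_sb]) _ _

theorem Admissible.out_invB (hP : P.Admissible) : P.out P.invB = -1 := by
  have hG : P.out P.invBin = -P.G := by rw [G, hP.out_neg hP.invBin_mem, neg_neg]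
  rw [hP.invB_eq, hP.out_smul hP.invBin_mem, hG, mul_neg, inv_mul_cancel₀ hP.G_ne_zero]

theorem Admissible.out_invI0Bd (hP : P.Admissible) : P.out P.invI0Bd = 0 := by
  rw [invI0Bd, hP.out_add hP.invBd_mem (Submodule.smul_mem _ _ hP.invB_mem),
    hP.out_smul hP.invB_mem, hP.out_invB]
  ring

theorem Admissible.integral_negPowC_inputKernel (hP : P.Admissible) {g : Z}
    (hg : IntegrableOn (P.inputKernel g) (Ioi 0)) {t : ℝ} (ht : 0 ≤ t) :
    ∫ τ in (0 : ℝ)..t, P.negPowC (P.inputKernel g τ) = P.T.op t g - g := by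
  refine C0Semigroup.inv_injective hP.expStable hP.analytic ?_
  have hp := intervalIntegrable_of_locallyIntegrableOn
    (locallyIntegrableOn_Ici_of_integrableOn_Ioi hg) ht
  calc P.T.inv (∫ τ in (0 : ℝ)..t, P.negPowC (P.inputKernel g τ))
      = ∫ τ in (0 : ℝ)..t, P.T.inv (P.negPowC (P.inputKernel g τ)) := by
        rw [P.negPowC.intervalIntegral_comp_comm hp, ← ContinuousLinearMap.comp_apply,
          ← (P.T.inv.comp P.negPowC).intervalIntegral_comp_comm hp]
        rfl
    _ = ∫ τ in (0 : ℝ)..t, P.T.op τ g := by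
        refine intervalIntegral.integral_congr_ae (Eventually.of_forall fun τ hτ => ?_)
        rw [uIoc_of_le ht] at hτ
        exact hP.inv_negPowC_inputKernel g hτ.1
    _ = P.T.inv (P.T.op t g - g) :=
        (C0Semigroup.gen_iff hP.expStable hP.analytic).1 (P.T.gen_integral g ht)

theorem Admissible.inv_negPowC_causalConv (hP : P.Admissible) {g : Z}
    (hg : IntegrableOn (P.inputKernel g) (Ioi 0)) {f : ℝ → ℝ} (hf : ContinuousOn f (Ici 0))
    {t : ℝ} (ht : 0 ≤ t) :
    P.T.inv (P.negPowC (causalConv (P.inputKernel g) f t)) =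
      ∫ σ in (0 : ℝ)..t, f σ • P.T.op (t - σ) g := by
  have hmap := map_causalConv (P.T.inv.comp P.negPowC)
    (locallyIntegrableOn_Ici_of_integrableOn_Ioi hg) hf ht
  simp only [ContinuousLinearMap.comp_apply] at hmap
  rw [hmap, causalConv_congr_left (fun τ hτ => hP.inv_negPowC_inputKernel g hτ) ht, causalConv,
    ← intervalIntegral_comp_const_sub]
  simp only [sub_sub_cancel]

theorem Admissible.integral_negPowC_causalConv (hP : P.Admissible) {g : Z}
    (hg : IntegrableOn (P.inputKernel g) (Ioi 0)) {f : ℝ → ℝ} (hf : ContinuousOn f (Ici 0))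
    {t : ℝ} (ht : 0 ≤ t) :
    ∫ s in (0 : ℝ)..t, P.negPowC (causalConv (P.inputKernel g) f s) =
      ∫ σ in (0 : ℝ)..t, f σ • (P.T.op (t - σ) g - g) := by
  have hp := locallyIntegrableOn_Ici_of_integrableOn_Ioi hg
  have hNp : LocallyIntegrableOn (fun τ => P.negPowC (P.inputKernel g τ)) (Ici 0) :=
    locallyIntegrableOn_Ici_of_integrableOn_Ioi (P.negPowC.integrable_comp hg)
  have primitive_eq : ∀ s, 0 ≤ s → ∫ σ in (0 : ℝ)..s, f σ = causalConv f (fun _ => 1) s :=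
    fun s _ => by rw [causalConv_comm, causalConv_one]
  calc ∫ s in (0 : ℝ)..t, P.negPowC (causalConv (P.inputKernel g) f s)
      = ∫ s in (0 : ℝ)..t, causalConv (fun τ => P.negPowC (P.inputKernel g τ)) f s :=
        intervalIntegral.integral_congr fun s hs =>
          map_causalConv P.negPowC hp hf (uIcc_of_le ht ▸ hs).1
    _ = ∫ σ in (0 : ℝ)..t,
          f σ • causalConv (fun τ => P.negPowC (P.inputKernel g τ)) (fun _ => 1) (t - σ) := by
        rw [integral_causalConv hNp hf ht, causalConv_congr primitive_eq ht,
          causalConv_causalConv hNp hf continuousOn_const ht]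
    _ = ∫ σ in (0 : ℝ)..t, f σ • (P.T.op (t - σ) g - g) := by
        refine intervalIntegral.integral_congr fun σ hσ => ?_
        rw [uIcc_of_le ht] at hσ
        simp only [causalConv, one_smul,
          hP.integral_negPowC_inputKernel hg (sub_nonneg.2 hσ.2)]

theorem Admissible.inv_negPowC_causalConv_eq_integral (hP : P.Admissible) {g : Z}
    (hg : IntegrableOn (P.inputKernel g) (Ioi 0)) {f : ℝ → ℝ} (hf : ContinuousOn f (Ici 0))
    {t : ℝ} (ht : 0 ≤ t) :
    P.T.inv (P.negPowC (causalConv (P.inputKernel g) f t)) =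
      ∫ s in (0 : ℝ)..t, (P.negPowC (causalConv (P.inputKernel g) f s) + f s • g) := by
  have hp := locallyIntegrableOn_Ici_of_integrableOn_Ioi hg
  have hconv : IntervalIntegrable (fun s => P.negPowC (causalConv (P.inputKernel g) f s))
      volume 0 t :=
    intervalIntegrable_of_continuousOn_Ici
      (P.negPowC.continuous.comp_continuousOn (continuousOn_causalConv hp hf)) ht
  have hfg : IntervalIntegrable (fun s => f s • g) volume 0 t :=
    intervalIntegrable_of_continuousOn_Ici (hf.smul continuousOn_const) ht
  have hduhamel : IntervalIntegrable (fun σ => f σ • P.T.op (t - σ) g) volume 0 t := by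
    refine ContinuousOn.intervalIntegrable ?_
    rw [uIcc_of_le ht]
    exact (hf.mono Icc_subset_Ici_self).smul
      ((P.T.continuousOn g).comp (by fun_prop) fun σ hσ => sub_nonneg.2 hσ.2)
  rw [hP.inv_negPowC_causalConv hg hf ht, intervalIntegral.integral_add hconv hfg,
    hP.integral_negPowC_causalConv hg hf ht]
  simp only [smul_sub]
  rw [intervalIntegral.integral_sub hduhamel hfg, sub_add_cancel]

theorem Admissible.hasDerivWithinAt_inv_negPowC_causalConv (hP : P.Admissible) {g : Z}
    (hg : IntegrableOn (P.inputKernel g) (Ioi 0)) {f : ℝ → ℝ} (hf : ContinuousOn f (Ici 0))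
    {t : ℝ} (ht : 0 ≤ t) :
    HasDerivWithinAt (fun t => P.T.inv (P.negPowC (causalConv (P.inputKernel g) f t)))
      (P.negPowC (causalConv (P.inputKernel g) f t) + f t • g) (Ici 0) t := by
  have hc : ContinuousOn (fun s => P.negPowC (causalConv (P.inputKernel g) f s) + f s • g)
      (Ici 0) :=
    (P.negPowC.continuous.comp_continuousOn (continuousOn_causalConv
      (locallyIntegrableOn_Ici_of_integrableOn_Ioi hg) hf)).add (hf.smul continuousOn_const)
  exact (hasDerivWithinAt_integral_Ici hc ht).congr
    (fun s hs => hP.inv_negPowC_causalConv_eq_integral hg hf hs)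
    (hP.inv_negPowC_causalConv_eq_integral hg hf ht)

theorem Admissible.hasDerivWithinAt_inv_op (hP : P.Admissible) (x : Z) {t : ℝ} (ht : 0 ≤ t) :
    HasDerivWithinAt (fun t => P.T.inv (P.T.op t x)) (P.T.op t x) (Ici 0) t := by
  have hgen : P.T.Gen (P.T.inv x) x := (C0Semigroup.gen_iff hP.expStable hP.analytic).2 rfl
  have hcomm : ∀ s, 0 ≤ s → P.T.inv (P.T.op s x) = P.T.op s (P.T.inv x) :=
    fun s hs => C0Semigroup.inv_op hP.expStable hP.analytic hs x
  exact (hgen.hasDerivWithinAt ht).congr hcomm (hcomm t ht)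

theorem Admissible.eq_of_hasDerivWithinAt_inv (hP : P.Admissible) {z z' F : ℝ → Z}
    (hz : ∀ t, 0 ≤ t → HasDerivWithinAt (fun t => P.T.inv (z t)) (z t + F t) (Ici 0) t)
    (hz' : ∀ t, 0 ≤ t → HasDerivWithinAt (fun t => P.T.inv (z' t)) (z' t + F t) (Ici 0) t)
    (h0 : z 0 = z' 0) {t : ℝ} (ht : 0 ≤ t) : z t = z' t := by
  have hdiff : P.T.inv (z t) - P.T.inv (z' t) = 0 := by
    refine hP.expStable.eq_zero_of_hasDerivWithinAt
      (w := fun t => P.T.inv (z t) - P.T.inv (z' t)) (w' := fun t => z t - z' t)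
      (fun s hs => ?_) (fun _ _ => ?_) (by simp [h0]) ht
    · have hd := (hz s hs).fun_sub (hz' s hs)
      rwa [add_sub_add_right_eq_sub] at hd
    · simp only [← map_sub]
      exact (C0Semigroup.gen_iff hP.expStable hP.analytic).2 rfl
  exact C0Semigroup.inv_injective hP.expStable hP.analytic (sub_eq_zero.1 hdiff)

theorem Admissible.hasDerivWithinAt_mild (hP : P.Admissible) {g₁ g₂ : Z}
    (h₁ : IntegrableOn (P.inputKernel g₁) (Ioi 0)) (h₂ : IntegrableOn (P.inputKernel g₂) (Ioi 0))
    {f₁ f₂ : ℝ → ℝ} (hf₁ : ContinuousOn f₁ (Ici 0)) (hf₂ : ContinuousOn f₂ (Ici 0)) (z₀ : Z)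
    {t : ℝ} (ht : 0 ≤ t) :
    HasDerivWithinAt (fun t => P.T.inv (P.mild g₁ g₂ f₁ f₂ z₀ t))
      (P.mild g₁ g₂ f₁ f₂ z₀ t + (f₁ t • g₁ + f₂ t • g₂)) (Ici 0) t := by
  have hsum := (hP.hasDerivWithinAt_inv_op z₀ ht).fun_add
    ((hP.hasDerivWithinAt_inv_negPowC_causalConv h₁ hf₁ ht).fun_add
      (hP.hasDerivWithinAt_inv_negPowC_causalConv h₂ hf₂ ht))
  simp only [← map_add] at hsum
  refine hsum.congr_deriv ?_
  simp only [mild, map_add]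
  abel

theorem Admissible.eq_mild (hP : P.Admissible) {g₁ g₂ : Z}
    (h₁ : IntegrableOn (P.inputKernel g₁) (Ioi 0)) (h₂ : IntegrableOn (P.inputKernel g₂) (Ioi 0))
    {f₁ f₂ : ℝ → ℝ} (hf₁ : ContinuousOn f₁ (Ici 0)) (hf₂ : ContinuousOn f₂ (Ici 0)) {z : ℝ → Z}
    (hz : ∀ t, 0 ≤ t → HasDerivWithinAt (fun t => P.T.inv (z t))
      (z t + (f₁ t • g₁ + f₂ t • g₂)) (Ici 0) t) {t : ℝ} (ht : 0 ≤ t) :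
    z t = P.mild g₁ g₂ f₁ f₂ (z 0) t :=
  hP.eq_of_hasDerivWithinAt_inv hz
    (fun _ hs => hP.hasDerivWithinAt_mild h₁ h₂ hf₁ hf₂ (z 0) hs) (P.mild_zero _ _ _ _ _).symm ht

end Plant

namespace Plant

variable {Z : Type*} [NormedAddCommGroup Z] [NormedSpace ℝ Z] {P : Plant Z} {β : ℝ}

/-! ### Solutions of the regularized system -/

theorem IsBetaSolution.initial_mem {v w : ℝ → ℝ} {z₀ : Z} {z : ℝ → Z}
    (h : P.IsBetaSolution β v w z₀ z) : z₀ ∈ P.T.ZPos P.sc :=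
  h.initial ▸ h.mem 0 le_rfl

theorem IsBetaSolution.add (hP : P.Admissible) {v w v' w' : ℝ → ℝ} {z₀ z₀' : Z} {z z' : ℝ → Z}
    (h : P.IsBetaSolution β v w z₀ z) (h' : P.IsBetaSolution β v' w' z₀' z') :
    P.IsBetaSolution β (fun t => v t + v' t) (fun t => w t + w' t) (z₀ + z₀')
      (fun t => z t + z' t) := by
  have ho : ∀ t, 0 ≤ t → P.out (z t + z' t) = P.out (z t) + P.out (z' t) :=
    fun t ht => hP.out_add (h.mem t ht) (h'.mem t ht)
  refine ⟨h.continuousOn.add h'.continuousOn,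
    fun t ht => Submodule.add_mem _ (h.mem t ht) (h'.mem t ht),
    (h.out_continuousOn.add h'.out_continuousOn).congr fun t ht => ho t ht,
    by rw [h.initial, h'.initial], fun t ht => ?_⟩
  have := (h.equation t ht).fun_add (h'.equation t ht)
  simp only [map_add]
  convert this using 1
  rw [ho t ht]
  module

theorem IsBetaSolution.smul (hP : P.Admissible) {v w : ℝ → ℝ} {z₀ : Z} {z : ℝ → Z}
    (h : P.IsBetaSolution β v w z₀ z) (a : ℝ) :
    P.IsBetaSolution β (fun t => a * v t) (fun t => a * w t) (a • z₀) (fun t => a • z t) := by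
  have ho : ∀ t, 0 ≤ t → P.out (a • z t) = a * P.out (z t) :=
    fun t ht => hP.out_smul (h.mem t ht) a
  refine ⟨h.continuousOn.const_smul a, fun t ht => Submodule.smul_mem _ a (h.mem t ht),
    (h.out_continuousOn.const_mul a).congr fun t ht => ho t ht, by rw [h.initial], fun t ht => ?_⟩
  have := (h.equation t ht).fun_const_smul a
  simp only [map_smul]
  convert this using 1
  rw [ho t ht]
  module

theorem IsBetaSolution.congr {v w v' w' : ℝ → ℝ} {z₀ : Z} {z : ℝ → Z}
    (h : P.IsBetaSolution β v w z₀ z) (hv : ∀ t, 0 ≤ t → v' t = v t)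
    (hw : ∀ t, 0 ≤ t → w' t = w t) : P.IsBetaSolution β v' w' z₀ z :=
  ⟨h.continuousOn, h.mem, h.out_continuousOn, h.initial, fun t ht => by
    rw [hv t ht, hw t ht]
    exact h.equation t ht⟩

theorem IsBetaSolution.sub (hP : P.Admissible) {v w v' w' : ℝ → ℝ} {z₀ z₀' : Z} {z z' : ℝ → Z}
    (h : P.IsBetaSolution β v w z₀ z) (h' : P.IsBetaSolution β v' w' z₀' z') :
    P.IsBetaSolution β (fun t => v t - v' t) (fun t => w t - w' t) (z₀ - z₀')
      (fun t => z t - z' t) := by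
  have := h.add hP (h'.smul hP (-1))
  simpa [sub_eq_add_neg] using this

theorem IsBetaSolution.shift {v w : ℝ → ℝ} {z₀ : Z} {z : ℝ → Z}
    (h : P.IsBetaSolution β v w z₀ z) {a : ℝ} (ha : 0 ≤ a) :
    P.IsBetaSolution β (fun t => v (a + t)) (fun t => w (a + t)) (z a) (fun t => z (a + t)) := by
  have hm : MapsTo (fun t => a + t) (Ici 0) (Ici 0) := fun t ht => add_nonneg ha ht
  have hc : ContinuousOn (fun t => a + t) (Ici 0) := by fun_prop
  refine ⟨h.continuousOn.comp hc hm, fun t ht => h.mem _ (hm ht), h.out_continuousOn.comp hc hm,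
    by rw [add_zero], fun t ht => ?_⟩
  have hderiv := HasDerivWithinAt.scomp t (h.equation (a + t) (hm ht))
    ((hasDerivWithinAt_id t (Ici 0)).const_add a) hm
  rw [one_smul] at hderiv
  exact hderiv

/-- The scalar input `v / β - ((1 - β) / β) y` by which the regularized system drives `z' = A z`. -/
def feedbackInput (β : ℝ) (v y : ℝ → ℝ) (t : ℝ) : ℝ := 1 / β * v t - (1 - β) / β * y t

theorem continuousOn_feedbackInput {v y : ℝ → ℝ} (hv : ContinuousOn v (Ici 0))
    (hy : ContinuousOn y (Ici 0)) : ContinuousOn (feedbackInput β v y) (Ici 0) :=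
  (hv.const_mul _).sub (hy.const_mul _)

theorem causalConv_feedbackInput {E : Type*} [NormedAddCommGroup E] [NormedSpace ℝ E] {p : ℝ → E}
    (hp : LocallyIntegrableOn p (Ici 0)) {v y : ℝ → ℝ} (hv : ContinuousOn v (Ici 0))
    (hy : ContinuousOn y (Ici 0)) {t : ℝ} (ht : 0 ≤ t) :
    causalConv p (feedbackInput β v y) t =
      (1 / β) • causalConv p v t + -((1 - β) / β) • causalConv p y t := by
  have hinput : ∀ s, 0 ≤ s → feedbackInput β v y s = 1 / β * v s + -((1 - β) / β) * y s :=
    fun s _ => by rw [feedbackInput, neg_mul, sub_eq_add_neg]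
  rw [causalConv_congr hinput ht, causalConv_add hp (hv.const_mul _) (hy.const_mul _) ht,
    causalConv_const_mul, causalConv_const_mul]

/-- `C e^{At} A g`, the impulse response from the input `A g` to the output `C z`. -/
def Admissible.outKernel (hP : P.Admissible) (g : Z) (t : ℝ) : ℝ :=
  hP.outNegPowC (P.inputKernel g t)

theorem Admissible.integrableOn_outKernel (hP : P.Admissible) {g : Z}
    (hg : IntegrableOn (P.inputKernel g) (Ioi 0)) : IntegrableOn (hP.outKernel g) (Ioi 0) :=
  hP.outNegPowC.integrable_comp hg

/-- `(-A)^{s_c}` applied to the state of the regularized system with initial value `(-A)^{-s_c} h₀`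
when the feedback through the output is cut. -/
def openLoopState (P : Plant Z) (β : ℝ) (v w : ℝ → ℝ) (h₀ : Z) (t : ℝ) : Z :=
  P.T.op t h₀ + ((1 / β) • causalConv (P.inputKernel P.invB) v t +
    causalConv (P.inputKernel P.invI0Bd) w t)

theorem openLoopState_zero_zero (P : Plant Z) (β : ℝ) (h₀ : Z) (t : ℝ) :
    P.openLoopState β (fun _ => 0) (fun _ => 0) h₀ t = P.T.op t h₀ := by
  simp [openLoopState, causalConv]

variable [CompleteSpace Z]

theorem Admissible.continuousOn_openLoopState (hP : P.Admissible) {v w : ℝ → ℝ}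
    (hv : ContinuousOn v (Ici 0)) (hw : ContinuousOn w (Ici 0)) (h₀ : Z) :
    ContinuousOn (P.openLoopState β v w h₀) (Ici 0) :=
  (P.T.continuousOn h₀).add (((continuousOn_causalConv
    (locallyIntegrableOn_Ici_of_integrableOn_Ioi hP.integrableOn_inputKernel_invB) hv).const_smul
      _).add (continuousOn_causalConv
    (locallyIntegrableOn_Ici_of_integrableOn_Ioi hP.integrableOn_inputKernel_invI0Bd) hw))

theorem Admissible.exists_norm_openLoopState_le (hP : P.Admissible) (β : ℝ) :
    ∃ c : ℝ, 0 ≤ c ∧ ∀ (v w : ℝ → ℝ) (h₀ : Z) (b t : ℝ), 0 ≤ b → 0 ≤ t →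
      (∀ s, 0 ≤ s → s ≤ t → |v s| ≤ b ∧ |w s| ≤ b) →
        ‖P.openLoopState β v w h₀ t‖ ≤ c * (‖h₀‖ + b) := by
  obtain ⟨M, hM0, hM⟩ := hP.expStable.exists_uniform_bound
  set Ip := ∫ τ in Ioi (0 : ℝ), ‖P.inputKernel P.invB τ‖
  set Iq := ∫ τ in Ioi (0 : ℝ), ‖P.inputKernel P.invI0Bd τ‖
  have hIp : 0 ≤ Ip := integral_nonneg fun _ => norm_nonneg _
  have hIq : 0 ≤ Iq := integral_nonneg fun _ => norm_nonneg _
  refine ⟨M + (|1 / β| * Ip + Iq), by positivity, fun v w h₀ b t hb ht hvw => ?_⟩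
  have hop : ‖P.T.op t h₀‖ ≤ M * ‖h₀‖ :=
    ((P.T.op t).le_opNorm _).trans (mul_le_mul_of_nonneg_right (hM t ht) (norm_nonneg _))
  have hconv_v : ‖causalConv (P.inputKernel P.invB) v t‖ ≤ Ip * b :=
    norm_causalConv_le_integral_Ioi hP.integrableOn_inputKernel_invB ht hb
      fun s h0 h1 => (hvw s h0 h1).1
  have hconv_w : ‖causalConv (P.inputKernel P.invI0Bd) w t‖ ≤ Iq * b :=
    norm_causalConv_le_integral_Ioi hP.integrableOn_inputKernel_invI0Bd ht hb
      fun s h0 h1 => (hvw s h0 h1).2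
  calc ‖P.openLoopState β v w h₀ t‖
      ≤ M * ‖h₀‖ + (|1 / β| * (Ip * b) + Iq * b) := by
        refine (norm_add_le _ _).trans (add_le_add hop ((norm_add_le _ _).trans ?_))
        rw [norm_smul, Real.norm_eq_abs]
        gcongr
    _ ≤ M * (‖h₀‖ + b) + (|1 / β| * (Ip * (‖h₀‖ + b)) + Iq * (‖h₀‖ + b)) := by
        gcongr <;> linarith [norm_nonneg h₀]
    _ = _ := by ring

theorem Admissible.isCb_outNegPowC_openLoopState (hP : P.Admissible) {v w : ℝ → ℝ}
    (hv : IsCb 0 v) (hw : IsCb 0 w) (h₀ : Z) :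
    IsCb 0 fun t => hP.outNegPowC (P.openLoopState β v w h₀ t) := by
  obtain ⟨c, -, hle⟩ := hP.exists_norm_openLoopState_le β
  obtain ⟨bv, hbv, hv_le⟩ := hv.exists_bound
  obtain ⟨bw, hbw, hw_le⟩ := hw.exists_bound
  refine isCb_zero_of_bound (hP.outNegPowC.continuous.comp_continuousOn
    (hP.continuousOn_openLoopState hv.continuousOn hw.continuousOn h₀)) fun t ht =>
      (hP.outNegPowC.le_opNorm _).trans (mul_le_mul_of_nonneg_left
        (hle v w h₀ (bv + bw) t (add_nonneg hbv hbw) ht fun s hs _ => ⟨?_, ?_⟩) (norm_nonneg _))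
  · exact (hv_le s hs).trans (le_add_of_nonneg_right hbw)
  · exact (hw_le s hs).trans (le_add_of_nonneg_left hbv)

theorem Admissible.outNegPowC_openLoopState_zero (hP : P.Admissible) {v w : ℝ → ℝ}
    (hv : ContinuousOn v (Ici 0)) (hw : ContinuousOn w (Ici 0)) {t : ℝ} (ht : 0 ≤ t) :
    hP.outNegPowC (P.openLoopState β v w 0 t) =
      1 / β * causalConv (hP.outKernel P.invB) v t +
        causalConv (hP.outKernel P.invI0Bd) w t := by
  rw [openLoopState, map_zero, zero_add, map_add, map_smul, smul_eq_mul,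
    map_causalConv _ (locallyIntegrableOn_Ici_of_integrableOn_Ioi
      hP.integrableOn_inputKernel_invB) hv ht,
    map_causalConv _ (locallyIntegrableOn_Ici_of_integrableOn_Ioi
      hP.integrableOn_inputKernel_invI0Bd) hw ht]
  rfl

theorem Admissible.outNegPowC_causalConv_invB (hP : P.Admissible) {y : ℝ → ℝ}
    (hy : ContinuousOn y (Ici 0)) {t : ℝ} (ht : 0 ≤ t) :
    hP.outNegPowC (causalConv (P.inputKernel P.invB) y t) =
      causalConv (hP.outKernel P.invB) y t :=
  map_causalConv _ (locallyIntegrableOn_Ici_of_integrableOn_Ioi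
    hP.integrableOn_inputKernel_invB) hy ht

theorem Admissible.mild_feedbackInput (hP : P.Admissible) {v y : ℝ → ℝ}
    (hv : ContinuousOn v (Ici 0)) (hy : ContinuousOn y (Ici 0)) (w : ℝ → ℝ) (h₀ : Z) {t : ℝ}
    (ht : 0 ≤ t) :
    P.mild P.invB P.invI0Bd (feedbackInput β v y) w (P.negPowC h₀) t =
      P.negPowC (P.openLoopState β v w h₀ t +
        -((1 - β) / β) • causalConv (P.inputKernel P.invB) y t) := by
  rw [mild, ← hP.negPowC_op ht, ← map_add, causalConv_feedbackInput
    (locallyIntegrableOn_Ici_of_integrableOn_Ioi hP.integrableOn_inputKernel_invB) hv hy ht,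
    openLoopState]
  congr 1
  abel

theorem IsBetaSolution.posPowC_eq (hP : P.Admissible) {v w : ℝ → ℝ} {z₀ : Z} {z : ℝ → Z}
    (h : P.IsBetaSolution β v w z₀ z) (hv : ContinuousOn v (Ici 0)) (hw : ContinuousOn w (Ici 0))
    {t : ℝ} (ht : 0 ≤ t) :
    P.posPowC (z t) = P.openLoopState β v w (P.posPowC z₀) t +
      -((1 - β) / β) • causalConv (P.inputKernel P.invB) (fun s => P.out (z s)) t := by
  have hmild := hP.eq_mild hP.integrableOn_inputKernel_invB hP.integrableOn_inputKernel_invI0Bd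
    (continuousOn_feedbackInput (β := β) hv h.out_continuousOn) hw (z := z) (fun t ht => by
      convert h.equation t ht using 1
      rw [feedbackInput]
      module) ht
  rw [h.initial, ← negPowC_posPowC h.initial_mem,
    hP.mild_feedbackInput hv h.out_continuousOn w _ ht] at hmild
  rw [hmild, hP.posPowC_negPowC]

theorem IsBetaSolution.continuousOn_posPowC (hP : P.Admissible) {v w : ℝ → ℝ} {z₀ : Z}
    {z : ℝ → Z} (h : P.IsBetaSolution β v w z₀ z) (hv : ContinuousOn v (Ici 0))
    (hw : ContinuousOn w (Ici 0)) : ContinuousOn (fun t => P.posPowC (z t)) (Ici 0) :=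
  ((hP.continuousOn_openLoopState hv hw _).add ((continuousOn_causalConv
    (locallyIntegrableOn_Ici_of_integrableOn_Ioi hP.integrableOn_inputKernel_invB)
      h.out_continuousOn).const_smul _)).congr fun _ ht => h.posPowC_eq hP hv hw ht

theorem IsBetaSolution.isVolterraSolution_out (hP : P.Admissible) {v w : ℝ → ℝ} {z₀ : Z}
    {z : ℝ → Z} (h : P.IsBetaSolution β v w z₀ z) (hv : ContinuousOn v (Ici 0))
    (hw : ContinuousOn w (Ici 0)) :
    IsVolterraSolution (hP.outKernel P.invB) (-((1 - β) / β))
      (fun t => hP.outNegPowC (P.openLoopState β v w (P.posPowC z₀) t))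
      (fun t => P.out (z t)) where
  continuousOn := h.out_continuousOn
  equation t ht := by
    rw [hP.out_eq_outNegPowC (h.mem t ht), h.posPowC_eq hP hv hw ht, map_add, map_smul,
      hP.outNegPowC_causalConv_invB h.out_continuousOn ht, smul_eq_mul]

theorem Admissible.exists_isBetaSolution (hP : P.Admissible) (β : ℝ) {v w : ℝ → ℝ}
    (hv : IsCb 0 v) (hw : IsCb 0 w) {z₀ : Z} (hz₀ : z₀ ∈ P.T.ZPos P.sc) :
    ∃ z, P.IsBetaSolution β v w z₀ z := by
  obtain ⟨h₀, rfl⟩ := mem_ZPos_iff.1 hz₀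
  obtain ⟨y, hy⟩ := exists_isVolterraSolution
    (hP.integrableOn_outKernel hP.integrableOn_inputKernel_invB) (-((1 - β) / β))
    (hP.isCb_outNegPowC_openLoopState (β := β) hv hw h₀)
  have hinput := continuousOn_feedbackInput (β := β) hv.continuousOn hy.continuousOn
  set z := P.mild P.invB P.invI0Bd (feedbackInput β v y) w (P.negPowC h₀)
  have hz : ∀ t, 0 ≤ t → z t = P.negPowC (P.openLoopState β v w h₀ t +
      -((1 - β) / β) • causalConv (P.inputKernel P.invB) y t) :=
    fun t ht => hP.mild_feedbackInput hv.continuousOn hy.continuousOn w h₀ ht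
  have hout : ∀ t, 0 ≤ t → P.out (z t) = y t := fun t ht => by
    rw [hz t ht, hP.out_negPowC, map_add, map_smul,
      hP.outNegPowC_causalConv_invB hy.continuousOn ht, smul_eq_mul, ← hy.equation t ht]
  refine ⟨z, continuousOn_mild hP.integrableOn_inputKernel_invB
    hP.integrableOn_inputKernel_invI0Bd hinput hw.continuousOn _,
    fun t ht => hz t ht ▸ P.negPowC_mem _, hy.continuousOn.congr hout,
    P.mild_zero _ _ _ _ _, fun t ht => ?_⟩
  convert hP.hasDerivWithinAt_mild hP.integrableOn_inputKernel_invB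
    hP.integrableOn_inputKernel_invI0Bd hinput hw.continuousOn (P.negPowC h₀) ht using 1
  rw [hout t ht, feedbackInput]
  module

theorem Admissible.exists_norm_posPowC_le (hP : P.Admissible) (β : ℝ) :
    ∃ c : ℝ → ℝ, (∀ T, 0 ≤ c T) ∧
      ∀ (v w : ℝ → ℝ) (z₀ : Z) (z : ℝ → Z), ContinuousOn v (Ici 0) → ContinuousOn w (Ici 0) →
        P.IsBetaSolution β v w z₀ z → ∀ T b : ℝ, 0 ≤ T → 0 ≤ b →
          (∀ t, 0 ≤ t → t ≤ T → |v t| ≤ b ∧ |w t| ≤ b) →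
          ∀ t, 0 ≤ t → t ≤ T → ‖P.posPowC (z t)‖ ≤ c T * (‖P.posPowC z₀‖ + b) := by
  obtain ⟨cV, hcV0, hcV⟩ := exists_isVolterraSolution_bounds
    (hP.integrableOn_outKernel hP.integrableOn_inputKernel_invB) (-((1 - β) / β))
  obtain ⟨c, hc, hopen⟩ := hP.exists_norm_openLoopState_le β
  set Ip := ∫ τ in Ioi (0 : ℝ), ‖P.inputKernel P.invB τ‖
  have hIp : 0 ≤ Ip := integral_nonneg fun _ => norm_nonneg _
  refine ⟨fun T => c + |(1 - β) / β| * (Ip * (cV T * (‖hP.outNegPowC‖ * c))), fun T => ?_,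
    fun v w z₀ z hv hw h T b hT hb hvw t ht htT => ?_⟩
  · have := hcV0 T
    positivity
  have hopen_le : ∀ s, 0 ≤ s → s ≤ T →
      ‖P.openLoopState β v w (P.posPowC z₀) s‖ ≤ c * (‖P.posPowC z₀‖ + b) :=
    fun s hs hsT => hopen v w _ b s hb hs fun r hr hrs => hvw r hr (hrs.trans hsT)
  have hout_le : ∀ s, 0 ≤ s → s ≤ T →
      |P.out (z s)| ≤ cV T * (‖hP.outNegPowC‖ * (c * (‖P.posPowC z₀‖ + b))) :=
    (hcV _ _ (h.isVolterraSolution_out hP hv hw) T hT).1 _ fun s hs hsT =>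
      (hP.outNegPowC.le_opNorm _).trans
        (mul_le_mul_of_nonneg_left (hopen_le s hs hsT) (norm_nonneg _))
  have hfeedback_le : ‖causalConv (P.inputKernel P.invB) (fun s => P.out (z s)) t‖ ≤
      Ip * (cV T * (‖hP.outNegPowC‖ * (c * (‖P.posPowC z₀‖ + b)))) :=
    norm_causalConv_le_integral_Ioi hP.integrableOn_inputKernel_invB ht
      (by have := hcV0 T; positivity) fun s hs hst => hout_le s hs (hst.trans htT)
  calc ‖P.posPowC (z t)‖
      ≤ c * (‖P.posPowC z₀‖ + b) +
          |(1 - β) / β| * (Ip * (cV T * (‖hP.outNegPowC‖ * (c * (‖P.posPowC z₀‖ + b))))) := by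
        rw [h.posPowC_eq hP hv hw ht]
        refine (norm_add_le _ _).trans (add_le_add (hopen_le t ht htT) ?_)
        rw [norm_smul, norm_neg, Real.norm_eq_abs]
        gcongr
    _ = _ := by ring

theorem IsBetaSolution.unique (hP : P.Admissible) {v w : ℝ → ℝ} {z₀ : Z} {z z' : ℝ → Z}
    (h : P.IsBetaSolution β v w z₀ z) (h' : P.IsBetaSolution β v w z₀ z') {t : ℝ} (ht : 0 ≤ t) :
    z t = z' t := by
  obtain ⟨c, -, hc⟩ := hP.exists_norm_posPowC_le β
  have hsub := (h.sub hP h').congr (v' := fun _ => 0) (w' := fun _ => 0) (by simp) (by simp)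
  have hle := hc _ _ _ _ continuousOn_const continuousOn_const hsub t 0 ht le_rfl (by simp) t ht
    le_rfl
  rw [sub_self, hP.posPowC_zero, norm_zero, add_zero, mul_zero, norm_le_zero_iff] at hle
  have hzero := negPowC_posPowC (hsub.mem t ht)
  rw [hle, map_zero] at hzero
  exact sub_eq_zero.1 hzero.symm

theorem Admissible.op_posPowC (hP : P.Admissible) {z : Z} (hz : z ∈ P.T.ZPos P.sc) {t : ℝ}
    (ht : 0 < t) : P.T.op t (P.posPowC z) = P.T.powOp P.sc t z := by
  refine hP.negPowC_injective ?_
  rw [hP.negPowC_op ht.le, negPowC_posPowC hz]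
  exact (C0Semigroup.negPow_powOp hP.expStable hP.analytic hP.sc_nonneg hP.sc_lt_one.le ht z).symm

theorem Admissible.exists_integral_norm_op_posPowC_le (hP : P.Admissible) :
    ∃ c : ℝ, 0 ≤ c ∧ ∀ z ∈ P.T.ZPos P.sc,
      ∫ t in (0 : ℝ)..1, ‖P.T.op t (P.posPowC z)‖ ≤ c * ‖z‖ := by
  obtain ⟨c, hc, hle⟩ := C0Semigroup.exists_integral_norm_powOp_apply_le hP.expStable hP.analytic
    hP.sc_nonneg hP.sc_lt_one
  refine ⟨c, hc, fun z hz => ?_⟩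
  calc ∫ t in (0 : ℝ)..1, ‖P.T.op t (P.posPowC z)‖
      = ∫ t in (0 : ℝ)..1, ‖P.T.powOp P.sc t z‖ := by
        refine intervalIntegral.integral_congr_ae (Eventually.of_forall fun t ht => ?_)
        rw [uIoc_of_le zero_le_one] at ht
        rw [hP.op_posPowC hz ht.1]
    _ ≤ ∫ t in Ioi (0 : ℝ), ‖P.T.powOp P.sc t z‖ :=
        intervalIntegral_norm_le_integral_Ioi (C0Semigroup.integrableOn_powOp_apply hP.expStable
          hP.analytic hP.sc_nonneg hP.sc_lt_one z) zero_le_one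
    _ ≤ c * ‖z‖ := hle z

theorem Admissible.exists_integral_abs_out_le (hP : P.Admissible) (β : ℝ) :
    ∃ c : ℝ, 0 ≤ c ∧
      ∀ (z₀ : Z) (z : ℝ → Z), P.IsBetaSolution β (fun _ => 0) (fun _ => 0) z₀ z →
        ∫ t in (0 : ℝ)..1, |P.out (z t)| ≤ c * ‖z₀‖ := by
  have hB := hP.integrableOn_outKernel hP.integrableOn_inputKernel_invB
  obtain ⟨cV, hcV0, hcV⟩ := exists_isVolterraSolution_bounds hB (-((1 - β) / β))
  obtain ⟨c, hc, hop⟩ := hP.exists_integral_norm_op_posPowC_le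
  have hcV1 := hcV0 1
  refine ⟨cV 1 * (‖hP.outNegPowC‖ * c), by positivity, fun z₀ z h => ?_⟩
  have hvolterra := h.isVolterraSolution_out hP continuousOn_const continuousOn_const
  simp only [openLoopState_zero_zero] at hvolterra
  have hdata := hvolterra.continuousOn_data (locallyIntegrableOn_Ici_of_integrableOn_Ioi hB)
  calc ∫ t in (0 : ℝ)..1, |P.out (z t)|
      ≤ cV 1 * ∫ t in (0 : ℝ)..1, |hP.outNegPowC (P.T.op t (P.posPowC z₀))| :=
        (hcV _ _ hvolterra 1 zero_le_one).2
    _ ≤ cV 1 * ∫ t in (0 : ℝ)..1, ‖hP.outNegPowC‖ * ‖P.T.op t (P.posPowC z₀)‖ := by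
        gcongr
        exact intervalIntegral.integral_mono_on zero_le_one
          (intervalIntegrable_of_continuousOn_Ici hdata.abs zero_le_one)
          ((intervalIntegrable_of_continuousOn_Ici (P.T.continuousOn _).norm
            zero_le_one).const_mul _) fun t _ => hP.outNegPowC.le_opNorm _
    _ ≤ cV 1 * (‖hP.outNegPowC‖ * (c * ‖z₀‖)) := by
        rw [intervalIntegral.integral_const_mul]
        gcongr
        exact hop z₀ h.initial_mem
    _ = _ := by ring

/-- Smoothing in the mean: `‖z₀‖` on the right is the norm of `Z`, not of `Z^{s_c}`. -/
theorem Admissible.exists_integral_norm_posPowC_le (hP : P.Admissible) (β : ℝ) :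
    ∃ c : ℝ, 0 ≤ c ∧
      ∀ (z₀ : Z) (z : ℝ → Z), P.IsBetaSolution β (fun _ => 0) (fun _ => 0) z₀ z →
        ∫ t in (0 : ℝ)..1, ‖P.posPowC (z t)‖ ≤ c * ‖z₀‖ := by
  obtain ⟨c, hc, hop⟩ := hP.exists_integral_norm_op_posPowC_le
  obtain ⟨cOut, hcOut, hout⟩ := hP.exists_integral_abs_out_le β
  have hp := locallyIntegrableOn_Ici_of_integrableOn_Ioi hP.integrableOn_inputKernel_invB
  set Ip := ∫ τ in (0 : ℝ)..1, ‖P.inputKernel P.invB τ‖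
  have hIp : 0 ≤ Ip := intervalIntegral.integral_nonneg zero_le_one fun _ _ => norm_nonneg _
  refine ⟨c + |(1 - β) / β| * (Ip * cOut), by positivity, fun z₀ z h => ?_⟩
  set feedback : ℝ → Z := causalConv (P.inputKernel P.invB) fun s => P.out (z s)
  have hop_int := intervalIntegrable_of_continuousOn_Ici (P.T.continuousOn (P.posPowC z₀)).norm
    zero_le_one
  have hfeedback_int := (intervalIntegrable_of_continuousOn_Ici
    (continuousOn_causalConv hp h.out_continuousOn).norm zero_le_one).const_mul |(1 - β) / β|
  calc ∫ t in (0 : ℝ)..1, ‖P.posPowC (z t)‖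
      ≤ ∫ t in (0 : ℝ)..1, (‖P.T.op t (P.posPowC z₀)‖ + |(1 - β) / β| * ‖feedback t‖) := by
        refine intervalIntegral.integral_mono_on zero_le_one
          (intervalIntegrable_of_continuousOn_Ici
            (h.continuousOn_posPowC hP continuousOn_const continuousOn_const).norm zero_le_one)
          (hop_int.add hfeedback_int) fun t ht => ?_
        rw [h.posPowC_eq hP continuousOn_const continuousOn_const ht.1, openLoopState_zero_zero]
        refine (norm_add_le _ _).trans_eq ?_
        rw [norm_smul, norm_neg, Real.norm_eq_abs]
    _ = (∫ t in (0 : ℝ)..1, ‖P.T.op t (P.posPowC z₀)‖) +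
          |(1 - β) / β| * ∫ t in (0 : ℝ)..1, ‖feedback t‖ := by
        rw [intervalIntegral.integral_add hop_int hfeedback_int,
          intervalIntegral.integral_const_mul]
    _ ≤ c * ‖z₀‖ + |(1 - β) / β| * (Ip * (cOut * ‖z₀‖)) := by
        gcongr
        · exact hop z₀ h.initial_mem
        · exact (integral_norm_causalConv_le hp h.out_continuousOn zero_le_one).trans
            (mul_le_mul_of_nonneg_left (hout z₀ z h) hIp)
    _ = _ := by ring

theorem IsBetaSolution.out_causalConv (hP : P.Admissible) {v w F : ℝ → ℝ} {z z' : ℝ → Z}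
    (h : P.IsBetaSolution β v w 0 z) (hv : ContinuousOn v (Ici 0)) (hw : ContinuousOn w (Ici 0))
    (hF : ContinuousOn F (Ici 0))
    (h' : P.IsBetaSolution β (causalConv F v) (causalConv F w) 0 z') {t : ℝ} (ht : 0 ≤ t) :
    P.out (z' t) = causalConv F (fun s => P.out (z s)) t := by
  have hkB := hP.integrableOn_outKernel hP.integrableOn_inputKernel_invB
  have hB := locallyIntegrableOn_Ici_of_integrableOn_Ioi hkB
  have hD := locallyIntegrableOn_Ici_of_integrableOn_Ioi
    (hP.integrableOn_outKernel hP.integrableOn_inputKernel_invI0Bd)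
  have hF_int := locallyIntegrableOn_Ici_of_continuousOn hF
  have hFv := continuousOn_causalConv hF_int hv
  have hFw := continuousOn_causalConv hF_int hw
  refine (h'.isVolterraSolution_out hP hFv hFw).unique
    ((h.isVolterraSolution_out hP hv hw).causalConv hB hF) hkB (fun s hs => ?_) ht
  rw [hP.posPowC_zero, hP.outNegPowC_openLoopState_zero hFv hFw hs,
    causalConv_congr (fun r hr => hP.outNegPowC_openLoopState_zero hv hw hr) hs,
    causalConv_add hF_int ((continuousOn_causalConv hB hv).const_mul _)
      (continuousOn_causalConv hD hw) hs, causalConv_const_mul,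
    causalConv_left_comm hB hF hv hs, causalConv_left_comm hD hF hw hs, smul_eq_mul]

end Plant

/-! ### Stability of the regularized system -/

theorem le_half_pow_floor_of_half_contraction {f : ℝ → ℝ} {L c m : ℝ} (hL : 0 < L) (hc : 0 ≤ c)
    (hstep : ∀ t, 0 ≤ t → f (t + L) ≤ 1 / 2 * f t + c) (hm : ∀ t, 0 ≤ t → t ≤ L → f t ≤ m)
    {t : ℝ} (ht : 0 ≤ t) : f t ≤ (1 / 2) ^ ⌊t / L⌋₊ * m + 2 * c := by
  induction hn : ⌊t / L⌋₊ generalizing t with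
  | zero =>
    have := hm t ht ((div_lt_one hL).1 (Nat.floor_eq_zero.1 hn)).le
    linarith
  | succ n ih =>
    have hLt : L ≤ t := by
      rw [← one_le_div hL, ← Nat.one_le_floor_iff, hn]
      exact Nat.le_add_left 1 n
    have hprev := ih (sub_nonneg.2 hLt) (by
      rw [sub_div, div_self hL.ne', Nat.floor_sub_one, hn, Nat.add_sub_cancel])
    have hcur := hstep (t - L) (sub_nonneg.2 hLt)
    rw [sub_add_cancel] at hcur
    rw [pow_succ]
    linarith

theorem tendsto_half_pow_floor_div {L : ℝ} (hL : 0 < L) :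
    Tendsto (fun t : ℝ => (1 / 2 : ℝ) ^ ⌊t / L⌋₊) atTop (𝓝 0) :=
  (tendsto_pow_atTop_nhds_zero_of_lt_one (by norm_num) (by norm_num)).comp
    (tendsto_nat_floor_atTop.comp (tendsto_id.atTop_div_const hL))

namespace Plant

variable {Z : Type*} [NormedAddCommGroup Z] [NormedSpace ℝ Z] [CompleteSpace Z] {P : Plant Z}
  {β : ℝ} {S : C0Semigroup Z}

theorem Admissible.posPowC_add (hP : P.Admissible) {z z' : Z} (hz : z ∈ P.T.ZPos P.sc)
    (hz' : z' ∈ P.T.ZPos P.sc) : P.posPowC (z + z') = P.posPowC z + P.posPowC z' := by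
  obtain ⟨h, rfl⟩ := mem_ZPos_iff.1 hz
  obtain ⟨h', rfl⟩ := mem_ZPos_iff.1 hz'
  rw [← map_add, hP.posPowC_negPowC, hP.posPowC_negPowC, hP.posPowC_negPowC]

theorem IsBetaSolution.integral_eq_negPowC (hP : P.Admissible) {z₀ : Z} {z : ℝ → Z}
    (h : P.IsBetaSolution β (fun _ => 0) (fun _ => 0) z₀ z) {t : ℝ} (ht : 0 ≤ t) :
    ∫ s in (0 : ℝ)..t, z s = P.negPowC (∫ s in (0 : ℝ)..t, P.posPowC (z s)) := by
  rw [← P.negPowC.intervalIntegral_comp_comm (intervalIntegrable_of_continuousOn_Ici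
    (h.continuousOn_posPowC hP continuousOn_const continuousOn_const) ht)]
  refine intervalIntegral.integral_congr fun s hs => ?_
  rw [uIcc_of_le ht] at hs
  exact (negPowC_posPowC (h.mem s hs.1)).symm

theorem IsBetaSolution.out_integral (hP : P.Admissible) {z₀ : Z} {z : ℝ → Z}
    (h : P.IsBetaSolution β (fun _ => 0) (fun _ => 0) z₀ z) {t : ℝ} (ht : 0 ≤ t) :
    P.out (∫ s in (0 : ℝ)..t, z s) = ∫ s in (0 : ℝ)..t, P.out (z s) := by
  rw [h.integral_eq_negPowC hP ht, hP.out_negPowC,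
    ← hP.outNegPowC.intervalIntegral_comp_comm (intervalIntegrable_of_continuousOn_Ici
      (h.continuousOn_posPowC hP continuousOn_const continuousOn_const) ht)]
  refine intervalIntegral.integral_congr fun s hs => ?_
  rw [uIcc_of_le ht] at hs
  exact (hP.out_eq_outNegPowC (h.mem s hs.1)).symm

theorem IsBetaSolution.betaGraph_integral (hP : P.Admissible) {z₀ : Z} {z : ℝ → Z}
    (h : P.IsBetaSolution β (fun _ => 0) (fun _ => 0) z₀ z) {t : ℝ} (ht : 0 ≤ t) :
    P.BetaGraph β (∫ s in (0 : ℝ)..t, z s) (z t - z₀) := by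
  refine ⟨h.integral_eq_negPowC hP ht ▸ P.negPowC_mem _, ?_⟩
  have hfeedback : ContinuousOn (fun s => ((1 - β) / β * P.out (z s)) • P.invB) (Ici 0) :=
    (h.out_continuousOn.const_mul _).smul continuousOn_const
  have hint := integral_eq_sub_of_hasDerivWithinAt_Ici (f := fun s => P.T.inv (z s))
    (fun s hs => by simpa using h.equation s hs) (h.continuousOn.fun_sub hfeedback) ht
  rw [map_sub, ← h.initial, ← hint, intervalIntegral.integral_sub
    (intervalIntegrable_of_continuousOn_Ici h.continuousOn ht)
    (intervalIntegrable_of_continuousOn_Ici hfeedback ht), intervalIntegral.integral_smul_const,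
    intervalIntegral.integral_const_mul, h.out_integral hP ht]

theorem IsBetaSolution.eq_op (hP : P.Admissible) (hS : P.IsBetaSemigroup β S) (hSs : S.ExpStable)
    {z₀ : Z} {z : ℝ → Z} (h : P.IsBetaSolution β (fun _ => 0) (fun _ => 0) z₀ z) {t : ℝ}
    (ht : 0 ≤ t) : z t = S.op t z₀ :=
  hSs.eq_op_of_gen_integral h.continuousOn
    (fun _ hs => (hS _ _).2 (h.betaGraph_integral hP hs)) ht

theorem Admissible.isBetaSolution_op (hP : P.Admissible) (hS : P.IsBetaSemigroup β S)
    (hSs : S.ExpStable) {z₀ : Z} (hz₀ : z₀ ∈ P.T.ZPos P.sc) :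
    P.IsBetaSolution β (fun _ => 0) (fun _ => 0) z₀ (fun t => S.op t z₀) := by
  obtain ⟨z, hz⟩ := hP.exists_isBetaSolution β (isCb_const 0 0) (isCb_const 0 0) hz₀
  have horbit : ∀ t, 0 ≤ t → S.op t z₀ = z t := fun t ht => (hz.eq_op hP hS hSs ht).symm
  refine ⟨S.continuousOn z₀, fun t ht => horbit t ht ▸ hz.mem t ht,
    hz.out_continuousOn.congr fun t ht => by simp only [horbit t ht], S.op_zero_apply z₀,
    fun t ht => ?_⟩
  have hderiv := (hz.equation t ht).congr (f₁ := fun t => P.T.inv (S.op t z₀))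
    (fun s hs => by simp only [horbit s hs]) (by simp only [horbit t ht])
  simpa only [horbit t ht] using hderiv

theorem Admissible.exists_norm_posPowC_le_of_le_one (hP : P.Admissible) (β : ℝ) :
    ∃ c : ℝ, 0 ≤ c ∧ ∀ (z₀ : Z) (z : ℝ → Z), P.IsBetaSolution β (fun _ => 0) (fun _ => 0) z₀ z →
      ∀ t, 0 ≤ t → t ≤ 1 → ‖P.posPowC (z t)‖ ≤ c * ‖P.posPowC z₀‖ := by
  obtain ⟨c, hc0, hc⟩ := hP.exists_norm_posPowC_le β
  refine ⟨c 1, hc0 1, fun z₀ z h t ht0 ht1 => ?_⟩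
  simpa using hc _ _ z₀ z continuousOn_const continuousOn_const h 1 0 zero_le_one le_rfl (by simp)
    t ht0 ht1

theorem Admissible.exists_norm_posPowC_one_le (hP : P.Admissible) (β : ℝ) :
    ∃ c : ℝ, 0 ≤ c ∧ ∀ (z₀ : Z) (z : ℝ → Z), P.IsBetaSolution β (fun _ => 0) (fun _ => 0) z₀ z →
      ‖P.posPowC (z 1)‖ ≤ c * ‖z₀‖ := by
  obtain ⟨cLoc, hcLoc, hloc⟩ := hP.exists_norm_posPowC_le_of_le_one β
  obtain ⟨cInt, hcInt, hint⟩ := hP.exists_integral_norm_posPowC_le β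
  refine ⟨cLoc * cInt, by positivity, fun z₀ z h => ?_⟩
  have hrestart : ∀ t ∈ Icc (0 : ℝ) 1, ‖P.posPowC (z 1)‖ ≤ cLoc * ‖P.posPowC (z t)‖ :=
    fun t ht => by
      simpa using hloc _ _ (h.shift ht.1) (1 - t) (sub_nonneg.2 ht.2) (sub_le_self 1 ht.1)
  have hcont := h.continuousOn_posPowC hP continuousOn_const continuousOn_const
  calc ‖P.posPowC (z 1)‖ = ∫ _ in (0 : ℝ)..1, ‖P.posPowC (z 1)‖ := by simp
    _ ≤ ∫ t in (0 : ℝ)..1, cLoc * ‖P.posPowC (z t)‖ :=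
        intervalIntegral.integral_mono_on zero_le_one intervalIntegrable_const
          (intervalIntegrable_of_continuousOn_Ici (hcont.norm.const_mul cLoc) zero_le_one) hrestart
    _ = cLoc * ∫ t in (0 : ℝ)..1, ‖P.posPowC (z t)‖ := intervalIntegral.integral_const_mul _ _
    _ ≤ cLoc * (cInt * ‖z₀‖) := mul_le_mul_of_nonneg_left (hint z₀ z h) hcLoc
    _ = cLoc * cInt * ‖z₀‖ := (mul_assoc _ _ _).symm

theorem Admissible.exists_norm_posPowC_op_le (hP : P.Admissible) (hS : P.IsBetaSemigroup β S)
    (hSs : S.ExpStable) : ∃ c ω : ℝ, 0 ≤ c ∧ 0 < ω ∧ ∀ z₀ ∈ P.T.ZPos P.sc, ∀ t, 0 ≤ t →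
      ‖P.posPowC (S.op t z₀)‖ ≤ c * Real.exp (-ω * t) * ‖P.posPowC z₀‖ := by
  obtain ⟨cLoc, hcLoc, hloc⟩ := hP.exists_norm_posPowC_le_of_le_one β
  obtain ⟨cOne, hcOne, hone⟩ := hP.exists_norm_posPowC_one_le β
  obtain ⟨M, ω, -, hω, hM⟩ := hSs.exists_bound
  suffices hlate : ∀ z₀ ∈ P.T.ZPos P.sc, ∀ t, 0 ≤ t → ‖P.posPowC (S.op t z₀)‖ ≤
      max cLoc (cOne * (M * ‖P.negPowC‖)) * Real.exp (-ω * (t - 1)) * ‖P.posPowC z₀‖ by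
    refine ⟨max cLoc (cOne * (M * ‖P.negPowC‖)) * Real.exp ω, ω, by positivity, hω,
      fun z₀ hz₀ t ht => (hlate z₀ hz₀ t ht).trans_eq ?_⟩
    rw [mul_assoc _ (Real.exp ω), ← Real.exp_add, mul_sub, mul_one, sub_neg_eq_add, add_comm]
  intro z₀ hz₀ t ht
  have h := hP.isBetaSolution_op hS hSs hz₀
  rcases le_total t 1 with ht1 | ht1
  · have hexp : 1 ≤ Real.exp (-ω * (t - 1)) :=
      Real.one_le_exp (mul_nonneg_of_nonpos_of_nonpos (neg_nonpos.2 hω.le) (sub_nonpos.2 ht1))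
    refine (hloc z₀ _ h t ht ht1).trans (mul_le_mul_of_nonneg_right ?_ (norm_nonneg _))
    exact (le_max_left _ _).trans (le_mul_of_one_le_right (by positivity) hexp)
  · have hshift := hone _ _ (h.shift (sub_nonneg.2 ht1))
    rw [sub_add_cancel] at hshift
    have hz₀_le : ‖z₀‖ ≤ ‖P.negPowC‖ * ‖P.posPowC z₀‖ := by
      simpa only [negPowC_posPowC hz₀] using P.negPowC.le_opNorm (P.posPowC z₀)
    calc ‖P.posPowC (S.op t z₀)‖ ≤ cOne * ‖S.op (t - 1) z₀‖ := hshift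
      _ ≤ cOne * (M * Real.exp (-ω * (t - 1)) * (‖P.negPowC‖ * ‖P.posPowC z₀‖)) := by
          gcongr
          exact (S.op _).le_of_opNorm_le_of_le (hM _ (sub_nonneg.2 ht1)) hz₀_le
      _ = cOne * (M * ‖P.negPowC‖) * Real.exp (-ω * (t - 1)) * ‖P.posPowC z₀‖ := by ring
      _ ≤ _ := by
          gcongr
          exact le_max_right _ _

theorem Admissible.exists_period (hP : P.Admissible) (hS : P.IsBetaSemigroup β S)
    (hSs : S.ExpStable) : ∃ L : ℝ, 0 < L ∧ ∀ z₀ ∈ P.T.ZPos P.sc,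
      ‖P.posPowC (S.op L z₀)‖ ≤ 1 / 2 * ‖P.posPowC z₀‖ := by
  obtain ⟨c, ω, -, hω, hc⟩ := hP.exists_norm_posPowC_op_le hS hSs
  obtain ⟨L, hcL, hL⟩ := (((tendsto_const_mul_exp_neg c hω).eventually_lt_const
    (by norm_num : (0 : ℝ) < 1 / 2)).and (eventually_gt_atTop 0)).exists
  exact ⟨L, hL, fun z₀ hz₀ => (hc z₀ hz₀ L hL.le).trans
    (mul_le_mul_of_nonneg_right hcL.le (norm_nonneg _))⟩

theorem Admissible.exists_inputToState_le (hP : P.Admissible) (hS : P.IsBetaSemigroup β S)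
    (hSs : S.ExpStable) : ∃ L c : ℝ, 0 < L ∧ 0 ≤ c ∧
      ∀ (v w : ℝ → ℝ) (z₀ : Z) (z : ℝ → Z) (b : ℝ), ContinuousOn v (Ici 0) →
        ContinuousOn w (Ici 0) → P.IsBetaSolution β v w z₀ z → 0 ≤ b →
        (∀ t, 0 ≤ t → |v t| ≤ b ∧ |w t| ≤ b) → ∀ t, 0 ≤ t →
          ‖P.posPowC (z t)‖ ≤ c * ((1 / 2) ^ ⌊t / L⌋₊ * (‖P.posPowC z₀‖ + b) + 2 * b) := by
  obtain ⟨c, hc0, hc⟩ := hP.exists_norm_posPowC_le β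
  obtain ⟨L, hL, hhalf⟩ := hP.exists_period hS hSs
  refine ⟨L, c L, hL, hc0 L, fun v w z₀ z b hv hw h hb hvw t ht => ?_⟩
  have hstep : ∀ t, 0 ≤ t → ‖P.posPowC (z (t + L))‖ ≤ 1 / 2 * ‖P.posPowC (z t)‖ + c L * b := by
    intro t ht
    have hfree := hP.isBetaSolution_op hS hSs (h.mem t ht)
    have hforced := (h.shift ht).sub hP hfree
    have hmaps : MapsTo (fun s => t + s) (Ici 0) (Ici 0) := fun s hs => add_nonneg ht hs
    have hshift : ContinuousOn (fun s => t + s) (Ici 0) := by fun_prop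
    have hforced_le : ‖P.posPowC (z (t + L) - S.op L (z t))‖ ≤ c L * b := by
      simpa [hP.posPowC_zero] using hc _ _ _ _ (hv.comp hshift hmaps) (hw.comp hshift hmaps)
        (hforced.congr (fun s _ => (sub_zero (v (t + s))).symm)
          fun s _ => (sub_zero (w (t + s))).symm) L b hL.le hb
        (fun s hs _ => hvw _ (hmaps hs)) L hL.le le_rfl
    calc ‖P.posPowC (z (t + L))‖
        = ‖P.posPowC (S.op L (z t)) + P.posPowC (z (t + L) - S.op L (z t))‖ := by
          rw [← hP.posPowC_add (hfree.mem L hL.le) (hforced.mem L hL.le), add_sub_cancel]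
      _ ≤ 1 / 2 * ‖P.posPowC (z t)‖ + c L * b :=
          (norm_add_le _ _).trans (add_le_add (hhalf _ (h.mem t ht)) hforced_le)
  have hperiod : ∀ t, 0 ≤ t → t ≤ L → ‖P.posPowC (z t)‖ ≤ c L * (‖P.posPowC z₀‖ + b) :=
    hc v w z₀ z hv hw h L b hL.le hb fun s hs _ => hvw s hs
  refine (le_half_pow_floor_of_half_contraction hL (mul_nonneg (hc0 L) hb) hstep hperiod
    ht).trans_eq ?_
  ring

theorem IsBetaSolution.isCb_out (hP : P.Admissible) (hS : P.IsBetaSemigroup β S)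
    (hSs : S.ExpStable) {v w : ℝ → ℝ} {z₀ : Z} {z : ℝ → Z} (h : P.IsBetaSolution β v w z₀ z)
    (hv : IsCb 0 v) (hw : IsCb 0 w) : IsCb 0 fun t => P.out (z t) := by
  obtain ⟨L, c, -, hc0, hc⟩ := hP.exists_inputToState_le hS hSs
  obtain ⟨Mv, hMv0, hMv⟩ := hv.exists_bound
  obtain ⟨Mw, hMw0, hMw⟩ := hw.exists_bound
  have hb : ∀ t, 0 ≤ t → |v t| ≤ Mv + Mw ∧ |w t| ≤ Mv + Mw := fun t ht =>
    ⟨(hMv t ht).trans (le_add_of_nonneg_right hMw0), (hMw t ht).trans (le_add_of_nonneg_left hMv0)⟩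
  refine isCb_zero_of_bound (M := ‖hP.outNegPowC‖ * (c * (1 * (‖P.posPowC z₀‖ + (Mv + Mw)) +
    2 * (Mv + Mw)))) h.out_continuousOn fun t ht => ?_
  refine (hP.abs_out_le (h.mem t ht)).trans (mul_le_mul_of_nonneg_left ?_ (norm_nonneg _))
  refine (hc v w z₀ z _ hv.continuousOn hw.continuousOn h (by positivity) hb t ht).trans ?_
  gcongr
  exact pow_le_one₀ (by norm_num) (by norm_num)

theorem IsBetaSolution.limsupAbsLE_out (hP : P.Admissible) (hS : P.IsBetaSemigroup β S)
    (hSs : S.ExpStable) {v w : ℝ → ℝ} {z₀ : Z} {z : ℝ → Z} (h : P.IsBetaSolution β v w z₀ z)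
    (hvc : ContinuousOn v (Ici 0)) (hwc : ContinuousOn w (Ici 0)) (hv : LimsupAbsLE v 0)
    (hw : LimsupAbsLE w 0) : LimsupAbsLE (fun t => P.out (z t)) 0 := by
  obtain ⟨L, c, hL, hc0, hc⟩ := hP.exists_inputToState_le hS hSs
  intro ε hε
  set δ := ε / ((‖hP.outNegPowC‖ + 1) * (c + 1) * 3) with hδ
  have hδ0 : 0 < δ := by positivity
  obtain ⟨a, ha⟩ := eventually_atTop.1
    (((hv δ hδ0).and (hw δ hδ0)).and (eventually_ge_atTop (0 : ℝ)))
  have ha0 : 0 ≤ a := (ha a le_rfl).2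
  have hmaps : MapsTo (fun s => a + s) (Ici 0) (Ici 0) := fun s hs => add_nonneg ha0 hs
  have hshift : ContinuousOn (fun s => a + s) (Ici 0) := by fun_prop
  have hstate := hc _ _ _ _ δ (hvc.comp hshift hmaps) (hwc.comp hshift hmaps) (h.shift ha0) hδ0.le
    fun t ht => by simpa using (ha (a + t) (le_add_of_nonneg_right ht)).1
  have hdecay : ∀ᶠ s in atTop, (1 / 2 : ℝ) ^ ⌊s / L⌋₊ * (‖P.posPowC (z a)‖ + δ) ≤ δ :=
    (by simpa using (tendsto_half_pow_floor_div hL).mul_const (‖P.posPowC (z a)‖ + δ) :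
      Tendsto _ atTop (𝓝 (0 : ℝ))).eventually_le_const hδ0
  filter_upwards [(tendsto_atTop_add_const_right atTop (-a) tendsto_id).eventually hdecay,
    eventually_ge_atTop a] with t ht hta
  have hout := hP.abs_out_le (h.mem t (ha0.trans hta))
  have hzt := hstate (t - a) (sub_nonneg.2 hta)
  rw [add_sub_cancel] at hzt
  rw [id, ← sub_eq_add_neg] at ht
  calc |P.out (z t)| ≤ ‖hP.outNegPowC‖ * (c * (δ + 2 * δ)) :=
        hout.trans (mul_le_mul_of_nonneg_left (hzt.trans (by gcongr)) (norm_nonneg _))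
    _ ≤ (‖hP.outNegPowC‖ + 1) * ((c + 1) * (δ + 2 * δ)) := by gcongr <;> linarith
    _ = 0 + ε := by
      rw [hδ]
      field_simp
      ring

/-! ### The kernels `K` and `K_d` -/

theorem Admissible.integrableOn_out_op (hP : P.Admissible) (hS : P.IsBetaSemigroup β S)
    (hSs : S.ExpStable) {z₀ : Z} (hz₀ : z₀ ∈ P.T.ZPos P.sc) :
    IntegrableOn (fun t => P.out (S.op t z₀)) (Ioi 0) := by
  obtain ⟨c, ω, -, hω, hc⟩ := hP.exists_norm_posPowC_op_le hS hSs
  have h := hP.isBetaSolution_op hS hSs hz₀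
  refine Integrable.mono' ((((exp_neg_integrableOn_Ioi 0 hω).const_mul c).mul_const
    ‖P.posPowC z₀‖).const_mul ‖hP.outNegPowC‖)
    ((h.out_continuousOn.mono Ioi_subset_Ici_self).aestronglyMeasurable measurableSet_Ioi) ?_
  refine (ae_restrict_iff' measurableSet_Ioi).2 (Eventually.of_forall fun t ht => ?_)
  exact (hP.abs_out_le (h.mem t (le_of_lt ht))).trans
    (mul_le_mul_of_nonneg_left (hc z₀ hz₀ t (le_of_lt ht)) (norm_nonneg _))

theorem Admissible.isCb_out_op (hP : P.Admissible) (hS : P.IsBetaSemigroup β S)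
    (hSs : S.ExpStable) {z₀ : Z} (hz₀ : z₀ ∈ P.T.ZPos P.sc) :
    IsCb 0 fun t => P.out (S.op t z₀) :=
  (hP.isBetaSolution_op hS hSs hz₀).isCb_out hP hS hSs (isCb_const 0 0) (isCb_const 0 0)

theorem Admissible.limsupAbsLE_out_op (hP : P.Admissible) (hS : P.IsBetaSemigroup β S)
    (hSs : S.ExpStable) {z₀ : Z} (hz₀ : z₀ ∈ P.T.ZPos P.sc) :
    LimsupAbsLE (fun t => P.out (S.op t z₀)) 0 :=
  (hP.isBetaSolution_op hS hSs hz₀).limsupAbsLE_out hP hS hSs continuousOn_const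
    continuousOn_const (limsupAbsLE_zero_of_tendsto tendsto_const_nhds)
    (limsupAbsLE_zero_of_tendsto tendsto_const_nhds)

theorem Admissible.K_eq (hP : P.Admissible) (hβ : 0 < β) (hS : P.IsBetaSemigroup β S)
    (hSs : S.ExpStable) {t : ℝ} (ht : 0 ≤ t) : P.K β S t = -1 * P.out (S.op t P.invB) := by
  have hinv : P.betaInv β P.invB = β • P.invB := by
    rw [betaInv, hP.out_invB]
    module
  rw [K, hinv, map_smul, hP.out_smul ((hP.isBetaSolution_op hS hSs hP.invB_mem).mem t ht)]
  field_simp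

theorem Admissible.Kd_eq (hP : P.Admissible) (t : ℝ) :
    P.Kd β S t = -1 * P.out (S.op t P.invI0Bd) := by
  rw [Kd, betaInv, hP.out_invI0Bd, mul_zero, zero_smul, add_zero, neg_one_mul]

theorem Admissible.integrableOn_K (hP : P.Admissible) (hβ : 0 < β) (hS : P.IsBetaSemigroup β S)
    (hSs : S.ExpStable) : IntegrableOn (P.K β S) (Ioi 0) :=
  IntegrableOn.congr_fun ((hP.integrableOn_out_op hS hSs hP.invB_mem).const_mul (-1))
    (fun _ ht => (hP.K_eq hβ hS hSs (le_of_lt ht)).symm) measurableSet_Ioi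

theorem Admissible.integrableOn_Kd (hP : P.Admissible) (hS : P.IsBetaSemigroup β S)
    (hSs : S.ExpStable) : IntegrableOn (P.Kd β S) (Ioi 0) :=
  IntegrableOn.congr_fun ((hP.integrableOn_out_op hS hSs hP.invI0Bd_mem).const_mul (-1))
    (fun t _ => (hP.Kd_eq t).symm) measurableSet_Ioi

theorem Admissible.isCb_K (hP : P.Admissible) (hβ : 0 < β) (hS : P.IsBetaSemigroup β S)
    (hSs : S.ExpStable) : IsCb 0 (P.K β S) :=
  ((hP.isCb_out_op hS hSs hP.invB_mem).const_mul (-1)).congr fun _ ht => hP.K_eq hβ hS hSs ht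

theorem Admissible.isCb_Kd (hP : P.Admissible) (hS : P.IsBetaSemigroup β S)
    (hSs : S.ExpStable) : IsCb 0 (P.Kd β S) :=
  ((hP.isCb_out_op hS hSs hP.invI0Bd_mem).const_mul (-1)).congr fun t _ => hP.Kd_eq t

theorem Admissible.limsupAbsLE_K (hP : P.Admissible) (hβ : 0 < β) (hS : P.IsBetaSemigroup β S)
    (hSs : S.ExpStable) : LimsupAbsLE (P.K β S) 0 :=
  ((hP.limsupAbsLE_out_op hS hSs hP.invB_mem).const_mul_zero (-1)).congr
    fun _ ht => hP.K_eq hβ hS hSs ht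

theorem Admissible.limsupAbsLE_Kd (hP : P.Admissible) (hS : P.IsBetaSemigroup β S)
    (hSs : S.ExpStable) : LimsupAbsLE (P.Kd β S) 0 :=
  ((hP.limsupAbsLE_out_op hS hSs hP.invI0Bd_mem).const_mul_zero (-1)).congr
    fun t _ => hP.Kd_eq t

theorem Admissible.K_zero (hP : P.Admissible) (hβ : 0 < β) (hS : P.IsBetaSemigroup β S)
    (hSs : S.ExpStable) : P.K β S 0 = 1 := by
  rw [hP.K_eq hβ hS hSs le_rfl, S.op_zero_apply, hP.out_invB]
  norm_num

theorem Admissible.D_pos (hP : P.Admissible) (hβ : 0 < β) (hS : P.IsBetaSemigroup β S)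
    (hSs : S.ExpStable) : 0 < P.D β S := by
  have hlarge : ∀ᶠ t in 𝓝[≥] (0 : ℝ), 1 / 2 < |P.K β S t| := by
    have hcont := ((hP.isCb_K hβ hS hSs).continuousOn 0 self_mem_Ici).abs
    rw [ContinuousWithinAt, hP.K_zero hβ hS hSs, abs_one] at hcont
    exact hcont.eventually_const_lt (by norm_num)
  obtain ⟨u, hu : (0 : ℝ) < u, hsub⟩ := mem_nhdsGE_iff_exists_Ico_subset.1 hlarge
  have hint : IntegrableOn (fun t => |P.K β S t|) (Ioi 0) := (hP.integrableOn_K hβ hS hSs).norm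
  calc (0 : ℝ) < ∫ _ in Ioo (0 : ℝ) u, (1 / 2 : ℝ) := by simp [hu, hu.le]
    _ ≤ ∫ t in Ioo (0 : ℝ) u, |P.K β S t| :=
        setIntegral_mono_on (integrableOn_const (by simp)) (hint.mono_set Ioo_subset_Ioi_self)
          measurableSet_Ioo fun t ht => le_of_lt (hsub ⟨ht.1.le, ht.2⟩)
    _ ≤ ∫ t in Ioi (0 : ℝ), |P.K β S t| :=
        setIntegral_mono_set hint (Eventually.of_forall fun _ => abs_nonneg _)
          Ioo_subset_Ioi_self.eventuallyLE

end Plant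

theorem causalConv_const_of_hasDerivWithinAt {φ φ' : ℝ → ℝ}
    (hφ : ∀ t, 0 ≤ t → HasDerivWithinAt φ (φ' t) (Ici 0) t) (hφ' : ContinuousOn φ' (Ici 0))
    (a : ℝ) {t : ℝ} (ht : 0 ≤ t) : causalConv φ' (fun _ => a) t = a * φ t - φ 0 * a := by
  simp only [causalConv, smul_eq_mul]
  rw [intervalIntegral.integral_const_mul, integral_eq_sub_of_hasDerivWithinAt_Ici hφ hφ' ht]
  ring

open scoped NNReal BoundedContinuousFunction

namespace Plant

variable {Z : Type*} [NormedAddCommGroup Z] [NormedSpace ℝ Z] [CompleteSpace Z] {P : Plant Z}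
  {β : ℝ} {S : C0Semigroup Z}

theorem Admissible.isBetaSolution_neg_invB (hP : P.Admissible) (hβ : 0 < β) :
    P.IsBetaSolution β (fun _ => 1) (fun _ => 0) (-P.invB) (fun _ => -P.invB) := by
  refine ⟨continuousOn_const, fun _ _ => Submodule.neg_mem _ hP.invB_mem, continuousOn_const, rfl,
    fun t _ => ?_⟩
  convert hasDerivWithinAt_const t (Ici 0) (P.T.inv (-P.invB)) using 1
  have hcoeff : -1 - (1 - β) / β + 1 / β = 0 := by
    field_simp
    ring
  rw [hP.out_neg hP.invB_mem, hP.out_invB]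
  linear_combination (norm := module) hcoeff • P.invB

theorem Admissible.isBetaSolution_neg_invI0Bd (hP : P.Admissible) (β : ℝ) :
    P.IsBetaSolution β (fun _ => 0) (fun _ => 1) (-P.invI0Bd) (fun _ => -P.invI0Bd) := by
  refine ⟨continuousOn_const, fun _ _ => Submodule.neg_mem _ hP.invI0Bd_mem, continuousOn_const,
    rfl, fun t _ => ?_⟩
  convert hasDerivWithinAt_const t (Ici 0) (P.T.inv (-P.invI0Bd)) using 1
  simp [hP.out_neg hP.invI0Bd_mem, hP.out_invI0Bd]

/-- Duhamel's formula: `x` is the equilibrium for the constant input `(a, b)`, so `x - e^{A_β t} x`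
is the response to that input switched on at time `0`. -/
theorem IsBetaSolution.out_eq_of_equilibrium (hP : P.Admissible) (hS : P.IsBetaSemigroup β S)
    (hSs : S.ExpStable) {a b : ℝ} {x : Z} {z : ℝ → Z} {φ φ' : ℝ → ℝ}
    (hx : P.IsBetaSolution β (fun _ => a) (fun _ => b) x fun _ => x)
    (h : P.IsBetaSolution β (fun t => a * φ t) (fun t => b * φ t) 0 z)
    (hφ : ∀ t, 0 ≤ t → HasDerivWithinAt φ (φ' t) (Ici 0) t) (hφ' : ContinuousOn φ' (Ici 0))
    {t : ℝ} (ht : 0 ≤ t) :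
    P.out (z t) = P.out x * φ t -
      (φ 0 * P.out (S.op t x) + causalConv (fun s => P.out (S.op s x)) φ' t) := by
  have hop := hP.isBetaSolution_op hS hSs hx.initial_mem
  have hstep := hx.sub hP hop
  simp only [sub_zero, sub_self] at hstep
  have hstep_out : ∀ s, 0 ≤ s →
      P.out (x - S.op s x) = P.out x + -1 * P.out (S.op s x) := fun s hs => by
    rw [sub_eq_add_neg, hP.out_add hx.initial_mem (Submodule.neg_mem _ (hop.mem s hs)),
      hP.out_neg (hop.mem s hs), neg_one_mul]
  have hscaled := hstep.smul hP (φ 0)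
  have hrest := h.sub hP hscaled
  rw [smul_zero, sub_zero] at hrest
  have hrest_out := hstep.out_causalConv hP continuousOn_const continuousOn_const hφ'
    (hrest.congr (fun s hs => causalConv_const_of_hasDerivWithinAt hφ hφ' a hs)
      fun s hs => causalConv_const_of_hasDerivWithinAt hφ hφ' b hs) ht
  have hsum := hP.out_add (hrest.mem t ht) (hscaled.mem t ht)
  rw [sub_add_cancel, hrest_out, hP.out_smul (hstep.mem t ht), causalConv_congr hstep_out ht,
    causalConv_add (locallyIntegrableOn_Ici_of_continuousOn hφ') continuousOn_const
      (hop.out_continuousOn.const_mul _) ht, causalConv_const_mul,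
    causalConv_const_of_hasDerivWithinAt hφ hφ' _ ht, causalConv_comm, hstep_out t ht] at hsum
  rw [hsum, smul_eq_mul]
  ring

theorem IsBetaSolution.sub_out_eq (hP : P.Admissible) (hβ : 0 < β) (hS : P.IsBetaSemigroup β S)
    (hSs : S.ExpStable) {z : ℝ → Z} {φ φ' : ℝ → ℝ} (h : P.IsBetaSolution β φ (fun _ => 0) 0 z)
    (hφ : ∀ t, 0 ≤ t → HasDerivWithinAt φ (φ' t) (Ici 0) t) (hφ' : ContinuousOn φ' (Ici 0))
    {t : ℝ} (ht : 0 ≤ t) :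
    φ t - P.out (z t) = φ 0 * P.K β S t + causalConv (P.K β S) φ' t := by
  have hK : ∀ s, 0 ≤ s → P.out (S.op s (-P.invB)) = P.K β S s := fun s hs => by
    rw [map_neg, hP.out_neg ((hP.isBetaSolution_op hS hSs hP.invB_mem).mem s hs),
      hP.K_eq hβ hS hSs hs, neg_one_mul]
  have hout := IsBetaSolution.out_eq_of_equilibrium hP hS hSs (hP.isBetaSolution_neg_invB hβ)
    (h.congr (by simp) (by simp)) hφ hφ' ht
  rw [hK t ht, causalConv_congr_left (fun s hs => hK s hs.le) ht,
    hP.out_neg hP.invB_mem, hP.out_invB] at hout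
  linarith

theorem IsBetaSolution.out_eq_Kd (hP : P.Admissible) (hS : P.IsBetaSemigroup β S)
    (hSs : S.ExpStable) {z : ℝ → Z} {φ φ' : ℝ → ℝ} (h : P.IsBetaSolution β (fun _ => 0) φ 0 z)
    (hφ : ∀ t, 0 ≤ t → HasDerivWithinAt φ (φ' t) (Ici 0) t) (hφ' : ContinuousOn φ' (Ici 0))
    {t : ℝ} (ht : 0 ≤ t) :
    P.out (z t) = -(φ 0 * P.Kd β S t + causalConv (P.Kd β S) φ' t) := by
  have hKd : ∀ s, 0 ≤ s → P.out (S.op s (-P.invI0Bd)) = P.Kd β S s := fun s hs => by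
    rw [map_neg, hP.out_neg ((hP.isBetaSolution_op hS hSs hP.invI0Bd_mem).mem s hs), hP.Kd_eq,
      neg_one_mul]
  have hout := IsBetaSolution.out_eq_of_equilibrium hP hS hSs (hP.isBetaSolution_neg_invI0Bd β)
    (h.congr (by simp) (by simp)) hφ hφ' ht
  rw [hKd t ht, causalConv_congr_left (fun s hs => hKd s hs.le) ht,
    hP.out_neg hP.invI0Bd_mem, hP.out_invI0Bd] at hout
  linarith

/-! ### The error map of the iteration -/

/-- The solution of the regularized system with input `v`, no disturbance and initial state `0`. -/
def Admissible.zeroStateSolution (hP : P.Admissible) (β : ℝ) (v : ℝ≥0 →ᵇ ℝ) : ℝ → Z :=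
  (hP.exists_isBetaSolution β (isCb_extend v) (isCb_const 0 0) (Submodule.zero_mem _)).choose

theorem Admissible.isBetaSolution_zeroStateSolution (hP : P.Admissible) (β : ℝ) (v : ℝ≥0 →ᵇ ℝ) :
    P.IsBetaSolution β (extend v) (fun _ => 0) 0 (hP.zeroStateSolution β v) :=
  (hP.exists_isBetaSolution β (isCb_extend v) (isCb_const 0 0) (Submodule.zero_mem _)).choose_spec

/-- The input-output map of the regularized system with initial state `0`. -/
def Admissible.responseMap (hP : P.Admissible) (hS : P.IsBetaSemigroup β S) (hSs : S.ExpStable) :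
    (ℝ≥0 →ᵇ ℝ) →ₗ[ℝ] (ℝ≥0 →ᵇ ℝ) where
  toFun v := ((hP.isBetaSolution_zeroStateSolution β v).isCb_out hP hS hSs (isCb_extend v)
    (isCb_const 0 0)).toBCF
  map_add' v w := eq_of_extend_eq fun t ht => by
    have hv := hP.isBetaSolution_zeroStateSolution β v
    have hw := hP.isBetaSolution_zeroStateSolution β w
    have hsum := hv.add hP hw
    simp only [add_zero] at hsum
    rw [extend_add]
    simp only [IsCb.extend_toBCF _ ht]
    rw [(hP.isBetaSolution_zeroStateSolution β (v + w)).unique hP hsum ht,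
      hP.out_add (hv.mem t ht) (hw.mem t ht)]
  map_smul' a v := eq_of_extend_eq fun t ht => by
    have hv := hP.isBetaSolution_zeroStateSolution β v
    have hsmul := hv.smul hP a
    simp only [smul_zero, mul_zero] at hsmul
    rw [RingHom.id_apply, extend_smul]
    simp only [IsCb.extend_toBCF _ ht]
    rw [(hP.isBetaSolution_zeroStateSolution β (a • v)).unique hP hsmul ht,
      hP.out_smul (hv.mem t ht)]

theorem Admissible.extend_responseMap (hP : P.Admissible) (hS : P.IsBetaSemigroup β S)
    (hSs : S.ExpStable) {v : ℝ≥0 →ᵇ ℝ} {z : ℝ → Z}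
    (h : P.IsBetaSolution β (extend v) (fun _ => 0) 0 z) {t : ℝ} (ht : 0 ≤ t) :
    extend (hP.responseMap hS hSs v) t = P.out (z t) := by
  rw [← (hP.isBetaSolution_zeroStateSolution β v).unique hP h ht]
  exact IsCb.extend_toBCF _ ht

theorem Admissible.commute_responseMap_causalConvBCF (hP : P.Admissible)
    (hS : P.IsBetaSemigroup β S) (hSs : S.ExpStable) {k : ℝ → ℝ} (hk : IntegrableOn k (Ioi 0))
    (hkc : ContinuousOn k (Ici 0)) :
    Commute (hP.responseMap hS hSs) (causalConvBCF hk) := by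
  refine LinearMap.ext fun v => eq_of_extend_eq fun t ht => ?_
  have hv := hP.isBetaSolution_zeroStateSolution β v
  have hkv := hP.isBetaSolution_zeroStateSolution β (causalConvBCF hk v)
  have hkv_conv := hkv.congr (v' := causalConv k (extend v)) (w' := causalConv k fun _ => 0)
    (fun s hs => (extend_causalConvBCF hk v hs).symm) fun s _ => by simp [causalConv]
  rw [Module.End.mul_apply, Module.End.mul_apply, hP.extend_responseMap hS hSs hkv ht,
    hv.out_causalConv hP (isCb_extend v).continuousOn continuousOn_const hkc hkv_conv ht,
    extend_causalConvBCF hk _ ht]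
  exact (causalConv_congr (fun s hs => hP.extend_responseMap hS hSs hv hs) ht).symm

/-- The map `v ↦ v - y`, where `y` is the response to `v` from the initial state `0`; one step of
the iteration applies it to the current error. -/
def Admissible.errMap (hP : P.Admissible) (hS : P.IsBetaSemigroup β S) (hSs : S.ExpStable) :
    Module.End ℝ (ℝ≥0 →ᵇ ℝ) :=
  1 - hP.responseMap hS hSs

theorem Admissible.extend_errMap (hP : P.Admissible) (hS : P.IsBetaSemigroup β S)
    (hSs : S.ExpStable) {v : ℝ≥0 →ᵇ ℝ} {z : ℝ → Z}
    (h : P.IsBetaSolution β (extend v) (fun _ => 0) 0 z) {t : ℝ} (ht : 0 ≤ t) :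
    extend (hP.errMap hS hSs v) t = extend v t - P.out (z t) := by
  rw [← hP.extend_responseMap hS hSs h ht]
  rfl

theorem Admissible.commute_errMap_causalConvBCF (hP : P.Admissible) (hS : P.IsBetaSemigroup β S)
    (hSs : S.ExpStable) {k : ℝ → ℝ} (hk : IntegrableOn k (Ioi 0)) (hkc : ContinuousOn k (Ici 0)) :
    Commute (hP.errMap hS hSs) (causalConvBCF hk) :=
  Commute.sub_left (R := Module.End ℝ (ℝ≥0 →ᵇ ℝ)) (Commute.one_left _)
    (hP.commute_responseMap_causalConvBCF hS hSs hk hkc)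

theorem Admissible.limsupAbsLE_errMap_pow (hP : P.Admissible) (hS : P.IsBetaSemigroup β S)
    (hSs : S.ExpStable) {v : ℝ≥0 →ᵇ ℝ} (hv : LimsupAbsLE (extend v) 0) (n : ℕ) :
    LimsupAbsLE (extend ((hP.errMap hS hSs ^ n) v)) 0 := by
  induction n with
  | zero => simpa using hv
  | succ n ih =>
    rw [pow_succ', Module.End.mul_apply]
    set x := (hP.errMap hS hSs ^ n) v
    have hx := hP.isBetaSolution_zeroStateSolution β x
    have hout := hx.limsupAbsLE_out hP hS hSs (isCb_extend x).continuousOn continuousOn_const ih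
      (limsupAbsLE_zero_of_tendsto tendsto_const_nhds)
    have hdiff := ih.add (hout.const_mul_zero (-1))
    rw [add_zero] at hdiff
    exact hdiff.congr fun t ht => by
      rw [hP.extend_errMap hS hSs hx ht, sub_eq_add_neg, neg_one_mul]

theorem Admissible.errMap_toBCF (hP : P.Admissible) (hβ : 0 < β) (hS : P.IsBetaSemigroup β S)
    (hSs : S.ExpStable) {N : ℕ} {φ : ℝ → ℝ} (hφ : IsCb (N + 1) φ) :
    hP.errMap hS hSs hφ.toBCF = φ 0 • (hP.isCb_K hβ hS hSs).toBCF +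
      causalConvBCF (hP.integrableOn_K hβ hS hSs) hφ.derivWithin.toBCF := by
  refine eq_of_extend_eq fun t ht => ?_
  have hext := hP.isBetaSolution_zeroStateSolution β hφ.toBCF
  have hsol := hext.congr (fun s hs => (hφ.extend_toBCF hs).symm) fun _ _ => rfl
  rw [hP.extend_errMap hS hSs hext ht, hφ.extend_toBCF ht,
    hsol.sub_out_eq hP hβ hS hSs (fun s hs => hφ.hasDerivWithinAt hs)
      hφ.derivWithin.continuousOn ht, extend_add, extend_smul, extend_causalConvBCF _ _ ht,
    IsCb.extend_toBCF _ ht, causalConv_congr (fun s hs => hφ.derivWithin.extend_toBCF hs) ht]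

theorem Admissible.limsupAbsLE_errMap_pow_add_causalConvBCF (hP : P.Admissible)
    (hS : P.IsBetaSemigroup β S) (hSs : S.ExpStable) {k : ℝ → ℝ} (hk : IntegrableOn k (Ioi 0))
    (hkb : IsCb 0 k) (hk₀ : LimsupAbsLE k 0) (a : ℝ) {n : ℕ} {v : ℝ≥0 →ᵇ ℝ} {c : ℝ} (hc : 0 ≤ c)
    (hv : LimsupAbsLE (extend ((hP.errMap hS hSs ^ n) v)) c) :
    LimsupAbsLE (extend ((hP.errMap hS hSs ^ n) (a • hkb.toBCF + causalConvBCF hk v)))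
      ((∫ τ in Ioi (0 : ℝ), |k τ|) * c) := by
  have hcomm := (hP.commute_errMap_causalConvBCF hS hSs hk hkb.continuousOn).pow_left n
  have hkernel := hP.limsupAbsLE_errMap_pow hS hSs (v := hkb.toBCF)
    (hk₀.congr fun t ht => hkb.extend_toBCF ht) n
  have hsum := (hkernel.const_mul_zero a).add (limsupAbsLE_causalConv hk (isCb_extend _) hc hv)
  rw [zero_add] at hsum
  refine hsum.congr fun t ht => ?_
  rw [map_add, map_smul, ← Module.End.mul_apply _ (causalConvBCF hk), hcomm.eq,
    Module.End.mul_apply, extend_add, extend_smul, extend_causalConvBCF hk _ ht]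

theorem Admissible.limsupAbsLE_errMap_pow_toBCF (hP : P.Admissible) (hβ : 0 < β)
    (hS : P.IsBetaSemigroup β S) (hSs : S.ExpStable) {n : ℕ} {φ : ℝ → ℝ} (hφ : IsCb n φ) :
    LimsupAbsLE (extend ((hP.errMap hS hSs ^ n) hφ.toBCF))
      (P.D β S ^ n * limsup (fun t => |iteratedDerivWithin n φ (Ici 0) t|) atTop) := by
  induction n generalizing φ with
  | zero =>
    obtain ⟨M, -, hM⟩ := hφ.exists_bound
    simp only [pow_zero, iteratedDerivWithin_zero, one_mul]
    exact (limsupAbsLE_limsup_of_bound hM).congr fun t ht => hφ.extend_toBCF ht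
  | succ n ih =>
    obtain ⟨M, hM⟩ := hφ.derivWithin.2 n le_rfl
    have hnonneg := mul_nonneg (pow_nonneg (hP.D_pos hβ hS hSs).le n) (limsup_abs_nonneg hM)
    rw [pow_succ, Module.End.mul_apply, hP.errMap_toBCF hβ hS hSs hφ, pow_succ', mul_assoc,
      iteratedDerivWithin_succ']
    exact hP.limsupAbsLE_errMap_pow_add_causalConvBCF hS hSs (hP.integrableOn_K hβ hS hSs) _
      (hP.limsupAbsLE_K hβ hS hSs) _ hnonneg (ih hφ.derivWithin)

end Plant

namespace Plant

variable {Z : Type*} [NormedAddCommGroup Z] [NormedSpace ℝ Z] {P : Plant Z} {β : ℝ}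
  {S : C0Semigroup Z} {r d : ℝ → ℝ} {z₀ : Z} {z : ℕ → ℝ → Z}

theorem IsBetaIteration.mem (h : P.IsBetaIteration β r d z₀ z) (j : ℕ) {t : ℝ} (ht : 0 ≤ t) :
    z j t ∈ P.T.ZPos P.sc := by
  cases j with
  | zero => exact h.zero.mem t ht
  | succ j => exact (h.succ j).mem t ht

theorem err_eq_sub_sum (P : Plant Z) (r : ℝ → ℝ) (z : ℕ → ℝ → Z) (n : ℕ) (t : ℝ) :
    P.err r z n t = r t - ∑ j ∈ Finset.range (n + 1), P.out (z j t) := by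
  induction n with
  | zero => simp [err]
  | succ n ih =>
    simp only [err, ih, Finset.sum_range_succ _ (n + 1), sub_sub]

theorem IsBetaIteration.err_eq (hP : P.Admissible) (h : P.IsBetaIteration β r d z₀ z) (n : ℕ)
    {t : ℝ} (ht : 0 ≤ t) :
    P.err r z n t = r t - P.out (∑ j ∈ Finset.range (n + 1), z j t) := by
  rw [hP.out_sum (fun j => h.mem j ht), P.err_eq_sub_sum]

theorem Dd_nonneg (P : Plant Z) (β : ℝ) (S : C0Semigroup Z) : 0 ≤ P.Dd β S :=
  integral_nonneg fun _ => abs_nonneg _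

variable [CompleteSpace Z]

/-! ### The error estimate -/

theorem IsBetaIteration.isCb_err (hP : P.Admissible) (hS : P.IsBetaSemigroup β S)
    (hSs : S.ExpStable) (h : P.IsBetaIteration β r d z₀ z) (hr : IsCb 0 r) (hd : IsCb 0 d)
    (n : ℕ) : IsCb 0 (P.err r z n) := by
  induction n with
  | zero => exact hr.sub (h.zero.isCb_out hP hS hSs hr hd)
  | succ n ih => exact ih.sub ((h.succ n).isCb_out hP hS hSs ih (isCb_const 0 0))

theorem IsBetaIteration.toBCF_err (hP : P.Admissible) (hS : P.IsBetaSemigroup β S)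
    (hSs : S.ExpStable) (h : P.IsBetaIteration β r d z₀ z) (hr : IsCb 0 r) (hd : IsCb 0 d)
    (n : ℕ) :
    (h.isCb_err hP hS hSs hr hd n).toBCF =
      (hP.errMap hS hSs ^ n) (h.isCb_err hP hS hSs hr hd 0).toBCF := by
  induction n with
  | zero => rfl
  | succ n ih =>
    rw [pow_succ', Module.End.mul_apply, ← ih]
    refine eq_of_extend_eq fun t ht => ?_
    have hsol := (h.succ n).congr
      (fun s hs => (h.isCb_err hP hS hSs hr hd n).extend_toBCF hs) fun _ _ => rfl
    rw [hP.extend_errMap hS hSs hsol ht, IsCb.extend_toBCF _ ht, IsCb.extend_toBCF _ ht, err]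

theorem IsBetaIteration.toBCF_err_zero (hP : P.Admissible) (hS : P.IsBetaSemigroup β S)
    (hSs : S.ExpStable) (h : P.IsBetaIteration β r d z₀ z) {N : ℕ} (hr : IsCb 0 r)
    (hd : IsCb (N + 1) d) :
    (h.isCb_err hP hS hSs hr (hd.mono (Nat.zero_le _)) 0).toBCF =
      (-1 : ℝ) • (hP.isCb_out_op hS hSs h.zero.initial_mem).toBCF +
        hP.errMap hS hSs hr.toBCF + (d 0 • (hP.isCb_Kd hS hSs).toBCF +
          causalConvBCF (hP.integrableOn_Kd hS hSs) hd.derivWithin.toBCF) := by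
  have hop := hP.isBetaSolution_op hS hSs h.zero.initial_mem
  have hzr := hP.isBetaSolution_zeroStateSolution β hr.toBCF
  obtain ⟨zd, hzd⟩ := hP.exists_isBetaSolution β (isCb_const 0 0) (hd.mono (Nat.zero_le _))
    (Submodule.zero_mem _)
  have hsum := (hop.add hP hzr).add hP hzd
  simp only [zero_add, add_zero] at hsum
  refine eq_of_extend_eq fun t ht => ?_
  have hz := (h.zero.congr (fun s hs => hr.extend_toBCF hs) fun _ _ => rfl).unique hP hsum ht
  simp only [IsCb.extend_toBCF _ ht, err, extend_add, extend_smul]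
  rw [hz, hP.out_add ((hop.add hP hzr).mem t ht) (hzd.mem t ht),
    hP.out_add (hop.mem t ht) (hzr.mem t ht),
    hzd.out_eq_Kd hP hS hSs (fun s hs => hd.hasDerivWithinAt hs) hd.derivWithin.continuousOn ht,
    hP.extend_errMap hS hSs hzr ht, extend_causalConvBCF _ _ ht, hr.extend_toBCF ht,
    causalConv_congr (fun s hs => hd.derivWithin.extend_toBCF hs) ht]
  ring

theorem IsBetaIteration.limsupAbsLE_err (hP : P.Admissible) (hβ : 0 < β)
    (hS : P.IsBetaSemigroup β S) (hSs : S.ExpStable) (h : P.IsBetaIteration β r d z₀ z) {n : ℕ}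
    (hr : IsCb (n + 1) r) (hd : IsCb (n + 1) d) :
    LimsupAbsLE (P.err r z n)
      (P.D β S ^ (n + 1) * limsup (fun t => |iteratedDerivWithin (n + 1) r (Ici 0) t|) atTop +
        P.Dd β S * (P.D β S ^ n *
          limsup (fun t => |iteratedDerivWithin (n + 1) d (Ici 0) t|) atTop)) := by
  have hr₀ := hr.mono (Nat.zero_le _)
  have hd₀ := hd.mono (Nat.zero_le _)
  obtain ⟨M, hM⟩ := hd.derivWithin.2 n le_rfl
  have hnonneg := mul_nonneg (pow_nonneg (hP.D_pos hβ hS hSs).le n) (limsup_abs_nonneg hM)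
  have hinitial := hP.limsupAbsLE_errMap_pow hS hSs
    (v := (hP.isCb_out_op hS hSs h.zero.initial_mem).toBCF)
    ((hP.limsupAbsLE_out_op hS hSs h.zero.initial_mem).congr fun t ht => IsCb.extend_toBCF _ ht) n
  have hreference := hP.limsupAbsLE_errMap_pow_toBCF hβ hS hSs hr
  have hdisturbance := hP.limsupAbsLE_errMap_pow_add_causalConvBCF hS hSs
    (hP.integrableOn_Kd hS hSs) (hP.isCb_Kd hS hSs) (hP.limsupAbsLE_Kd hS hSs) (d 0) hnonneg
    (hP.limsupAbsLE_errMap_pow_toBCF hβ hS hSs hd.derivWithin)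
  have hsum := ((hinitial.const_mul_zero (-1)).add hreference).add hdisturbance
  rw [zero_add, ← iteratedDerivWithin_succ'] at hsum
  refine hsum.congr fun t ht => ?_
  rw [← (h.isCb_err hP hS hSs hr₀ hd₀ n).extend_toBCF ht, h.toBCF_err hP hS hSs hr₀ hd₀,
    h.toBCF_err_zero hP hS hSs hr₀ hd, map_add, map_add, map_smul, ← Module.End.mul_apply,
    ← pow_succ, extend_add, extend_add, extend_smul]
  rfl

theorem Admissible.Cn_nonneg (hP : P.Admissible) (hβ : 0 < β) (hS : P.IsBetaSemigroup β S)
    (hSs : S.ExpStable) {n : ℕ} (hr : IsCb n r) (hd : IsCb n d) : 0 ≤ P.Cn β S r d n :=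
  add_nonneg hr.maxLimsup_nonneg
    (mul_nonneg (div_nonneg (P.Dd_nonneg β S) (hP.D_pos hβ hS hSs).le) hd.maxLimsup_nonneg)

theorem IsBetaIteration.limsup_err_le (hP : P.Admissible) (hβ : 0 < β)
    (hS : P.IsBetaSemigroup β S) (hSs : S.ExpStable) (h : P.IsBetaIteration β r d z₀ z) {n : ℕ}
    (hr : IsCb (n + 1) r) (hd : IsCb (n + 1) d) :
    limsup (fun t => |P.err r z n t|) atTop ≤ P.D β S ^ (n + 1) * P.Cn β S r d (n + 1) := by
  have hD := hP.D_pos hβ hS hSs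
  have hDd := P.Dd_nonneg β S
  have hr_le := limsup_le_maxLimsup le_rfl (n := n + 1) r
  have hd_le := limsup_le_maxLimsup le_rfl (n := n + 1) d
  calc limsup (fun t => |P.err r z n t|) atTop
      ≤ _ := (h.limsupAbsLE_err hP hβ hS hSs hr hd).limsup_le
    _ ≤ P.D β S ^ (n + 1) * maxLimsup (n + 1) r +
        P.Dd β S * (P.D β S ^ n * maxLimsup (n + 1) d) := by gcongr
    _ = P.D β S ^ (n + 1) * P.Cn β S r d (n + 1) := by
        rw [Cn]
        field_simp
        ring

theorem IsBetaIteration.limsup_err_le_of_Cn_le (hP : P.Admissible) (hβ : 0 < β)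
    (hS : P.IsBetaSemigroup β S) (hSs : S.ExpStable) (h : P.IsBetaIteration β r d z₀ z) {n : ℕ}
    (hr : IsCb (n + 1) r) (hd : IsCb (n + 1) d) {A α : ℝ}
    (hC : P.Cn β S r d (n + 1) ≤ A * α ^ (n + 1)) :
    limsup (fun t => |P.err r z n t|) atTop ≤ A * (P.D β S * α) ^ (n + 1) :=
  calc limsup (fun t => |P.err r z n t|) atTop
      ≤ P.D β S ^ (n + 1) * P.Cn β S r d (n + 1) := h.limsup_err_le hP hβ hS hSs hr hd
    _ ≤ P.D β S ^ (n + 1) * (A * α ^ (n + 1)) :=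
        mul_le_mul_of_nonneg_left hC (pow_nonneg (hP.D_pos hβ hS hSs).le _)
    _ = A * (P.D β S * α) ^ (n + 1) := by rw [mul_pow, mul_left_comm]

/-! ### Existence of the iteration -/

theorem Admissible.exists_isBetaIteration (hP : P.Admissible) (hS : P.IsBetaSemigroup β S)
    (hSs : S.ExpStable) (hz₀ : z₀ ∈ P.T.ZPos P.sc) (hr : IsCb 0 r) (hd : IsCb 0 d) :
    ∃ z : ℕ → ℝ → Z, P.IsBetaIteration β r d z₀ z := by
  obtain ⟨x, hx⟩ := hP.exists_isBetaSolution β hr hd hz₀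
  have he₀ := hr.sub (hx.isCb_out hP hS hSs hr hd)
  let e (j : ℕ) := (hP.errMap hS hSs ^ j) he₀.toBCF
  let z : ℕ → ℝ → Z := fun
    | 0 => x
    | j + 1 => hP.zeroStateSolution β (e j)
  have herr : ∀ j t, 0 ≤ t → P.err r z j t = extend (e j) t := fun j t ht => by
    induction j with
    | zero => exact (he₀.extend_toBCF ht).symm
    | succ j ih =>
      simp only [err, ih, z]
      rw [← hP.extend_errMap hS hSs (hP.isBetaSolution_zeroStateSolution β (e j)) ht,
        ← Module.End.mul_apply, ← pow_succ']
  exact ⟨z, hx, fun j => (hP.isBetaSolution_zeroStateSolution β (e j)).congr (herr j)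
    fun _ _ => rfl⟩

/-! ### Practical regulation -/

theorem IsBetaIteration.isCb_totalCtrl (hP : P.Admissible) (hS : P.IsBetaSemigroup β S)
    (hSs : S.ExpStable) (h : P.IsBetaIteration β r d z₀ z) (hr : IsCb 0 r) (hd : IsCb 0 d)
    (n : ℕ) : IsCb 0 (P.totalCtrl β r d z n) := by
  refine IsCb.sum fun j _ => ?_
  cases j with
  | zero =>
    have hout := h.zero.isCb_out hP hS hSs hr hd
    exact (((hr.const_mul _).sub (hout.const_mul _)).add (hd.const_mul _)).const_mul _
  | succ j =>
    have herr := h.isCb_err hP hS hSs hr hd j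
    have hout := (h.succ j).isCb_out hP hS hSs herr (isCb_const 0 0)
    exact ((herr.const_mul _).sub (hout.const_mul _)).const_mul _

theorem IsBetaIteration.isSolution (hP : P.Admissible) (h : P.IsBetaIteration β r d z₀ z) (n : ℕ) :
    P.IsSolution (P.totalCtrl β r d z n) d z₀
      (fun t => ∑ j ∈ Finset.range (n + 1), z j t) := by
  induction n with
  | zero =>
    simp only [zero_add, Finset.sum_range_one]
    refine ⟨h.zero.continuousOn, h.zero.initial, fun t ht => ?_⟩
    convert h.zero.equation t ht using 1
    rw [totalCtrl, invI0Bd, hP.invB_eq]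
    simp only [zero_add, Finset.sum_range_one, ctrl]
    module
  | succ n ih =>
    simp only [Finset.sum_range_succ _ (n + 1)]
    refine ⟨ih.continuousOn.add (h.succ n).continuousOn, ?_, fun t ht => ?_⟩
    · rw [ih.initial, (h.succ n).initial, add_zero]
    · simp only [map_add]
      convert (ih.equation t ht).fun_add ((h.succ n).equation t ht) using 1
      rw [totalCtrl, Finset.sum_range_succ _ (n + 1), ← totalCtrl, ctrl, hP.invB_eq]
      module

theorem Admissible.exists_isSolution (hP : P.Admissible) {u : ℝ → ℝ} (hu : ContinuousOn u (Ici 0))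
    (hd : ContinuousOn d (Ici 0)) (z₀ : Z) : ∃ z, P.IsSolution u d z₀ z :=
  ⟨P.mild P.invBin P.invBd u d z₀,
    continuousOn_mild hP.integrableOn_inputKernel_invBin hP.integrableOn_inputKernel_invBd hu hd z₀,
    P.mild_zero _ _ _ _ _, fun t ht => by
      rw [add_assoc]
      exact hP.hasDerivWithinAt_mild hP.integrableOn_inputKernel_invBin
        hP.integrableOn_inputKernel_invBd hu hd z₀ ht⟩

theorem IsSolution.eq_add_op (hP : P.Admissible) {u : ℝ → ℝ} {x₀ x₀' : Z} {x x' : ℝ → Z}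
    (h : P.IsSolution u d x₀ x) (h' : P.IsSolution u d x₀' x') {t : ℝ} (ht : 0 ≤ t) :
    x' t = x t + P.T.op t (x₀' - x₀) := by
  refine hP.eq_of_hasDerivWithinAt_inv (F := fun t => u t • P.invBin + d t • P.invBd)
    (z := x') (z' := fun t => x t + P.T.op t (x₀' - x₀))
    (fun s hs => ?_) (fun s hs => ?_) ?_ ht
  · rw [← add_assoc]
    exact h'.equation s hs
  · simp only [map_add]
    convert (h.equation s hs).fun_add (hP.hasDerivWithinAt_inv_op (x₀' - x₀) hs) using 1
    abel
  · rw [P.T.op_zero_apply, h.initial, h'.initial, add_sub_cancel]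

theorem Admissible.op_eq_negPowC (hP : P.Admissible) {t : ℝ} (ht : 0 < t) (x : Z) :
    P.T.op t x = P.negPowC (P.T.powOp P.sc t x) :=
  (C0Semigroup.negPow_powOp hP.expStable hP.analytic hP.sc_nonneg hP.sc_lt_one.le ht x).symm

theorem Admissible.op_mem (hP : P.Admissible) {t : ℝ} (ht : 0 < t) (x : Z) :
    P.T.op t x ∈ P.T.ZPos P.sc := by
  rw [hP.op_eq_negPowC ht]
  exact P.negPowC_mem _

theorem Admissible.tendsto_out_op (hP : P.Admissible) (x : Z) :
    Tendsto (fun t => P.out (P.T.op t x)) atTop (𝓝 0) := by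
  have hlim := (hP.outNegPowC.continuous.tendsto 0).comp ((hP.expStable.tendsto_op_atTop
    (P.T.powOp P.sc 1 x)).comp (tendsto_atTop_add_const_right atTop (-1) tendsto_id))
  rw [map_zero] at hlim
  refine hlim.congr' ?_
  filter_upwards [eventually_ge_atTop 1] with t ht
  have ht' : 0 ≤ t + -1 := by linarith
  have hsplit := P.T.op_add_apply ht' zero_le_one x
  rw [neg_add_cancel_right] at hsplit
  rw [hsplit, hP.op_eq_negPowC one_pos, ← hP.negPowC_op ht', hP.out_negPowC]
  rfl

/-- Two solutions driven by the same control differ by `e^{At} x`, so the initial state does not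
affect the asymptotics of the output. -/
theorem IsBetaIteration.solvesPracticalRegulation (hP : P.Admissible)
    (hS : P.IsBetaSemigroup β S) (hSs : S.ExpStable) (h : P.IsBetaIteration β r d z₀ z)
    (hr : IsCb 0 r) (hd : IsCb 0 d) {n : ℕ} {ε : ℝ}
    (hε : limsup (fun t => |P.err r z n t|) atTop ≤ ε) :
    P.SolvesPracticalRegulation r d ε (P.totalCtrl β r d z n) := by
  have hu := h.isCb_totalCtrl hP hS hSs hr hd n
  obtain ⟨M, -, hM⟩ := hu.exists_bound
  refine ⟨hu.continuousOn, ⟨M, hM⟩, fun x₀ =>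
    ⟨hP.exists_isSolution hu.continuousOn hd.continuousOn x₀, fun x hx => ?_⟩⟩
  have hsum := h.isSolution hP n
  have hsum_mem : ∀ t, 0 ≤ t → ∑ j ∈ Finset.range (n + 1), z j t ∈ P.T.ZPos P.sc :=
    fun t ht => Submodule.sum_mem _ fun j _ => h.mem j ht
  have hmem : ∀ t, 0 < t → x t ∈ P.T.ZPos P.sc := fun t ht => by
    rw [hsum.eq_add_op hP hx ht.le]
    exact Submodule.add_mem _ (hsum_mem t ht.le) (hP.op_mem ht _)
  obtain ⟨Me, -, hMe⟩ := (h.isCb_err hP hS hSs hr hd n).exists_bound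
  have hadd := (limsupAbsLE_limsup_of_bound hMe).add
    ((limsupAbsLE_zero_of_tendsto (hP.tendsto_out_op (x₀ - z₀))).const_mul_zero (-1))
  rw [add_zero] at hadd
  have herr : LimsupAbsLE (fun t => r t - P.out (x t))
      (limsup (fun t => |P.err r z n t|) atTop) := fun δ hδ => by
    filter_upwards [hadd δ hδ, eventually_gt_atTop 0] with t hle ht
    rwa [hsum.eq_add_op hP hx ht.le, hP.out_add (hsum_mem t ht.le) (hP.op_mem ht _), ← sub_sub,
      ← h.err_eq hP n ht.le, sub_eq_add_neg, ← neg_one_mul]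
  exact ⟨hmem, herr.isBoundedUnder, herr.limsup_le.trans hε⟩

end Plant

theorem antitone_and_tendsto_const_mul_pow {A q : ℝ} (hA : 0 ≤ A) (hAq : 0 ≤ A * q) (hq : q < 1) :
    Antitone (fun n : ℕ => A * q ^ n) ∧ Tendsto (fun n : ℕ => A * q ^ n) atTop (𝓝 0) := by
  rcases hA.eq_or_lt with rfl | hA_pos
  · simp [antitone_const]
  · have hq₀ : 0 ≤ q := nonneg_of_mul_nonneg_right hAq hA_pos
    refine ⟨(pow_right_anti₀ hq₀ hq.le).const_mul hA, ?_⟩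
    simpa using (tendsto_pow_atTop_nhds_zero_of_lt_one hq₀ hq).const_mul A

theorem Plant.Admissible.antitone_and_tendsto_geometric {Z : Type*} [NormedAddCommGroup Z]
    [NormedSpace ℝ Z] [CompleteSpace Z] {P : Plant Z} (hP : P.Admissible) {β : ℝ} (hβ : 0 < β)
    {S : C0Semigroup Z} (hS : P.IsBetaSemigroup β S) (hSs : S.ExpStable) {r d : ℝ → ℝ}
    (hr : IsCb 1 r) (hd : IsCb 1 d) {A α : ℝ} (hC : ∀ n, P.Cn β S r d n ≤ A * α ^ n)
    (hα : P.D β S * α < 1) :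
    Antitone (fun n : ℕ => A * (P.D β S * α) ^ n) ∧
      Tendsto (fun n : ℕ => A * (P.D β S * α) ^ n) atTop (𝓝 0) := by
  have hA : 0 ≤ A := by
    simpa using (hP.Cn_nonneg hβ hS hSs (hr.mono zero_le_one) (hd.mono zero_le_one)).trans (hC 0)
  have hAα : 0 ≤ A * α := by simpa using (hP.Cn_nonneg hβ hS hSs hr hd).trans (hC 1)
  refine antitone_and_tendsto_const_mul_pow hA ?_ hα
  rw [mul_left_comm]
  exact mul_nonneg (hP.D_pos hβ hS hSs).le hAα

end

end Regulation

theorem mainTheorem2_general {Z : Type*} [NormedAddCommGroup Z] [NormedSpace ℝ Z]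
    [CompleteSpace Z] (P : Regulation.Plant Z) (hP : P.Admissible) (β : ℝ) (hβ : 0 < β)
    (S : Regulation.C0Semigroup Z) (hS : P.IsBetaSemigroup β S) (hSs : S.ExpStable)
    (z₀ : Z) (hz₀ : z₀ ∈ P.T.ZPos P.sc)
    (r d : ℝ → ℝ) (hr : Regulation.IsCb 0 r) (hd : Regulation.IsCb 0 d) :
    (IntegrableOn (P.K β S) (Ioi 0) ∧ IntegrableOn (P.Kd β S) (Ioi 0) ∧ 0 < P.D β S) ∧
    (∃ z : ℕ → ℝ → Z, P.IsBetaIteration β r d z₀ z) ∧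
    ∀ z : ℕ → ℝ → Z, P.IsBetaIteration β r d z₀ z →
      (∀ n : ℕ, ∀ t : ℝ, 0 ≤ t →
        P.err r z n t = r t - P.out (∑ j ∈ Finset.range (n + 1), z j t)) ∧
      (∀ n : ℕ, Regulation.IsCb (n + 1) r → Regulation.IsCb (n + 1) d →
        IsBoundedUnder (· ≤ ·) atTop (fun t => |P.err r z n t|) ∧
        limsup (fun t => |P.err r z n t|) atTop ≤
          P.D β S ^ (n + 1) * P.Cn β S r d (n + 1)) ∧
      ((∀ N : ℕ, Regulation.IsCb N r ∧ Regulation.IsCb N d) →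
        ∀ A α : ℝ, (∀ n : ℕ, P.Cn β S r d n ≤ A * α ^ n) → P.D β S * α < 1 →
          (∀ n : ℕ, limsup (fun t => |P.err r z n t|) atTop ≤ A * (P.D β S * α) ^ (n + 1) ∧
            A * (P.D β S * α) ^ (n + 1) ≤ A * (P.D β S * α) ^ n) ∧
          Tendsto (fun n : ℕ => A * (P.D β S * α) ^ n) atTop (𝓝 0) ∧
          Tendsto (fun n : ℕ => limsup (fun t => |P.err r z n t|) atTop) atTop (𝓝 0) ∧
          ∀ ε : ℝ, 0 < ε → ∃ N : ℕ, ∀ n : ℕ, N ≤ n →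
            P.SolvesPracticalRegulation r d ε (P.totalCtrl β r d z n)) := by
  refine ⟨⟨hP.integrableOn_K hβ hS hSs, hP.integrableOn_Kd hS hSs, hP.D_pos hβ hS hSs⟩,
    hP.exists_isBetaIteration hS hSs hz₀ hr hd, fun z h =>
    ⟨fun n t ht => h.err_eq hP n ht, fun n hr' hd' =>
      ⟨(h.limsupAbsLE_err hP hβ hS hSs hr' hd').isBoundedUnder,
        h.limsup_err_le hP hβ hS hSs hr' hd'⟩, fun hcb A α hC hα => ?_⟩⟩
  obtain ⟨hanti, hgeom⟩ :=
    hP.antitone_and_tendsto_geometric hβ hS hSs (hcb 1).1 (hcb 1).2 hC hα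
  have hle n : limsup (fun t => |P.err r z n t|) atTop ≤ A * (P.D β S * α) ^ (n + 1) :=
    h.limsup_err_le_of_Cn_le hP hβ hS hSs (hcb (n + 1)).1 (hcb (n + 1)).2 (hC (n + 1))
  have hlim : Tendsto (fun n => limsup (fun t => |P.err r z n t|) atTop) atTop (𝓝 0) := by
    refine squeeze_zero (fun n => ?_) (fun n => (hle n).trans (hanti n.le_succ)) hgeom
    obtain ⟨M, -, hM⟩ := (h.isCb_err hP hS hSs hr hd n).exists_bound
    exact Regulation.limsup_abs_nonneg hM
  refine ⟨fun n => ⟨hle n, hanti n.le_succ⟩, hgeom, hlim, fun ε hε => ?_⟩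
  obtain ⟨N, hN⟩ := eventually_atTop.1 (hlim.eventually_le_const hε)
  exact ⟨N, fun n hn => h.solvesPracticalRegulation hP hS hSs hr hd (hN n hn)⟩

theorem mainTheorem2 {Z : Type*} [NormedAddCommGroup Z] [InnerProductSpace ℝ Z] [CompleteSpace Z]
    (P : Regulation.Plant Z) (hP : P.Standing)
    (β : ℝ) (hβ₀ : 0 < β) (hβ₁ : β < 1)
    (S : Regulation.C0Semigroup Z) (hS : P.IsBetaSemigroup β S) (hSstable : S.ExpStable)
    (z₀ : Z) (hz₀ : z₀ ∈ P.T.ZPos P.sc)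
    (r d : ℝ → ℝ) (hr : Regulation.IsCb 0 r) (hd : Regulation.IsCb 0 d) :
    -- the constants `D > 0` and `D_d` are well defined, and the β-iteration has a solution
    (IntegrableOn (P.K β S) (Ioi 0) ∧ IntegrableOn (P.Kd β S) (Ioi 0) ∧ 0 < P.D β S) ∧
    (∃ z : ℕ → ℝ → Z, P.IsBetaIteration β r d z₀ z) ∧
    ∀ z : ℕ → ℝ → Z, P.IsBetaIteration β r d z₀ z →
      (∀ n : ℕ, ∀ t : ℝ, 0 ≤ t →
        P.err r z n t = r t - P.out (∑ j ∈ Finset.range (n + 1), z j t)) ∧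
      -- the error estimate
      (∀ n : ℕ, Regulation.IsCb (n + 1) r → Regulation.IsCb (n + 1) d →
        IsBoundedUnder (· ≤ ·) atTop (fun t => |P.err r z n t|) ∧
        limsup (fun t => |P.err r z n t|) atTop ≤
          P.D β S ^ (n + 1) * P.Cn β S r d (n + 1)) ∧
      -- convergence, and solution of the practical regulation problem
      ((∀ N : ℕ, Regulation.IsCb N r ∧ Regulation.IsCb N d) →
        ∀ A α : ℝ, (∀ n : ℕ, P.Cn β S r d n ≤ A * α ^ n) → P.D β S * α < 1 →
          (∀ n : ℕ, limsup (fun t => |P.err r z n t|) atTop ≤ A * (P.D β S * α) ^ (n + 1) ∧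
            A * (P.D β S * α) ^ (n + 1) ≤ A * (P.D β S * α) ^ n) ∧
          Tendsto (fun n : ℕ => A * (P.D β S * α) ^ n) atTop (𝓝 0) ∧
          Tendsto (fun n : ℕ => limsup (fun t => |P.err r z n t|) atTop) atTop (𝓝 0) ∧
          ∀ ε : ℝ, 0 < ε → ∃ N : ℕ, ∀ n : ℕ, N ≤ n →
            P.SolvesPracticalRegulation r d ε (P.totalCtrl β r d z n)) :=
  mainTheorem2_general P hP.admissible β hβ₀ S hS hSstable z₀ hz₀ r d hr hd
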